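/- Let $\alpha\ge 0$ and $\lambda>0$. Write $\widehat f(p)=(2\pi)^{-3/2}\int_{\mathbb R^3}e^{-ip\cdot x}f(x)\,dx$ for the unitary Fourier transform on $L^2(\mathbb R^3)$, and let $(-\Delta+\lambda)^{\sigma}$ be the Fourier multiplier $(p^2+\lambda)^{\sigma}$. For $s\in(\tfrac12,2)$ and $f\in H^s(\mathbb R^3)$ set $$c_f(t)=\frac1{(2\pi)^{3/2}}\int_{\mathbb R^3}\frac{(p^2+\lambda)^{s/2}}{p^2+\lambda+t}\,\widehat f(p)\,dp\quad(t\ge 0),\qquad q_f=4\sin\tfrac{s\pi}2\int_0^{\infty}\frac{t^{-s/2}c_f(t)}{4\pi\alpha+\sqrt{\lambda+t}}\,dt,$$ $$\widehat{w_f}(p)=-\frac1{p^2+\lambda}\,\frac{4\sin\frac{s\pi}2}{(2\pi)^{3/2}}\int_0^{\infty}\frac{t^{1-s/2}c_f(t)}{4\pi\alpha+\sqrt{\lambda+t}}\,\frac{dt}{p^2+\lambda+t},$$ and $\mathcal R_sf=f+w_f$, $\mathcal Q_sf=q_f$. Further let $J_\lambda$ and $\mathcal G_\lambda$ (which depend on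 $s$) be given by $$\widehat{J_\lambda}(p)=\frac{\sin\frac{s\pi}2}{\pi(2\pi)^{3/2}}\int_0^\infty\frac{t^{s/2-1}\phi(t)}{p^2+\lambda+t}\,dt,\quad \phi(t)=\frac{4\pi\alpha+\sqrt\lambda}{4\pi\alpha+\sqrt{\lambda+t}},\qquad \widehat{\mathcal G_\lambda}(p)=\frac{4\sin\frac{s\pi}2}{(2\pi)^{3/2}}\int_0^\infty\frac{t^{-s/2}\,dt}{(4\pi\alpha+\sqrt{\lambda+t})(p^2+\lambda+t)}.$$ For every $s\in(\tfrac12,2)$ all integrals defining $c_f(t)$ $(t\ge0)$, $q_f$ and $\widehat{w_f}(p)$ $(p\in\mathbb R^3)$ converge absolutely, and $\mathcal R_s:H^s(\mathbb R^3)\to H^s(\mathbb R^3)$ and $\mathcal Q_s:H^s(\mathbb R^3)\to\mathbb C$ are well-defined linear maps. Moreover: (i) If $s\in(\frac12,\frac32)$, then $\mathcal R_s$ and $\mathcal Q_s$ are surjective and not injective, and there are functions in $\ker\mathcal R_s\setminus\ker\mathcal Q_s$ and functions in $\ker\mathcal Q_s\setminus\ker\mathcal R_s$. (ii) If $s\in(\frac12,\frac32)$,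 then $J_\lambda$ is a well-defined element of $L^2(\mathbb R^3)$, and $f_\star:=(-\Delta+\lambda)^{-s/2}J_\lambda$ is a non-zero element of $H^s(\mathbb R^3)$ with $\mathcal R_sf_\star=0$ and $\mathcal Q_sf_\star=1$. (iii) If $s\in(\frac12,2)$, then $\mathcal G_\lambda$ is a well-defined element of $L^2(\mathbb R^3)$ and $\ker\mathcal Q_s=(-\Delta+\lambda)^{-s/2}\big(\{\mathcal G_\lambda\}^{\perp}\big)$, where $\perp$ is the orthogonal complement in $L^2(\mathbb R^3)$. (iv) If $s=\frac32$, then $\mathcal R_{3/2}$ is injective and not surjective, and $\mathcal Q_{3/2}$ is surjective and not injective. (v) If $s\in(\frac32,2)$, then $\mathcal R_s$ is a bijection of $H^s(\mathbb R^3)$ onto itself, and $\mathcal Q_s$ is surjective and not injective. -/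

import Mathlib

open MeasureTheory Set
open scoped FourierTransform SchwartzMap

noncomputable section

namespace FractionalMaps

/-- Three-dimensional Euclidean space. -/
abbrev R3 : Type := EuclideanSpace ℝ (Fin 3)

/-- The complex Hilbert space `L²(ℝ³)`. -/
abbrev L2 : Type := Lp ℂ 2 (volume : Measure R3)

/-! ### The unitary Fourier transform in angular-frequency variables -/

/-- The Fourier transform `f̂(p) = (2π)^{-3/2} ∫ e^{-i p·x} f(x) dx` of an `L²` function, obtained
from Mathlib's transform `𝓕 f (ξ) = ∫ e^{-2π i ξ·x} f(x) dx` by `p = 2πξ`. (A representative,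
well defined up to null sets.) -/
def hat (f : L2) (p : R3) : ℂ :=
  (((2 * Real.pi) ^ (-(3 / 2) : ℝ) : ℝ) : ℂ) * (𝓕 f : L2) ((2 * Real.pi)⁻¹ • p)

theorem quasiMeasurePreserving_smul {r : ℝ} (hr : r ≠ 0) :
    Measure.QuasiMeasurePreserving (fun p : R3 => r • p) volume volume := by
  refine ⟨by fun_prop, ?_⟩
  rw [Measure.map_addHaar_smul _ hr]
  exact Measure.smul_absolutelyContinuous

theorem memLp_comp_smul {u : R3 → ℂ} (hu : MemLp u 2 volume) {r : ℝ} (hr : r ≠ 0) :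
    MemLp (fun p => u (r • p)) 2 volume := by
  have h : MemLp u 2 (Measure.map (fun p : R3 => r • p) volume) := by
    rw [Measure.map_addHaar_smul _ hr]
    exact hu.smul_measure ENNReal.ofReal_ne_top
  exact h.comp_of_map (by fun_prop)

theorem memLp_dilate {u : R3 → ℂ} (hu : MemLp u 2 volume) :
    MemLp (fun ξ => (((2 * Real.pi) ^ (3 / 2 : ℝ) : ℝ) : ℂ) * u ((2 * Real.pi) • ξ)) 2 volume :=
  (memLp_comp_smul hu (by positivity)).const_mul _

open Classical in
/-- The `L²` function with Fourier transform `u`, for square integrable `u`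
(and `0` when `u` is not square integrable). -/
def ofHat (u : R3 → ℂ) : L2 :=
  if hu : MemLp u 2 volume then 𝓕⁻ ((memLp_dilate hu).toLp _ : L2) else 0

theorem hat_ofHat {u : R3 → ℂ} (hu : MemLp u 2 volume) : hat (ofHat u) =ᵐ[volume] u := by
  have hpi : (0 : ℝ) < 2 * Real.pi := by positivity
  have h1 : (𝓕 (ofHat u) : L2) = (memLp_dilate hu).toLp _ := by
    simp only [ofHat, dif_pos hu]
    exact FourierTransform.fourier_fourierInv_eq _
  have h2 := (quasiMeasurePreserving_smul (inv_ne_zero hpi.ne')).ae_eq_comp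
    ((memLp_dilate hu).coeFn_toLp)
  filter_upwards [h2] with p hp
  simp only [Function.comp_apply] at hp
  rw [hat, h1, hp, smul_smul, mul_inv_cancel₀ hpi.ne', one_smul, ← mul_assoc, ← Complex.ofReal_mul,
    ← Real.rpow_add hpi]
  norm_num

/-! ### Sobolev spaces and powers of `-Δ + lam` -/

/-- The Sobolev space `H^s(ℝ³)`, `s ≥ 0`, as a subspace of `L²(ℝ³)`. -/
def Hs (s : ℝ) : Submodule ℂ L2 where
  carrier := {f | TemperedDistribution.MemSobolev s 2 (f : 𝓢'(R3, ℂ))}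
  zero_mem' := by
    have h : ((0 : L2) : 𝓢'(R3, ℂ)) = 0 := by
      rw [← Lp.toTemperedDistributionCLM_apply, map_zero]
    simp only [mem_ofPred_eq, h, TemperedDistribution.memSobolev_fun_zero]
  add_mem' := by
    intro f g hf hg
    have h : ((f + g : L2) : 𝓢'(R3, ℂ)) = (f : 𝓢'(R3, ℂ)) + (g : 𝓢'(R3, ℂ)) := by
      simp only [← Lp.toTemperedDistributionCLM_apply, map_add]
    simp only [mem_ofPred_eq, h]
    exact hf.add hg
  smul_mem' := by
    intro c f hf
    have h : ((c • f : L2) : 𝓢'(R3, ℂ)) = c • (f : 𝓢'(R3, ℂ)) := by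
      simp only [← Lp.toTemperedDistributionCLM_apply, map_smul]
    simp only [mem_ofPred_eq, h]
    exact hf.smul c

/-- The bounded operator `(-Δ + lam)^{-s/2}` on `L²(ℝ³)` (for `lam > 0`, `s ≥ 0`), i.e. the Fourier
multiplier `(p² + lam)^{-s/2}`. -/
def invPow (lam s : ℝ) (g : L2) : L2 :=
  ofHat fun p => (((‖p‖ ^ 2 + lam) ^ (-(s / 2)) : ℝ) : ℂ) * hat g p

/-! ### The coefficient `c_f`, the constant `q_f` and the function `w_f` -/

/-- The integrand of `c_f(t)`. -/
def cIntegrand (lam s : ℝ) (f : L2) (t : ℝ) (p : R3) : ℂ :=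
  (((‖p‖ ^ 2 + lam) ^ (s / 2) / (‖p‖ ^ 2 + lam + t) : ℝ) : ℂ) * hat f p

/-- `c_f(t) = (2π)^{-3/2} ∫ (p² + lam)^{s/2} / (p² + lam + t) f̂(p) dp`. -/
def cCoef (lam s : ℝ) (f : L2) (t : ℝ) : ℂ :=
  (((2 * Real.pi) ^ (-(3 / 2) : ℝ) : ℝ) : ℂ) * ∫ p : R3, cIntegrand lam s f t p

/-- The integrand of `q_f`. -/
def qIntegrand (α lam s : ℝ) (f : L2) (t : ℝ) : ℂ :=
  ((t ^ (-(s / 2)) / (4 * Real.pi * α + √(lam + t)) : ℝ) : ℂ) * cCoef lam s f t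

/-- `q_f = 4 sin(sπ/2) ∫₀^∞ t^{-s/2} c_f(t) / (4πα + √(lam + t)) dt`. -/
def qConst (α lam s : ℝ) (f : L2) : ℂ :=
  ((4 * Real.sin (s * Real.pi / 2) : ℝ) : ℂ) * ∫ t in Ioi (0 : ℝ), qIntegrand α lam s f t

/-- The integrand of the integral that defines `ŵ_f(p)`. -/
def wIntegrand (α lam s : ℝ) (f : L2) (p : R3) (t : ℝ) : ℂ :=
  ((t ^ (1 - s / 2) / (4 * Real.pi * α + √(lam + t)) * (1 / (‖p‖ ^ 2 + lam + t)) : ℝ) : ℂ)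
    * cCoef lam s f t

/-- `ŵ_f(p) = - (p² + lam)⁻¹ 4 sin(sπ/2) (2π)^{-3/2}
∫₀^∞ t^{1-s/2} c_f(t) / (4πα + √(lam + t)) / (p² + lam + t) dt`. -/
def wHat (α lam s : ℝ) (f : L2) (p : R3) : ℂ :=
  -(((1 / (‖p‖ ^ 2 + lam)
      * (4 * Real.sin (s * Real.pi / 2) / (2 * Real.pi) ^ (3 / 2 : ℝ)) : ℝ) : ℂ)
    * ∫ t in Ioi (0 : ℝ), wIntegrand α lam s f p t)

/-- The function `w_f`. -/
def wFun (α lam s : ℝ) (f : L2) : L2 := ofHat (wHat α lam s f)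

/-- The fractional map `R_s f = f + w_f`. -/
def fracR (α lam s : ℝ) (f : L2) : L2 := f + wFun α lam s f

/-- The fractional map `Q_s f = q_f`. -/
def fracQ (α lam s : ℝ) (f : L2) : ℂ := qConst α lam s f

/-! ### The functions `J_lam`, `f_⋆` and `𝒢_lam` -/

/-- `φ(t) = (4πα + √lam) / (4πα + √(lam + t))`. -/
def phi (α lam t : ℝ) : ℝ :=
  (4 * Real.pi * α + √lam) / (4 * Real.pi * α + √(lam + t))

/-- The integrand of the integral that defines `Ĵ_lam(p)`. -/
def jIntegrand (α lam s : ℝ) (p : R3) (t : ℝ) : ℝ :=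
  t ^ (s / 2 - 1) * phi α lam t / (‖p‖ ^ 2 + lam + t)

/-- `Ĵ_lam(p) = sin(sπ/2) / (π (2π)^{3/2}) ∫₀^∞ t^{s/2-1} φ(t) / (p² + lam + t) dt`. -/
def jHat (α lam s : ℝ) (p : R3) : ℂ :=
  ((Real.sin (s * Real.pi / 2) / (Real.pi * (2 * Real.pi) ^ (3 / 2 : ℝ))
    * ∫ t in Ioi (0 : ℝ), jIntegrand α lam s p t : ℝ) : ℂ)

/-- The function `J_lam`. -/
def jFun (α lam s : ℝ) : L2 := ofHat (jHat α lam s)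

/-- `f_⋆ = (-Δ + lam)^{-s/2} J_lam`. -/
def fStar (α lam s : ℝ) : L2 := invPow lam s (jFun α lam s)

/-- The integrand of the integral that defines the Fourier transform of `𝒢_lam` at `p`. -/
def gIntegrand (α lam s : ℝ) (p : R3) (t : ℝ) : ℝ :=
  t ^ (-(s / 2)) / ((4 * Real.pi * α + √(lam + t)) * (‖p‖ ^ 2 + lam + t))

/-- The Fourier transform of `𝒢_lam`: `4 sin(sπ/2) (2π)^{-3/2}
∫₀^∞ t^{-s/2} / ((4πα + √(lam + t)) (p² + lam + t)) dt`. -/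
def gHat (α lam s : ℝ) (p : R3) : ℂ :=
  ((4 * Real.sin (s * Real.pi / 2) / (2 * Real.pi) ^ (3 / 2 : ℝ)
    * ∫ t in Ioi (0 : ℝ), gIntegrand α lam s p t : ℝ) : ℂ)

/-- The function `𝒢_lam`. -/
def gFun (α lam s : ℝ) : L2 := ofHat (gHat α lam s)

end FractionalMaps

end

open FractionalMaps

noncomputable section

namespace FractionalMaps

/-! ### Scalar integrals -/

/-! Put σ = s/2, X = p² + lam and ψ_t = (2π)^{-3/2} (p² + lam + t)⁻¹. The maps R_s and Q_s are the
two components of a fractional power of a point interaction resolvent. Let N be multiplication by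
X⁻¹ plus a positive rank-one term along ψ_0. It is bounded, nonnegative and injective, and its
resolvent family (N⁻¹ + t)⁻¹ is again a multiplication operator plus a rank-one term along ψ_t
(`resOp_identity`, which rests on `robin_identity`).

The Balakrishnan formula (`inner_fracPow`) writes N^σ as an integral over t (`fracPow_resOp_ae`).
Splitting ψ_t = ψ_0 (1 - t/(X + t)) gives, for g = X^σ f̂, the decomposition N^σ g = X^{-σ} v + Q
ψ_0, where v = X^σ times the Fourier transform of R_s f and Q = Q_s f (`powFun_eq`). Since ψ_0 does
not lie in X^{-σ} L² when σ ≥ 1/4, the pair (v, Q) is determined by N^σ g.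

The pair is inverted by applying N^{1-σ}: N g = N^{1-σ}(X^{-σ} v + Q ψ_0), and the right side is
computed explicitly. The outcome is `preimage_iff`: f has data (v, Q) iff g = v + E(v, Q), with E
given by the density t^{σ-1} (4πα + √(lam + t))⁻¹ (c Q - t ⟨ψ_t, X^{-σ} v⟩), c = (4πα + √lam)/(4π).
Every statement on R_s becomes the question for which (v, Q) the function E(v, Q) is square
integrable.

If σ < 3/4, it always is, by the Schur test (`memLp_errFun_of_lt`), so all pairs are attained. If σ
≥ 3/4, then E(0, Q) decays no faster than X^{-3/4} unless Q = 0, so R_s is injective. If σ > 3/4,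
one charge cancels the leading term of the density (`memLp_errFun_of_gt`), so R_s is onto. If σ =
3/4, the cancelling charge would be a multiple of ∫ X^{-3/4} v, which diverges for a suitable v in
L², and no charge works (`not_memLp_errFun_critFun`).

The statements on Q_s follow from Fubini: Q_s f = ⟨𝒢, X^{s/2} f̂⟩ on the Fourier side, with 𝒢 ≠ 0 in
L² (`fracQ_invPow`). -/

theorem integrableOn_rpow_div_add {σ x : ℝ} (h0 : 0 < σ) (h1 : σ < 1) (hx : 0 < x) :
    IntegrableOn (fun t : ℝ => t ^ (σ - 1) / (x + t)) (Ioi 0) := by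
  have h := (Real.integrableOn_rpowIntegrand₀₁_Ioi (p := σ) ⟨h0, h1⟩ hx.le).const_mul x⁻¹
  refine IntegrableOn.congr_fun h (fun t ht => ?_) measurableSet_Ioi
  have ht' : (0 : ℝ) < t := ht
  simp only [Real.rpowIntegrand₀₁_eq_pow_div ⟨h0, h1⟩ ht'.le hx.le]
  field_simp
  ring

/-- Inserting 1/(1 + t) = ∫ e^{-(1+t)u} du and exchanging the integrals gives Γ(σ) Γ(1 - σ), which
the reflection formula evaluates. -/
theorem integral_rpow_div_one_add {σ : ℝ} (h0 : 0 < σ) (h1 : σ < 1) :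
    ∫ t in Ioi (0 : ℝ), t ^ (σ - 1) / (1 + t) = Real.pi / Real.sin (Real.pi * σ) := by
  rw [← Real.Gamma_mul_Gamma_one_sub]
  set μ := (volume : Measure ℝ).restrict (Ioi 0)
  let f : ℝ → ℝ → ℝ := fun t u => t ^ (σ - 1) * Real.exp (-(1 + t) * u)
  have hexp : ∀ t : ℝ, 0 < t → IntegrableOn (fun u => Real.exp (-(1 + t) * u)) (Ioi 0) ∧
      ∫ u in Ioi (0 : ℝ), Real.exp (-(1 + t) * u) = (1 + t)⁻¹ := fun t ht => by
    refine ⟨integrableOn_exp_mul_Ioi (by linarith) 0, ?_⟩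
    rw [integral_exp_mul_Ioi (by linarith) 0, mul_zero, Real.exp_zero, neg_div_neg_eq, one_div]
  have hin : ∀ t : ℝ, 0 < t → ∫ u, f t u ∂μ = t ^ (σ - 1) / (1 + t) := fun t ht => by
    simp only [f, integral_const_mul]
    rw [(hexp t ht).2, div_eq_mul_inv]
  have hint : Integrable (Function.uncurry f) (μ.prod μ) := by
    rw [integrable_prod_iff]
    · refine ⟨?_, ?_⟩
      · filter_upwards [ae_restrict_mem measurableSet_Ioi] with t ht
        have h : Integrable (fun u => t ^ (σ - 1) * Real.exp (-(1 + t) * u)) μ :=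
          (hexp t ht).1.const_mul _
        exact h
      · refine (integrableOn_rpow_div_add h0 h1 one_pos).congr ?_
        filter_upwards [ae_restrict_mem measurableSet_Ioi] with t ht
        rw [← hin t ht]
        refine integral_congr_ae (Filter.Eventually.of_forall fun u => ?_)
        have ht' : (0 : ℝ) < t := ht
        simp only [Function.uncurry, f]
        rw [Real.norm_of_nonneg (by positivity)]
    · exact Measurable.aestronglyMeasurable (by fun_prop)
  have hsw := integral_integral_swap hint
  rw [setIntegral_congr_fun measurableSet_Ioi (fun t ht => (hin t ht).symm), hsw]
  have : ∀ u ∈ Ioi (0 : ℝ), ∫ t, f t u ∂μ = Real.Gamma σ * (Real.exp (-u) * u ^ ((1 - σ) - 1)) := by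
    intro u hu
    have hu' : (0 : ℝ) < u := hu
    have h := Real.integral_rpow_mul_exp_neg_mul_Ioi h0 hu'
    have e : ∀ t, f t u = Real.exp (-u) * (t ^ (σ - 1) * Real.exp (-(u * t))) := fun t => by
      simp only [f]
      rw [show -(1 + t) * u = -u + -(u * t) by ring, Real.exp_add]
      ring
    simp only [e, integral_const_mul, h, μ]
    rw [show (1 - σ) - 1 = -σ by ring, Real.rpow_neg hu'.le, one_div, Real.inv_rpow hu'.le]
    ring
  rw [setIntegral_congr_fun measurableSet_Ioi this, integral_const_mul,
    Real.Gamma_eq_integral (by linarith : 0 < 1 - σ)]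

theorem integral_rpow_div_add {σ x : ℝ} (h0 : 0 < σ) (h1 : σ < 1) (hx : 0 < x) :
    ∫ t in Ioi (0 : ℝ), t ^ (σ - 1) / (x + t) = Real.pi / Real.sin (Real.pi * σ) * x ^ (σ - 1) := by
  have h := Real.integral_rpowIntegrand₀₁_eq_rpow_mul_const (p := σ) ⟨h0, h1⟩ hx.le
  have e : ∀ y : ℝ, 0 < y → ∫ t in Ioi (0 : ℝ), Real.rpowIntegrand₀₁ σ t y
      = y * ∫ t in Ioi (0 : ℝ), t ^ (σ - 1) / (y + t) := fun y hy => by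
    rw [← integral_const_mul]
    refine setIntegral_congr_fun measurableSet_Ioi fun t ht => ?_
    have ht' : (0 : ℝ) < t := ht
    simp only [Real.rpowIntegrand₀₁_eq_pow_div ⟨h0, h1⟩ ht'.le hy.le]
    field_simp
    ring
  rw [e x hx, e 1 one_pos, integral_rpow_div_one_add h0 h1] at h
  rw [Real.rpow_sub_one hx.ne']
  field_simp at h ⊢
  linarith

theorem sin_pi_mul_pos {σ : ℝ} (h0 : 0 < σ) (h1 : σ < 1) : 0 < Real.sin (Real.pi * σ) :=
  Real.sin_pos_of_pos_of_lt_pi (by positivity) (by nlinarith [Real.pi_pos])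

/-! ### Radial integrals over ℝ³ -/

theorem integral_inv_sq_add_sq {a : ℝ} (ha : 0 < a) :
    IntegrableOn (fun r : ℝ => (r ^ 2 + a ^ 2)⁻¹) (Ioi 0) ∧
      ∫ r in Ioi (0 : ℝ), (r ^ 2 + a ^ 2)⁻¹ = Real.pi / (2 * a) := by
  have e : ∀ r : ℝ, (r ^ 2 + a ^ 2)⁻¹ = a⁻¹ ^ 2 * (1 + (a⁻¹ * r) ^ 2)⁻¹ := fun r => by
    field_simp
    ring
  constructor
  · simp only [e]
    refine Integrable.const_mul ?_ _
    exact (integrableOn_Ioi_comp_mul_left_iff (fun x : ℝ => (1 + x ^ 2)⁻¹) 0 (inv_pos.2 ha)).2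
      integrable_inv_one_add_sq.integrableOn
  · simp only [e, integral_const_mul]
    rw [integral_comp_mul_left_Ioi (fun x : ℝ => (1 + x ^ 2)⁻¹) 0 (inv_pos.2 ha)]
    simp only [mul_zero, integral_Ioi_inv_one_add_sq, Real.arctan_zero, smul_eq_mul]
    field_simp
    ring

theorem integral_radial (f : ℝ → ℝ) :
    ∫ p : R3, f ‖p‖ = 4 * Real.pi * ∫ r in Ioi (0 : ℝ), r ^ 2 * f r := by
  rw [integral_fun_norm_addHaar (volume : Measure R3) f]
  simp [Measure.real, EuclideanSpace.volume_ball_fin_three]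
  have := Real.pi_pos
  rw [ENNReal.toReal_ofReal (by positivity)]
  ring

theorem integrable_radial_iff {f : ℝ → ℝ} :
    Integrable (fun p : R3 => f ‖p‖) ↔ IntegrableOn (fun r => r ^ 2 * f r) (Ioi 0) := by
  rw [integrable_fun_norm_addHaar]
  simp

/-- In polar coordinates this is a partial fraction decomposition, nondegenerate because a ≠ b. It
yields the value of ⟨ψ_0, ψ_t⟩. -/
theorem integral_resolvent_mul_resolvent {a b : ℝ} (hb : 0 < b) (hab : b < a) :
    Integrable (fun p : R3 => ((‖p‖ ^ 2 + a ^ 2) * (‖p‖ ^ 2 + b ^ 2))⁻¹) ∧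
      ∫ p : R3, ((‖p‖ ^ 2 + a ^ 2) * (‖p‖ ^ 2 + b ^ 2))⁻¹ = 2 * Real.pi ^ 2 / (a + b) := by
  have ha : 0 < a := hb.trans hab
  have hne : a ^ 2 - b ^ 2 ≠ 0 := by nlinarith
  have e : ∀ r : ℝ, r ^ 2 * ((r ^ 2 + a ^ 2) * (r ^ 2 + b ^ 2))⁻¹ =
      a ^ 2 / (a ^ 2 - b ^ 2) * (r ^ 2 + a ^ 2)⁻¹ - b ^ 2 / (a ^ 2 - b ^ 2) * (r ^ 2 + b ^ 2)⁻¹ :=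
    fun r => by
      have h1 : r ^ 2 + a ^ 2 ≠ 0 := by positivity
      have h2 : r ^ 2 + b ^ 2 ≠ 0 := by positivity
      field_simp
      ring
  obtain ⟨ia, va⟩ := integral_inv_sq_add_sq ha
  obtain ⟨ib, vb⟩ := integral_inv_sq_add_sq hb
  constructor
  · refine (integrable_radial_iff (f := fun r => ((r ^ 2 + a ^ 2) * (r ^ 2 + b ^ 2))⁻¹)).2 ?_
    simp only [e]
    exact (ia.const_mul _).sub (ib.const_mul _)
  · rw [integral_radial (fun r => ((r ^ 2 + a ^ 2) * (r ^ 2 + b ^ 2))⁻¹)]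
    simp only [e]
    rw [integral_sub (ia.const_mul _) (ib.const_mul _), integral_const_mul, integral_const_mul,
      va, vb]
    have h3 : a + b ≠ 0 := by positivity
    have h4 : a - b ≠ 0 := by linarith
    rw [show a ^ 2 - b ^ 2 = (a - b) * (a + b) by ring]
    field_simp
    ring

/-- Spatial half of the Schur test bounds. -/
theorem lintegral_rpow_div_le {lam e : ℝ} (hlam : 0 < lam) (he : 1 / 2 < e) (he' : e < 3 / 2) :
    ∃ C : ℝ, 0 < C ∧ ∀ t : ℝ, 0 < t →
      ∫⁻ p : R3, ENNReal.ofReal ((‖p‖ ^ 2 + lam) ^ (-e) / (‖p‖ ^ 2 + lam + t)) ≤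
        ENNReal.ofReal (C * t ^ (1 / 2 - e)) := by
  have hs := sin_pi_mul_pos (σ := 3 / 2 - e) (by linarith) (by linarith)
  refine ⟨4 * Real.pi * (1 / 2 * (Real.pi / Real.sin (Real.pi * (3 / 2 - e)))), by positivity,
    fun t ht => ?_⟩
  -- The radial integrand with `lam` dropped, a majorant because -e < 0. It is homogeneous: y = r²
  -- turns its integral into the scalar one with exponent 3/2 - e, whence the power t^{1/2 - e}.
  let f : ℝ → ℝ := fun r => r ^ (-(2 * e)) / (t + r ^ 2)
  have h1 := integrableOn_rpow_div_add (σ := 3 / 2 - e) (by linarith) (by linarith) ht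
  have h2 := integral_rpow_div_add (σ := 3 / 2 - e) (by linarith) (by linarith) ht
  have e1 : ∀ r ∈ Ioi (0 : ℝ), (1 / 2 : ℝ) * ((|(2 : ℝ)| * r ^ ((2 : ℝ) - 1)) •
      ((r ^ (2 : ℝ)) ^ ((3 / 2 - e) - 1) / (t + r ^ (2 : ℝ)))) = r ^ 2 * f r := by
    intro r hr
    have hr' : (0 : ℝ) < r := hr
    have : r ^ 2 * r ^ (-(2 * e)) = r * r ^ (2 * (3 / 2 - e - 1)) := by
      rw [← Real.rpow_natCast, ← Real.rpow_add hr']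
      nth_rw 2 [← Real.rpow_one r]
      rw [← Real.rpow_add hr']
      congr 1
      push_cast
      ring
    simp only [f, smul_eq_mul]
    rw [← Real.rpow_mul hr'.le, show (2 : ℝ) - 1 = 1 by norm_num, Real.rpow_one, Real.rpow_two,
      abs_of_pos (by norm_num : (0 : ℝ) < 2), mul_div_assoc', mul_div_assoc', mul_div_assoc', this]
    ring
  have hi : Integrable (fun p : R3 => f ‖p‖) := by
    rw [integrable_radial_iff]
    refine IntegrableOn.congr_fun (f := fun r => (1 / 2 : ℝ) * _) ?_ e1 measurableSet_Ioi
    exact Integrable.const_mul ((integrableOn_Ioi_comp_rpow_iff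
      (fun y => y ^ ((3 / 2 - e) - 1) / (t + y)) (p := 2) (by norm_num)).2 h1) _
  have hv : ∫ p : R3, f ‖p‖ =
      4 * Real.pi * (1 / 2 * (Real.pi / Real.sin (Real.pi * (3 / 2 - e)))) * t ^ (1 / 2 - e) := by
    rw [integral_radial, ← setIntegral_congr_fun measurableSet_Ioi e1, integral_const_mul,
      integral_comp_rpow_Ioi (fun y => y ^ ((3 / 2 - e) - 1) / (t + y)) (by norm_num), h2,
      show 3 / 2 - e - 1 = 1 / 2 - e by ring]
    ring
  rw [← hv, ofReal_integral_eq_lintegral_ofReal hi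
    (Filter.Eventually.of_forall fun p => by simp only [f]; positivity)]
  have h0 : ∀ᵐ p : R3, p ≠ 0 := by
    simp [ae_iff]
  refine lintegral_mono_ae ?_
  filter_upwards [h0] with p hp
  have hp' : 0 < ‖p‖ := norm_pos_iff.2 hp
  refine ENNReal.ofReal_le_ofReal ?_
  simp only [f]
  have : ‖p‖ ^ (-(2 * e)) = (‖p‖ ^ 2) ^ (-e) := by
    rw [← Real.rpow_two, ← Real.rpow_mul hp'.le]
    congr 1
    ring
  rw [this]
  refine div_le_div₀ (by positivity) ?_ (by positivity) (by linarith)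
  exact Real.rpow_le_rpow_of_nonpos (by positivity) (by linarith) (by linarith)

/-! ### The Schur test -/

/-- Cauchy–Schwarz for f = φ^{1/2} · (f φ^{-1/2}) with weight k, then the first bound, Tonelli, and
the second bound. Working in `ENNReal` removes all integrability side conditions. -/
theorem lintegral_schur {A B : Type*} [MeasurableSpace A] [MeasurableSpace B] {μ : Measure A}
    {ν : Measure B} [SFinite μ] [SFinite ν] {k : A → B → ENNReal}
    (hk : Measurable (Function.uncurry k)) {φ : B → ENNReal} (hφ : Measurable φ)
    (hφ0 : ∀ y, φ y ≠ 0) (hφ1 : ∀ y, φ y ≠ ⊤) {ψ : A → ENNReal} (hψ : Measurable ψ)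
    {C₁ C₂ : ENNReal}
    (h1 : ∀ᵐ x ∂μ, ∫⁻ y, k x y * φ y ∂ν ≤ C₁ * ψ x)
    (h2 : ∀ᵐ y ∂ν, ∫⁻ x, k x y * ψ x ∂μ ≤ C₂ * φ y) {f : B → ENNReal} (hf : AEMeasurable f ν) :
    ∫⁻ x, (∫⁻ y, k x y * f y ∂ν) ^ 2 ∂μ ≤ C₁ * C₂ * ∫⁻ y, f y ^ 2 ∂ν := by
  have hkx : ∀ x, Measurable (k x) := fun x => hk.comp measurable_prodMk_left
  have hfφ : AEMeasurable (fun y => f y ^ 2 * (φ y)⁻¹) ν :=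
    (hf.pow_const 2).mul hφ.inv.aemeasurable
  have hkf : ∀ x, AEMeasurable (fun y => k x y * (f y ^ 2 * (φ y)⁻¹)) ν := fun x =>
    (hkx x).aemeasurable.mul hfφ
  have step : ∀ x, (∫⁻ y, k x y * f y ∂ν) ^ 2 ≤
      (∫⁻ y, k x y * φ y ∂ν) * ∫⁻ y, k x y * (f y ^ 2 * (φ y)⁻¹) ∂ν := by
    intro x
    have hh := ENNReal.lintegral_mul_le_Lp_mul_Lq ν (p := 2) (q := 2)
      (Real.HolderConjugate.two_two)
      (f := fun y => (k x y * φ y) ^ (1 / 2 : ℝ))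
      (g := fun y => (k x y * (f y ^ 2 * (φ y)⁻¹)) ^ (1 / 2 : ℝ))
      (((hkx x).mul hφ).aemeasurable.pow_const _)
      ((hkf x).pow_const _)
    have e : ∀ y, ((fun y => (k x y * φ y) ^ (1 / 2 : ℝ)) *
        fun y => (k x y * (f y ^ 2 * (φ y)⁻¹)) ^ (1 / 2 : ℝ)) y = k x y * f y := by
      intro y
      simp only [Pi.mul_apply]
      rw [← ENNReal.mul_rpow_of_nonneg _ _ (by norm_num)]
      have : k x y * φ y * (k x y * (f y ^ 2 * (φ y)⁻¹)) = (k x y * f y) ^ (2 : ℝ) := by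
        rw [ENNReal.rpow_two]
        calc _ = (k x y * f y) ^ 2 * (φ y * (φ y)⁻¹) := by ring
          _ = _ := by rw [ENNReal.mul_inv_cancel (hφ0 y) (hφ1 y), mul_one]
      rw [this, ← ENNReal.rpow_mul]
      norm_num
    simp only [e, ← ENNReal.rpow_mul] at hh
    norm_num at hh
    calc (∫⁻ y, k x y * f y ∂ν) ^ 2 ≤ _ := pow_le_pow_left' hh 2
      _ = _ := by
        rw [mul_pow, ← ENNReal.rpow_two, ← ENNReal.rpow_two, ← ENNReal.rpow_mul,
          ← ENNReal.rpow_mul]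
        norm_num
  have hmeas : AEMeasurable (Function.uncurry fun x y => ψ x * (k x y * (f y ^ 2 * (φ y)⁻¹)))
      (μ.prod ν) := by
    refine (hψ.comp measurable_fst).aemeasurable.mul (hk.aemeasurable.mul ?_)
    exact ((hf.comp_quasiMeasurePreserving Measure.quasiMeasurePreserving_snd).pow_const 2).mul
      (hφ.inv.comp measurable_snd).aemeasurable
  calc ∫⁻ x, (∫⁻ y, k x y * f y ∂ν) ^ 2 ∂μ
      ≤ ∫⁻ x, C₁ * ∫⁻ y, ψ x * (k x y * (f y ^ 2 * (φ y)⁻¹)) ∂ν ∂μ := by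
        refine lintegral_mono_ae ?_
        filter_upwards [h1] with x hx
        rw [lintegral_const_mul'' _ (hkf x), ← mul_assoc]
        exact (step x).trans (mul_le_mul_left hx _)
    _ = C₁ * ∫⁻ x, ∫⁻ y, ψ x * (k x y * (f y ^ 2 * (φ y)⁻¹)) ∂ν ∂μ :=
        lintegral_const_mul'' _ hmeas.lintegral_prod_right'
    _ = C₁ * ∫⁻ y, ∫⁻ x, ψ x * (k x y * (f y ^ 2 * (φ y)⁻¹)) ∂μ ∂ν := by
        rw [lintegral_lintegral_swap hmeas]
    _ ≤ C₁ * ∫⁻ y, C₂ * f y ^ 2 ∂ν := by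
        refine mul_le_mul_right (lintegral_mono_ae ?_) _
        filter_upwards [h2] with y hy
        calc ∫⁻ x, ψ x * (k x y * (f y ^ 2 * (φ y)⁻¹)) ∂μ
            = ∫⁻ x, k x y * ψ x * (f y ^ 2 * (φ y)⁻¹) ∂μ := by
              congr 1; ext x; ring
          _ = (∫⁻ x, k x y * ψ x ∂μ) * (f y ^ 2 * (φ y)⁻¹) := by
              rw [lintegral_mul_const]
              exact (hk.comp measurable_prodMk_right).mul hψ
          _ ≤ C₂ * φ y * (f y ^ 2 * (φ y)⁻¹) := mul_le_mul_left hy _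
          _ = C₂ * f y ^ 2 * (φ y * (φ y)⁻¹) := by ring
          _ = _ := by rw [ENNReal.mul_inv_cancel (hφ0 y) (hφ1 y), mul_one]
    _ = C₁ * C₂ * ∫⁻ y, f y ^ 2 ∂ν := by
        rw [lintegral_const_mul'' _ (hf.pow_const 2), mul_assoc]

/-! ### The resolvent kernel -/

/-- The resolvent kernel `(p² + lam + t)⁻¹`. -/
def rk (lam t : ℝ) (p : R3) : ℝ := (‖p‖ ^ 2 + lam + t)⁻¹

/-- Lebesgue measure on the positive half-line. -/
abbrev vol0 : Measure ℝ := volume.restrict (Ioi 0)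

theorem measurable_rk (lam : ℝ) : Measurable fun z : ℝ × R3 => rk lam z.1 z.2 := by
  unfold rk; fun_prop

theorem continuous_rk {lam t : ℝ} (hlam : 0 < lam) (ht : 0 ≤ t) : Continuous (rk lam t) := by
  unfold rk
  refine Continuous.inv₀ (by fun_prop) fun p => by positivity

theorem rk_pos {lam t : ℝ} (hlam : 0 < lam) (ht : 0 ≤ t) (p : R3) : 0 < rk lam t p := by
  unfold rk; positivity

theorem rk_le {lam t : ℝ} (hlam : 0 < lam) (ht : 0 ≤ t) (p : R3) : rk lam t p ≤ (lam + t)⁻¹ := by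
  unfold rk
  exact inv_anti₀ (by positivity) (by nlinarith [sq_nonneg ‖p‖])

theorem rk_le_zero {lam t : ℝ} (hlam : 0 < lam) (ht : 0 ≤ t) (p : R3) :
    rk lam t p ≤ rk lam 0 p := by
  unfold rk
  exact inv_anti₀ (by positivity) (by linarith)

theorem continuous_symbol {lam : ℝ} (hlam : 0 < lam) (e : ℝ) :
    Continuous fun p : R3 => (‖p‖ ^ 2 + lam) ^ e := by
  refine Continuous.rpow_const (by fun_prop) fun p => Or.inl (by positivity)

theorem integrable_symbol {lam e : ℝ} (hlam : 0 < lam) (he : 3 / 2 < e) :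
    Integrable fun p : R3 => (‖p‖ ^ 2 + lam) ^ (-e) := by
  have h := integrable_rpow_neg_one_add_norm_sq (E := R3) (μ := volume) (r := 2 * e)
    (by simp; linarith)
  have hm : 0 < min 1 lam := lt_min one_pos hlam
  refine (h.const_mul ((min 1 lam) ^ (-e))).mono'
    (continuous_symbol hlam _).aestronglyMeasurable (Filter.Eventually.of_forall fun p => ?_)
  rw [Real.norm_of_nonneg (by positivity), show -(2 * e) / 2 = -e by ring,
    ← Real.mul_rpow hm.le (by positivity)]
  refine Real.rpow_le_rpow_of_nonpos (by positivity) ?_ (by linarith)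
  nlinarith [min_le_left 1 lam, min_le_right 1 lam, sq_nonneg ‖p‖]

theorem memLp_symbol {lam e : ℝ} (hlam : 0 < lam) (he : 3 / 4 < e) :
    MemLp (fun p : R3 => (‖p‖ ^ 2 + lam) ^ (-e)) 2 := by
  rw [memLp_two_iff_integrable_sq (continuous_symbol hlam _).aestronglyMeasurable]
  refine (integrable_symbol hlam (e := 2 * e) (by linarith)).congr
    (Filter.Eventually.of_forall fun p => ?_)
  simp only
  rw [← Real.rpow_two ((_ : ℝ) ^ (-e)), ← Real.rpow_mul (by positivity)]
  congr 1
  ring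

/-- Once r² ≥ lam and r ≥ 1, the radial integrand is at least r² (2r²)^{-3/2}, a multiple of 1/r. -/
theorem not_integrable_symbol {lam e : ℝ} (hlam : 0 < lam) (he0 : 0 ≤ e) (he : e ≤ 3 / 2) :
    ¬ Integrable fun p : R3 => (‖p‖ ^ 2 + lam) ^ (-e) := by
  intro h
  have h' := (integrable_radial_iff (f := fun r => (r ^ 2 + lam) ^ (-e))).1 h
  set r₀ := max 1 (√lam)
  have h'' := h'.mono_set (Ioi_subset_Ioi (le_trans zero_le_one (le_max_left 1 (√lam))))
  refine not_integrableOn_Ioi_inv (a := r₀) ?_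
  have hd : IntegrableOn (fun r : ℝ => 2 ^ (3 / 2 : ℝ) *
      (r ^ 2 * (r ^ 2 + lam) ^ (-e))) (Ioi r₀) := h''.const_mul _
  refine hd.mono' (by fun_prop) ?_
  filter_upwards [ae_restrict_mem measurableSet_Ioi] with r hr
  have hr1 : 1 < r := lt_of_le_of_lt (le_max_left _ _) hr
  have hr2 : √lam < r := lt_of_le_of_lt (le_max_right _ _) hr
  have hr3 : lam ≤ r ^ 2 := by
    have := Real.sq_sqrt hlam.le
    nlinarith [Real.sqrt_nonneg lam]
  have hr0 : 0 < r := by linarith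
  rw [Real.norm_of_nonneg (by positivity)]
  have e1 : (r ^ 2) ^ (-(3 / 2) : ℝ) = r⁻¹ * (r ^ 2)⁻¹ := by
    rw [← Real.rpow_two, ← Real.rpow_mul hr0.le, ← Real.rpow_neg_one, ← Real.rpow_neg hr0.le,
      ← Real.rpow_add hr0]
    norm_num
  have e2 : (2 * r ^ 2) ^ (-(3 / 2) : ℝ) ≤ (r ^ 2 + lam) ^ (-e) := by
    calc (2 * r ^ 2) ^ (-(3 / 2) : ℝ) ≤ (2 * r ^ 2) ^ (-e) :=
          Real.rpow_le_rpow_of_exponent_le (by nlinarith) (by linarith)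
      _ ≤ _ := Real.rpow_le_rpow_of_nonpos (by positivity) (by linarith) (by linarith)
  calc r⁻¹ = 2 ^ (3 / 2 : ℝ) * (r ^ 2 * (2 * r ^ 2) ^ (-(3 / 2) : ℝ)) := by
        rw [Real.mul_rpow (by norm_num) (by positivity), e1, Real.rpow_neg (by norm_num)]
        field_simp
    _ ≤ _ := by gcongr

theorem memLp_rk {lam t : ℝ} (hlam : 0 < lam) (ht : 0 ≤ t) : MemLp (rk lam t) 2 := by
  refine (memLp_symbol hlam (e := 1) (by norm_num)).mono
    (continuous_rk hlam ht).aestronglyMeasurable (Filter.Eventually.of_forall fun p => ?_)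
  rw [Real.norm_of_nonneg (rk_pos hlam ht p).le, Real.norm_of_nonneg (by positivity)]
  refine (rk_le_zero hlam ht p).trans_eq ?_
  rw [Real.rpow_neg_one, rk, add_zero]

theorem integral_rk_mul_rk_zero {lam t : ℝ} (hlam : 0 < lam) (ht : 0 < t) :
    Integrable (fun p => rk lam t p * rk lam 0 p) ∧
      ∫ p, rk lam t p * rk lam 0 p = 2 * Real.pi ^ 2 / (√(lam + t) + √lam) := by
  have h := integral_resolvent_mul_resolvent (a := √(lam + t)) (b := √lam) (Real.sqrt_pos.2 hlam)
    (Real.sqrt_lt_sqrt hlam.le (by linarith))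
  rw [Real.sq_sqrt (by positivity), Real.sq_sqrt hlam.le] at h
  simpa only [rk, mul_inv, add_zero, add_assoc] using h

theorem integral_rk_sq_le {lam t : ℝ} (hlam : 0 < lam) (ht : 0 ≤ t) :
    ∫ p, rk lam t p ^ 2 ≤ 2 * Real.pi ^ 2 * (lam + t) ^ (-(1 / 2) : ℝ) := by
  have h0 : 0 < √(lam + t) := Real.sqrt_pos.2 (by positivity)
  -- The product formula needs two different parameters, so one factor is enlarged by halving its
  -- parameter; the value 2π²/(a + a/2) is still at most 2π²/a.
  obtain ⟨hi, hv⟩ := integral_resolvent_mul_resolvent (a := √(lam + t)) (b := √(lam + t) / 2)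
    (by positivity) (by linarith)
  have hm := integral_mono_of_nonneg (μ := (volume : Measure R3)) (f := fun p => rk lam t p ^ 2)
    (Filter.Eventually.of_forall fun p => sq_nonneg _) hi
    (Filter.Eventually.of_forall fun p => ?_)
  · refine hm.trans ?_
    rw [hv, Real.rpow_neg (by positivity), ← Real.sqrt_eq_rpow, ← div_eq_mul_inv]
    refine div_le_div_of_nonneg_left (by positivity) h0 (by linarith)
  · simp only [rk, sq (_ : ℝ)⁻¹, ← mul_inv, div_pow, Real.sq_sqrt (by positivity : 0 ≤ lam + t)]
    refine inv_anti₀ (by positivity) ?_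
    rw [← add_assoc]
    refine mul_le_mul_of_nonneg_left ?_ (by positivity)
    linarith

theorem integrable_rk_mul {lam t : ℝ} (hlam : 0 < lam) (ht : 0 ≤ t) {g : R3 → ℂ}
    (hg : MemLp g 2) : Integrable fun p => (rk lam t p : ℂ) * g p :=
  ((memLp_rk hlam ht).ofReal (K := ℂ)).integrable_mul hg

/-- Cauchy–Schwarz. The decay exponent 1/4 is what later forces σ > 1/4, that is s > 1/2. -/
theorem integral_rk_mul_norm_le {lam t : ℝ} (hlam : 0 < lam) (ht : 0 ≤ t) {g : R3 → ℂ}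
    (hg : MemLp g 2) : ∫ p, rk lam t p * ‖g p‖ ≤
      √(2 * Real.pi ^ 2) * √(∫ p, ‖g p‖ ^ 2) * (lam + t) ^ (-(1 / 4) : ℝ) := by
  have h := integral_mul_le_Lp_mul_Lq_of_nonneg (μ := (volume : Measure R3))
    Real.HolderConjugate.two_two (f := rk lam t) (g := fun p => ‖g p‖)
    (Filter.Eventually.of_forall fun p => (rk_pos hlam ht p).le)
    (Filter.Eventually.of_forall fun p => norm_nonneg _)
    (by simpa using memLp_rk hlam ht) (by simpa using hg.norm)
  simp only [Real.rpow_two, ← Real.sqrt_eq_rpow] at h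
  refine h.trans ?_
  have h2 := Real.sqrt_le_sqrt (integral_rk_sq_le hlam ht)
  rw [Real.sqrt_mul (by positivity)] at h2
  have h3 : √((lam + t) ^ (-(1 / 2) : ℝ)) = (lam + t) ^ (-(1 / 4) : ℝ) := by
    rw [Real.sqrt_eq_rpow, ← Real.rpow_mul (by positivity)]
    norm_num
  rw [h3] at h2
  calc _ ≤ _ := mul_le_mul_of_nonneg_right h2 (Real.sqrt_nonneg _)
    _ = _ := by ring

/-! ### Exchange of the integrals over `t` and `p` -/

/-- Absolute convergence of the double integral of `u(t) h(p) / (p² + lam + t)`. -/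
def ProdInt (lam : ℝ) (u : ℝ → ℂ) (h : R3 → ℂ) : Prop :=
  Integrable (fun z : ℝ × R3 => u z.1 * ((rk lam z.1 z.2 : ℂ) * h z.2)) (vol0.prod volume)

section ProdInt

variable {lam : ℝ} {u : ℝ → ℂ} {h : R3 → ℂ}

theorem aestronglyMeasurable_prodInt (hu : AEStronglyMeasurable u vol0)
    (hh : AEStronglyMeasurable h volume) :
    AEStronglyMeasurable (fun z : ℝ × R3 => u z.1 * ((rk lam z.1 z.2 : ℂ) * h z.2))
      (vol0.prod volume) :=
  hu.comp_fst.mul (((measurable_rk lam).complex_ofReal).aestronglyMeasurable.mul hh.comp_snd)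

theorem ProdInt.of_fst (hlam : 0 < lam) (hu : AEStronglyMeasurable u vol0)
    (hh : AEStronglyMeasurable h volume)
    (h1 : ∀ t : ℝ, 0 < t → Integrable fun p => (rk lam t p : ℂ) * h p)
    (h2 : IntegrableOn (fun t => ‖u t‖ * ∫ p, rk lam t p * ‖h p‖) (Ioi 0)) : ProdInt lam u h := by
  refine (integrable_prod_iff (aestronglyMeasurable_prodInt hu hh)).2 ⟨?_, ?_⟩
  · filter_upwards [ae_restrict_mem measurableSet_Ioi] with t ht
    exact (h1 t ht).const_mul _
  · refine h2.congr ?_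
    filter_upwards [ae_restrict_mem measurableSet_Ioi] with t ht
    rw [← integral_const_mul]
    congr 1
    ext p
    rw [norm_mul, norm_mul, Complex.norm_real, Real.norm_of_nonneg (rk_pos hlam (le_of_lt ht) p).le]

theorem ProdInt.of_snd (hlam : 0 < lam) (hu : AEStronglyMeasurable u vol0)
    (hh : AEStronglyMeasurable h volume)
    (h1 : ∀ p, IntegrableOn (fun t => u t * (rk lam t p : ℂ)) (Ioi 0))
    (h2 : Integrable (fun p => ‖h p‖ * ∫ t in Ioi 0, ‖u t‖ * rk lam t p)) : ProdInt lam u h := by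
  refine (integrable_prod_iff' (aestronglyMeasurable_prodInt hu hh)).2 ⟨?_, ?_⟩
  · refine Filter.Eventually.of_forall fun p => ?_
    simp only [← mul_assoc]
    exact (h1 p).mul_const _
  · refine h2.congr (Filter.Eventually.of_forall fun p => ?_)
    simp only
    rw [← integral_const_mul]
    refine setIntegral_congr_fun measurableSet_Ioi fun t ht => ?_
    simp only [norm_mul, Complex.norm_real, Real.norm_of_nonneg (rk_pos hlam (le_of_lt ht) p).le]
    ring

theorem ProdInt.swap (H : ProdInt lam u h) :
    ∫ t in Ioi 0, u t * ∫ p, (rk lam t p : ℂ) * h p =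
      ∫ p, h p * ∫ t in Ioi 0, u t * (rk lam t p : ℂ) := by
  have := integral_integral_swap (f := fun t p => u t * ((rk lam t p : ℂ) * h p)) H
  simp only [integral_const_mul] at this
  rw [this]
  congr 1
  ext p
  rw [← integral_const_mul]
  congr 1
  ext t
  ring

theorem ProdInt.integrable_fst (H : ProdInt lam u h) :
    IntegrableOn (fun t => u t * ∫ p, (rk lam t p : ℂ) * h p) (Ioi 0) := by
  have := H.integral_prod_left
  simp only [integral_const_mul] at this
  exact this

theorem ProdInt.integrable_snd (H : ProdInt lam u h) :
    Integrable (fun p => h p * ∫ t in Ioi 0, u t * (rk lam t p : ℂ)) := by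
  have := H.integral_prod_right
  refine this.congr (Filter.Eventually.of_forall fun p => ?_)
  simp only
  rw [← integral_const_mul]
  congr 1
  ext t
  ring

end ProdInt

/-! ### Weighted square-integrability via the Schur test -/

/-- The homogeneous kernel of the Schur test. -/
def schurKer (lam b t : ℝ) (p : R3) : ENNReal :=
  ENNReal.ofReal (t ^ (-b - 1 / 4) * (‖p‖ ^ 2 + lam) ^ b * rk lam t p)

theorem measurable_schurKer (lam b : ℝ) :
    Measurable fun z : ℝ × R3 => schurKer lam b z.1 z.2 := by
  unfold schurKer
  have := measurable_rk lam
  fun_prop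

/-- The test functions (p² + lam)^{-3/4} and t^{-1/2} are the borderline powers for L² at infinity
in the two variables. The range of b is where both scalar integrals converge: 1/2 < 3/4 - b < 3/2
here, and 0 < 1/4 - b < 1 in `lintegral_schurKer_fst`. -/
theorem lintegral_schurKer_snd {lam b : ℝ} (hlam : 0 < lam) (hb : -(3 / 4) < b) (hb' : b < 1 / 4) :
    ∃ C : ℝ, ∀ t : ℝ, 0 < t →
      ∫⁻ p, schurKer lam b t p * ENNReal.ofReal ((‖p‖ ^ 2 + lam) ^ (-(3 / 4) : ℝ)) ≤
        ENNReal.ofReal C * ENNReal.ofReal (t ^ (-(1 / 2) : ℝ)) := by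
  obtain ⟨C, hC, h⟩ := lintegral_rpow_div_le (e := 3 / 4 - b) hlam (by linarith) (by linarith)
  refine ⟨C, fun t ht => ?_⟩
  calc _ = ∫⁻ p : R3, ENNReal.ofReal (t ^ (-b - 1 / 4)) *
        ENNReal.ofReal ((‖p‖ ^ 2 + lam) ^ (-(3 / 4 - b)) / (‖p‖ ^ 2 + lam + t)) := by
        refine lintegral_congr fun p => ?_
        rw [schurKer, ← ENNReal.ofReal_mul (by have := rk_pos hlam ht.le p; positivity),
          ← ENNReal.ofReal_mul (by positivity), rk, show -(3 / 4 - b) = b + -(3 / 4) by ring,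
          Real.rpow_add (by positivity)]
        congr 1
        ring
    _ = ENNReal.ofReal (t ^ (-b - 1 / 4)) * ∫⁻ p : R3,
        ENNReal.ofReal ((‖p‖ ^ 2 + lam) ^ (-(3 / 4 - b)) / (‖p‖ ^ 2 + lam + t)) :=
        lintegral_const_mul' _ _ ENNReal.ofReal_ne_top
    _ ≤ ENNReal.ofReal (t ^ (-b - 1 / 4)) * ENNReal.ofReal (C * t ^ (1 / 2 - (3 / 4 - b))) :=
        mul_le_mul_right (h t ht) _
    _ = _ := by
        rw [← ENNReal.ofReal_mul (by positivity), ← ENNReal.ofReal_mul hC.le]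
        congr 1
        rw [show (-(1 / 2) : ℝ) = (-b - 1 / 4) + (1 / 2 - (3 / 4 - b)) by ring, Real.rpow_add ht]
        ring

theorem lintegral_schurKer_fst {lam b : ℝ} (hlam : 0 < lam) (hb : -(3 / 4) < b) (hb' : b < 1 / 4) :
    ∃ C : ℝ, ∀ p : R3,
      ∫⁻ t in Ioi 0, schurKer lam b t p * ENNReal.ofReal (t ^ (-(1 / 2) : ℝ)) ≤
        ENNReal.ofReal C * ENNReal.ofReal ((‖p‖ ^ 2 + lam) ^ (-(3 / 4) : ℝ)) := by
  have hσ0 : 0 < 1 / 4 - b := by linarith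
  have hσ1 : 1 / 4 - b < 1 := by linarith
  refine ⟨Real.pi / Real.sin (Real.pi * (1 / 4 - b)), fun p => ?_⟩
  have hX : 0 < ‖p‖ ^ 2 + lam := by positivity
  have hi := integrableOn_rpow_div_add hσ0 hσ1 hX
  have hv := integral_rpow_div_add hσ0 hσ1 hX
  have hs := sin_pi_mul_pos hσ0 hσ1
  calc _ = ∫⁻ t in Ioi (0 : ℝ), ENNReal.ofReal ((‖p‖ ^ 2 + lam) ^ b) *
        ENNReal.ofReal (t ^ ((1 / 4 - b) - 1) / (‖p‖ ^ 2 + lam + t)) := by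
        refine setLIntegral_congr_fun measurableSet_Ioi fun t ht => ?_
        have ht' : (0 : ℝ) < t := ht
        rw [schurKer, ← ENNReal.ofReal_mul (by have := rk_pos hlam ht'.le p; positivity),
          ← ENNReal.ofReal_mul (by positivity), rk,
          show (1 / 4 - b) - 1 = (-b - 1 / 4) + (-(1 / 2)) by ring, Real.rpow_add ht']
        congr 1
        ring
    _ = ENNReal.ofReal ((‖p‖ ^ 2 + lam) ^ b) * ENNReal.ofReal
          (Real.pi / Real.sin (Real.pi * (1 / 4 - b)) * (‖p‖ ^ 2 + lam) ^ ((1 / 4 - b) - 1)) := by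
        rw [lintegral_const_mul' _ _ ENNReal.ofReal_ne_top, ← hv,
          ofReal_integral_eq_lintegral_ofReal hi]
        filter_upwards [ae_restrict_mem measurableSet_Ioi] with t ht
        have ht' : (0 : ℝ) < t := ht
        simp only [Pi.zero_apply]
        positivity
    _ ≤ _ := by
        refine le_of_eq ?_
        rw [← ENNReal.ofReal_mul (by positivity), ← ENNReal.ofReal_mul (by positivity)]
        congr 1
        rw [show (-(3 / 4) : ℝ) = b + ((1 / 4 - b) - 1) by ring, Real.rpow_add hX]
        ring

theorem lintegral_schurKer_apply_fst {lam b : ℝ} (hlam : 0 < lam) (hb : -(3 / 4) < b)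
    (hb' : b < 1 / 4) : ∃ C : ENNReal, C ≠ ⊤ ∧ ∀ f : R3 → ENNReal, AEMeasurable f volume →
      ∫⁻ t in Ioi 0, (∫⁻ p, schurKer lam b t p * f p) ^ 2 ≤ C * ∫⁻ p, f p ^ 2 := by
  obtain ⟨C₁, h1⟩ := lintegral_schurKer_snd hlam hb hb'
  obtain ⟨C₂, h2⟩ := lintegral_schurKer_fst hlam hb hb'
  refine ⟨ENNReal.ofReal C₁ * ENNReal.ofReal C₂, by finiteness, fun f hf => ?_⟩
  refine lintegral_schur (μ := vol0) (measurable_schurKer lam b)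
    (φ := fun p : R3 => ENNReal.ofReal ((‖p‖ ^ 2 + lam) ^ (-(3 / 4) : ℝ)))
    (ψ := fun t : ℝ => ENNReal.ofReal (t ^ (-(1 / 2) : ℝ))) (by fun_prop) (fun p => ?_)
    (fun p => by finiteness) (by fun_prop) ?_ (Filter.Eventually.of_forall h2) hf
  · rw [Ne, ENNReal.ofReal_eq_zero, not_le]
    positivity
  · filter_upwards [ae_restrict_mem measurableSet_Ioi] with t ht
    exact h1 t ht

theorem lintegral_schurKer_apply_snd {lam b : ℝ} (hlam : 0 < lam) (hb : -(3 / 4) < b)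
    (hb' : b < 1 / 4) : ∃ C : ENNReal, C ≠ ⊤ ∧ ∀ f : ℝ → ENNReal, AEMeasurable f vol0 →
      ∫⁻ p, (∫⁻ t in Ioi 0, schurKer lam b t p * f t) ^ 2 ≤ C * ∫⁻ t in Ioi 0, f t ^ 2 := by
  obtain ⟨C₁, h1⟩ := lintegral_schurKer_snd hlam hb hb'
  obtain ⟨C₂, h2⟩ := lintegral_schurKer_fst hlam hb hb'
  refine ⟨ENNReal.ofReal C₂ * ENNReal.ofReal C₁, by finiteness, fun f hf => ?_⟩
  -- `lintegral_schur` divides by this test function, so it must be nonzero at every real t; the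
  -- value 1 off the half-line is irrelevant to the integrals.
  let ψ : ℝ → ENNReal := fun t => if 0 < t then ENNReal.ofReal (t ^ (-(1 / 2) : ℝ)) else 1
  have hψ : ∀ t ∈ Ioi (0 : ℝ), ψ t = ENNReal.ofReal (t ^ (-(1 / 2) : ℝ)) := fun t ht => if_pos ht
  refine lintegral_schur (ν := vol0) (k := fun p t => schurKer lam b t p)
    ((measurable_schurKer lam b).comp measurable_swap) (φ := ψ)
    (ψ := fun p : R3 => ENNReal.ofReal ((‖p‖ ^ 2 + lam) ^ (-(3 / 4) : ℝ)))
    (Measurable.ite measurableSet_Ioi (by fun_prop) measurable_const) (fun t => ?_)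
    (fun t => ?_) (by fun_prop) (Filter.Eventually.of_forall fun p => ?_) ?_ hf
  · simp only [ψ]
    split_ifs with h
    · rw [Ne, ENNReal.ofReal_eq_zero, not_le]
      positivity
    · exact one_ne_zero
  · simp only [ψ]
    split_ifs <;> finiteness
  · refine le_trans (le_of_eq ?_) (h2 p)
    refine setLIntegral_congr_fun measurableSet_Ioi fun t ht => ?_
    simp only [hψ t ht]
  · filter_upwards [ae_restrict_mem measurableSet_Ioi] with t ht
    rw [hψ t ht]
    exact h1 t ht

theorem memLp_two_of_lintegral_enorm {g : R3 → ℂ} (hm : AEStronglyMeasurable g volume)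
    (h : ∫⁻ p, ‖g p‖ₑ ^ 2 < ⊤) : MemLp g 2 := by
  refine ⟨hm, ?_⟩
  rw [eLpNorm_lt_top_iff_lintegral_rpow_enorm_lt_top (by norm_num) (by norm_num)]
  simpa using h

theorem lintegral_enorm_sq_lt_top {g : R3 → ℂ} (hg : MemLp g 2) : ∫⁻ p, ‖g p‖ₑ ^ 2 < ⊤ := by
  have := (eLpNorm_lt_top_iff_lintegral_rpow_enorm_lt_top (by norm_num) (by norm_num)).1 hg.2
  simpa using this

/-- The composition of two Schur kernels maps `L²` to `L²`. -/
theorem memLp_schur_comp {lam b₁ b₂ : ℝ} (hlam : 0 < lam) (h1 : -(3 / 4) < b₁) (h1' : b₁ < 1 / 4)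
    (h2 : -(3 / 4) < b₂) (h2' : b₂ < 1 / 4) {w : ℝ → ℝ} (hw : Measurable w)
    (hw1 : ∀ t, 0 < t → |w t| ≤ 1) {g : R3 → ℂ} (hg : MemLp g 2) :
    MemLp (fun p => (((‖p‖ ^ 2 + lam) ^ b₁ : ℝ) : ℂ) * ∫ t in Ioi (0 : ℝ),
      (((t ^ (-b₁ - b₂ - 1 / 2) * w t : ℝ) : ℂ) *
        ∫ q, (rk lam t q : ℂ) * ((((‖q‖ ^ 2 + lam) ^ b₂ : ℝ) : ℂ) * g q)) * (rk lam t p : ℂ)) 2 := by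
  obtain ⟨C₁, hC₁, H1⟩ := lintegral_schurKer_apply_fst hlam h2 h2'
  obtain ⟨C₂, hC₂, H2⟩ := lintegral_schurKer_apply_snd hlam h1 h1'
  have hgm := hg.1
  have hd : AEStronglyMeasurable (fun t => ∫ q, (rk lam t q : ℂ) *
      ((((‖q‖ ^ 2 + lam) ^ b₂ : ℝ) : ℂ) * g q)) vol0 := by
    have : AEStronglyMeasurable (fun z : ℝ × R3 => (rk lam z.1 z.2 : ℂ) *
      ((((‖z.2‖ ^ 2 + lam) ^ b₂ : ℝ) : ℂ) * g z.2)) (vol0.prod volume) :=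
      ((measurable_rk lam).complex_ofReal).aestronglyMeasurable.mul
        ((Measurable.aestronglyMeasurable (by fun_prop)).mul hgm.comp_snd)
    exact this.integral_prod_right'
  let F : ℝ → ENNReal := fun t => ∫⁻ q, schurKer lam b₂ t q * ‖g q‖ₑ
  have hF : AEMeasurable F vol0 := by
    have : AEMeasurable (fun z : ℝ × R3 => schurKer lam b₂ z.1 z.2 * ‖g z.2‖ₑ)
      (vol0.prod volume) :=
      (measurable_schurKer lam b₂).aemeasurable.mul hgm.comp_snd.enorm
    exact this.lintegral_prod_right'
  refine memLp_two_of_lintegral_enorm ?_ ?_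
  · refine (Measurable.aestronglyMeasurable (by fun_prop)).mul ?_
    have : AEStronglyMeasurable (fun z : R3 × ℝ =>
        (((z.2 ^ (-b₁ - b₂ - 1 / 2) * w z.2 : ℝ) : ℂ) * ∫ q, (rk lam z.2 q : ℂ) *
          ((((‖q‖ ^ 2 + lam) ^ b₂ : ℝ) : ℂ) * g q)) * (rk lam z.2 z.1 : ℂ))
        (volume.prod vol0) :=
      ((Measurable.aestronglyMeasurable (by fun_prop)).mul hd.comp_snd).mul
        ((measurable_rk lam).comp measurable_swap).complex_ofReal.aestronglyMeasurable
    exact this.integral_prod_right'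
  · refine lt_of_le_of_lt (b := ∫⁻ p, (∫⁻ t in Ioi 0, schurKer lam b₁ t p * F t) ^ 2) ?_ ?_
    · refine lintegral_mono fun p => pow_le_pow_left' ?_ 2
      have hX : 0 < ‖p‖ ^ 2 + lam := by positivity
      rw [← integral_const_mul]
      refine (enorm_integral_le_lintegral_enorm _).trans
        (setLIntegral_mono' measurableSet_Ioi fun t ht => ?_)
      have ht' : (0 : ℝ) < t := ht
      have hr := rk_pos hlam ht'.le
      have hin : ENNReal.ofReal (t ^ (-b₂ - 1 / 4)) * ‖∫ q, (rk lam t q : ℂ) *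
          ((((‖q‖ ^ 2 + lam) ^ b₂ : ℝ) : ℂ) * g q)‖ₑ ≤ F t := by
        refine (mul_le_mul_right (enorm_integral_le_lintegral_enorm _) _).trans (le_of_eq ?_)
        rw [← lintegral_const_mul' _ _ ENNReal.ofReal_ne_top]
        refine lintegral_congr fun q => ?_
        have hXq : 0 < ‖q‖ ^ 2 + lam := by positivity
        rw [enorm_mul, enorm_mul, schurKer, ← ofReal_norm, ← ofReal_norm,
          Complex.norm_real, Complex.norm_real, Real.norm_of_nonneg (hr q).le,
          Real.norm_of_nonneg (by positivity), ENNReal.ofReal_mul (by positivity),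
          ENNReal.ofReal_mul (by positivity)]
        ring
      rw [enorm_mul, enorm_mul, enorm_mul]
      -- The power of t splits as (-b₁ - 1/4) + (-b₂ - 1/4), one factor for each of the two Schur
      -- kernels.
      have hw' : ‖((t ^ (-b₁ - b₂ - 1 / 2) * w t : ℝ) : ℂ)‖ₑ ≤
          ENNReal.ofReal (t ^ (-b₁ - 1 / 4)) * ENNReal.ofReal (t ^ (-b₂ - 1 / 4)) := by
        rw [← ofReal_norm, Complex.norm_real, ← ENNReal.ofReal_mul (by positivity),
          ← Real.rpow_add ht']
        refine ENNReal.ofReal_le_ofReal ?_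
        rw [norm_mul, Real.norm_of_nonneg (by positivity)]
        refine (mul_le_of_le_one_right (by positivity) (hw1 t ht')).trans_eq ?_
        congr 1
        ring
      calc _ ≤ ENNReal.ofReal ((‖p‖ ^ 2 + lam) ^ b₁) *
            (ENNReal.ofReal (t ^ (-b₁ - 1 / 4)) * ENNReal.ofReal (t ^ (-b₂ - 1 / 4)) *
              ‖∫ q, (rk lam t q : ℂ) * ((((‖q‖ ^ 2 + lam) ^ b₂ : ℝ) : ℂ) * g q)‖ₑ *
              ENNReal.ofReal (rk lam t p)) := by
            refine mul_le_mul' (le_of_eq ?_) (mul_le_mul' (mul_le_mul_left hw' _) (le_of_eq ?_))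
            · rw [← ofReal_norm, Complex.norm_real, Real.norm_of_nonneg (by positivity)]
            · rw [← ofReal_norm, Complex.norm_real, Real.norm_of_nonneg (hr p).le]
        _ = schurKer lam b₁ t p * (ENNReal.ofReal (t ^ (-b₂ - 1 / 4)) *
              ‖∫ q, (rk lam t q : ℂ) * ((((‖q‖ ^ 2 + lam) ^ b₂ : ℝ) : ℂ) * g q)‖ₑ) := by
            rw [schurKer, ENNReal.ofReal_mul (by positivity), ENNReal.ofReal_mul (by positivity)]
            ring
        _ ≤ _ := mul_le_mul_right hin _
    · refine (H2 F hF).trans_lt (ENNReal.mul_lt_top hC₂.lt_top ?_)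
      exact (H1 _ hgm.enorm).trans_lt
        (ENNReal.mul_lt_top hC₁.lt_top (lintegral_enorm_sq_lt_top hg))

/-! ### Fractional powers of a bounded positive operator -/

section Powers

variable {H : Type*} [NormedAddCommGroup H] [InnerProductSpace ℂ H] [CompleteSpace H]

/-- The fractional power `N^σ` of a bounded nonnegative operator. -/
def fracPow (N : H →L[ℂ] H) (σ : ℝ) : H →L[ℂ] H := N ^ σ.toNNReal

theorem fracPow_fracPow {N : H →L[ℂ] H} (hN : 0 ≤ N) {σ : ℝ} (h0 : 0 < σ) (h1 : σ < 1) (g : H) :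
    fracPow N (1 - σ) (fracPow N σ g) = N g := by
  have h : N ^ (1 - σ).toNNReal * N ^ σ.toNNReal = N := by
    rw [← CFC.nnrpow_add (by simpa using h1) (by simpa using h0),
      ← Real.toNNReal_add (by linarith) h0.le]
    simp [CFC.nnrpow_one N hN]
  exact congrArg (fun T : H →L[ℂ] H => T g) h

theorem integral_cfc_rpowIntegrand {N : H →L[ℂ] H} (hN : 0 ≤ N) {σ : ℝ} (h0 : 0 < σ)
    (h1 : σ < 1) :
    IntegrableOn (fun t => cfcₙ (Real.rpowIntegrand₀₁ σ t) N) (Ioi 0) ∧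
      fracPow N σ = (Real.sin (Real.pi * σ) / Real.pi) •
        ∫ t in Ioi (0 : ℝ), cfcₙ (Real.rpowIntegrand₀₁ σ t) N := by
  have hp : σ ∈ Ioo 0 1 := ⟨h0, h1⟩
  nontriviality (H →L[ℂ] H)
  let f : ℝ → ℝ → ℝ := fun t => Real.rpowIntegrand₀₁ σ t
  let maxr := sSup (quasispectrum ℝ N)
  have maxr_nonneg : 0 ≤ maxr :=
    le_csSup_of_le (b := 0) (IsCompact.bddAbove (by grind)) (by simp) (by simp)
  -- The integrand increases with the spectral variable, so its value at the top of the
  -- quasispectrum dominates it uniformly.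
  let bound (t : ℝ) := ‖f t maxr‖
  have hf : ContinuousOn (Function.uncurry f) (Ioi (0 : ℝ) ×ˢ quasispectrum ℝ N) := by
    refine Real.continuousOn_rpowIntegrand₀₁_uncurry hp (quasispectrum ℝ N) ?_
    grind
  have hbound : ∀ᵐ t ∂(volume : Measure ℝ).restrict (Ioi 0),
      ∀ z ∈ quasispectrum ℝ N, ‖f t z‖ ≤ bound t := by
    filter_upwards [ae_restrict_mem measurableSet_Ioi] with t ht
    intro z hz
    have hz' : 0 ≤ z := by grind
    unfold bound f
    rw [Real.norm_of_nonneg (Real.rpowIntegrand₀₁_nonneg h0 (le_of_lt ht) hz'),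
      Real.norm_of_nonneg (Real.rpowIntegrand₀₁_nonneg h0 (le_of_lt ht) maxr_nonneg)]
    refine Real.rpowIntegrand₀₁_monotoneOn hp (le_of_lt ht) hz' maxr_nonneg ?_
    exact le_csSup (IsCompact.bddAbove (quasispectrum.isCompact _)) hz
  have hbound_fin : HasFiniteIntegral bound ((volume : Measure ℝ).restrict (Ioi 0)) := by
    rw [hasFiniteIntegral_norm_iff]
    exact (Real.integrableOn_rpowIntegrand₀₁_Ioi hp maxr_nonneg).2
  have hmapzero : ∀ᵐ t ∂(volume : Measure ℝ).restrict (Ioi 0), Real.rpowIntegrand₀₁ σ t 0 = 0 := by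
    filter_upwards [ae_restrict_mem measurableSet_Ioi]
    simp
  refine ⟨integrableOn_cfcₙ measurableSet_Ioi _ bound N hf hmapzero hbound hbound_fin
    hN.isSelfAdjoint, ?_⟩
  rw [← cfcₙ_setIntegral measurableSet_Ioi _ bound N hf hmapzero hbound hbound_fin
    hN.isSelfAdjoint, fracPow, CFC.nnrpow_eq_cfcₙ_real _ _]
  have hs := sin_pi_mul_pos h0 h1
  have hval : ∀ r ∈ quasispectrum ℝ N, ∫ t in Ioi (0 : ℝ), f t r =
      Real.pi / Real.sin (Real.pi * σ) * r ^ σ := by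
    intro r hr
    have hr0 : 0 ≤ r := by grind
    simp only [f]
    rw [Real.integral_rpowIntegrand₀₁_eq_rpow_mul_const hp hr0, mul_comm,
      ← integral_rpow_div_one_add h0 h1]
    congr 1
    refine setIntegral_congr_fun measurableSet_Ioi fun t ht => ?_
    have ht' : (0 : ℝ) < t := ht
    simp only [Real.rpowIntegrand₀₁_eq_pow_div hp ht'.le zero_le_one, mul_one, add_comm t]
  have hcont : ContinuousOn (fun r : ℝ => r ^ σ) (quasispectrum ℝ N) :=
    ContinuousOn.rpow_const (by fun_prop) fun r _ => Or.inr h0.le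
  rw [cfcₙ_congr hval, cfcₙ_const_mul _ _ N hcont (Real.zero_rpow h0.ne'), smul_smul,
    Real.coe_toNNReal _ h0.le]
  have hone : Real.sin (Real.pi * σ) / Real.pi * (Real.pi / Real.sin (Real.pi * σ)) = 1 := by
    have := Real.pi_pos
    field_simp
  rw [hone, one_smul]

/-- If `R t` is the resolvent `(N⁻¹ + t)⁻¹`, then `N^σ = π⁻¹ sin(πσ) ∫ t^{-σ} R t dt` weakly. -/
theorem inner_fracPow {N : H →L[ℂ] H} (hN : 0 ≤ N) {R : ℝ → H →L[ℂ] H}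
    (hR : ∀ t, 0 < t → ∀ g, t • N (R t g) + R t g = N g) {σ : ℝ} (h0 : 0 < σ) (h1 : σ < 1)
    (h g : H) :
    inner ℂ h (fracPow N σ g) = ((Real.sin (Real.pi * σ) / Real.pi : ℝ) : ℂ) *
      ∫ t in Ioi (0 : ℝ), ((t ^ (-σ) : ℝ) : ℂ) * inner ℂ h (R t g) := by
  have hp : σ ∈ Ioo 0 1 := ⟨h0, h1⟩
  obtain ⟨hi, hv⟩ := integral_cfc_rpowIntegrand hN h0 h1
  -- Both sides solve (N + t) y = t^{σ-1} N g, and N + t is injective because N is nonnegative. Thus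
  -- the identity for `R` is all that is needed; N is never inverted.
  have hD : ∀ t : ℝ, 0 < t → cfcₙ (Real.rpowIntegrand₀₁ σ t) N g = (t ^ (σ - 2)) • R t⁻¹ g := by
    intro t ht
    set D := cfcₙ (Real.rpowIntegrand₀₁ σ t) N
    have hc : ContinuousOn (Real.rpowIntegrand₀₁ σ t) (quasispectrum ℝ N) :=
      (Real.continuousOn_rpowIntegrand₀₁_Ici hp ht).mono (by grind)
    have e1 : N * D + t • D = (t ^ (σ - 1)) • N := by
      have a1 : cfcₙ (fun x : ℝ => x * Real.rpowIntegrand₀₁ σ t x) N = N * D := by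
        rw [cfcₙ_mul (fun x => x) _ N (by fun_prop) rfl hc (by simp), cfcₙ_id' ℝ N hN.isSelfAdjoint]
      have a2 : cfcₙ (fun x : ℝ => t * Real.rpowIntegrand₀₁ σ t x) N = t • D :=
        cfcₙ_const_mul t _ N hc (by simp)
      have a3 : cfcₙ (fun x : ℝ => t ^ (σ - 1) * x) N = (t ^ (σ - 1)) • N := by
        rw [cfcₙ_const_mul _ (fun x => x) N (by fun_prop) rfl, cfcₙ_id' ℝ N hN.isSelfAdjoint]
      rw [← a1, ← a2, ← a3, ← cfcₙ_add _ _ N (by fun_prop) (by simp) (by fun_prop) (by simp)]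
      refine cfcₙ_congr fun x hx => ?_
      have hx0 : 0 ≤ x := by grind
      simp only [Real.rpowIntegrand₀₁_eq_pow_div hp ht.le hx0]
      field_simp
      ring
    have e2 := hR t⁻¹ (inv_pos.2 ht) g
    have e3 := congrArg (fun T : H →L[ℂ] H => T g) e1
    simp only [add_apply, mul_apply_eq_comp, smul_apply] at e3
    set z := D g - (t ^ (σ - 2)) • R t⁻¹ g
    have hz : N z + t • z = 0 := by
      have hpow : t ^ (σ - 1) = t ^ (σ - 2) * t := by
        rw [← Real.rpow_add_one ht.ne']; congr 1; ring
      have : N z + t • z = (N (D g) + t • D g) -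
          (t ^ (σ - 2) * t) • (t⁻¹ • N (R t⁻¹ g) + R t⁻¹ g) := by
        simp only [z, map_sub, smul_sub, smul_add, smul_smul, mul_assoc, mul_inv_cancel₀ ht.ne',
          mul_one, N.map_smul_of_tower, mul_comm t]
        abel
      rw [this, e3, e2, hpow, sub_self]
    have hpos := ((ContinuousLinearMap.nonneg_iff_isPositive N).1 hN).re_inner_nonneg_left z
    have h2 : RCLike.re (inner ℂ (N z + t • z) z) = 0 := by rw [hz]; simp
    rw [inner_add_left, map_add, inner_smul_left_eq_smul] at h2
    have h3 : RCLike.re (t • inner ℂ z z) = t * ‖z‖ ^ 2 := by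
      rw [inner_self_eq_norm_sq_to_K]
      norm_cast
    rw [h3] at h2
    have h4 : ‖z‖ ^ 2 = 0 := by
      have := sq_nonneg ‖z‖
      nlinarith
    exact sub_eq_zero.1 (by simpa using h4)
  have hi' : IntegrableOn (fun t => cfcₙ (Real.rpowIntegrand₀₁ σ t) N g) (Ioi 0) :=
    hi.apply_continuousLinearMap g
  rw [hv, smul_apply, ContinuousLinearMap.integral_apply hi, inner_smul_right_eq_smul,
    ← integral_inner hi', Complex.real_smul]
  congr 1
  -- Substitution t ↦ t⁻¹: the Jacobian t^{-2} and the power t^{σ} combine to the t^{σ-2} of `hD`.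
  rw [← integral_comp_rpow_Ioi (fun t : ℝ => ((t ^ (-σ) : ℝ) : ℂ) * inner ℂ h (R t g))
    (by norm_num : (-1 : ℝ) ≠ 0)]
  refine setIntegral_congr_fun measurableSet_Ioi fun t ht => ?_
  have ht' : (0 : ℝ) < t := ht
  simp only [hD t ht']
  rw [inner_smul_right_eq_smul, Complex.real_smul, Complex.real_smul, ← mul_assoc,
    ← Complex.ofReal_mul, Real.rpow_neg_one, Real.inv_rpow ht'.le, ← Real.rpow_neg ht'.le, neg_neg,
    abs_neg, abs_one, one_mul, ← Real.rpow_add ht', show (-1 - 1 + σ : ℝ) = σ - 2 by ring]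

end Powers

/-! ### The point interaction resolvent -/

/-- `(2π)^{-3/2}`. -/
def kap : ℝ := (2 * Real.pi) ^ (-(3 / 2) : ℝ)

theorem kap_pos : 0 < kap := by unfold kap; positivity

theorem kap_sq : kap * kap * (2 * Real.pi ^ 2) = 1 / (4 * Real.pi) := by
  have hpi := Real.pi_pos
  unfold kap
  rw [← Real.rpow_add (by positivity), show (-(3 / 2) + -(3 / 2) : ℝ) = -(3 : ℕ) by norm_num,
    Real.rpow_neg (by positivity), Real.rpow_natCast]
  field_simp
  ring

/-- `1 / (4πα + √(lam + t))`. -/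
def robin (α lam t : ℝ) : ℝ := 1 / (4 * Real.pi * α + √(lam + t))

section robin

variable {α lam t : ℝ}

theorem robin_denom_pos (hα : 0 ≤ α) (hlam : 0 < lam) (ht : 0 ≤ t) :
    0 < 4 * Real.pi * α + √(lam + t) := by
  have := Real.pi_pos
  have : 0 < √(lam + t) := Real.sqrt_pos.2 (by positivity)
  positivity

theorem robin_pos (hα : 0 ≤ α) (hlam : 0 < lam) (ht : 0 ≤ t) : 0 < robin α lam t :=
  one_div_pos.2 (robin_denom_pos hα hlam ht)

theorem robin_le (hα : 0 ≤ α) (hlam : 0 < lam) (ht : 0 ≤ t) : robin α lam t ≤ robin α lam 0 := by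
  unfold robin
  refine one_div_le_one_div_of_le (robin_denom_pos hα hlam le_rfl) ?_
  gcongr

theorem sqrt_mul_robin_le_one (hα : 0 ≤ α) (hlam : 0 < lam) (ht : 0 < t) :
    |t ^ (1 / 2 : ℝ) * robin α lam t| ≤ 1 := by
  have := robin_pos hα hlam ht.le
  rw [abs_of_nonneg (by positivity), robin, mul_one_div, div_le_one (robin_denom_pos hα hlam ht.le),
    ← Real.sqrt_eq_rpow]
  have h1 : √t ≤ √(lam + t) := Real.sqrt_le_sqrt (by linarith)
  have h2 := Real.pi_pos
  have : 0 ≤ 4 * Real.pi * α := by positivity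
  linarith

theorem measurable_robin (α lam : ℝ) : Measurable (robin α lam) := by
  unfold robin; fun_prop

/-- The algebraic identity behind the resolvent formula. -/
theorem robin_identity (hα : 0 ≤ α) (hlam : 0 < lam) (ht : 0 < t) :
    t * robin α lam t / (√(lam + t) + √lam) = 1 - robin α lam t / robin α lam 0 := by
  have h1 := robin_denom_pos hα hlam ht.le
  have h2 := robin_denom_pos hα hlam le_rfl
  have h3 : 0 < √(lam + t) + √lam := by
    have := Real.sqrt_pos.2 hlam
    positivity
  have h4 : t = (√(lam + t) - √lam) * (√(lam + t) + √lam) := by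
    have e1 := Real.mul_self_sqrt (by positivity : 0 ≤ lam + t)
    have e2 := Real.mul_self_sqrt hlam.le
    nlinarith
  have h5 : t / (√(lam + t) + √lam) = √(lam + t) - √lam := by
    rw [div_eq_iff h3.ne']; exact h4
  rw [mul_div_right_comm, h5]
  unfold robin
  rw [add_zero] at h2 ⊢
  field_simp
  ring

end robin

/-- The pairing `⟨ψ_t, g⟩` with the Fourier transform `ψ_t` of the Green function. -/
def green (lam t : ℝ) (g : R3 → ℂ) : ℂ := (kap : ℂ) * ∫ p, (rk lam t p : ℂ) * g p

section green

variable {lam t : ℝ}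

theorem green_congr {g h : R3 → ℂ} (H : g =ᵐ[volume] h) : green lam t g = green lam t h := by
  unfold green
  congr 1
  refine integral_congr_ae ?_
  filter_upwards [H] with p hp
  rw [hp]

theorem green_add {g h : R3 → ℂ} (hg : Integrable fun p => (rk lam t p : ℂ) * g p)
    (hh : Integrable fun p => (rk lam t p : ℂ) * h p) :
    green lam t (fun p => g p + h p) = green lam t g + green lam t h := by
  unfold green
  simp only [mul_add]
  rw [integral_add hg hh, mul_add]

theorem green_const_mul (c : ℂ) (g : R3 → ℂ) :
    green lam t (fun p => c * g p) = c * green lam t g := by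
  unfold green
  simp only [mul_left_comm _ c, integral_const_mul]

theorem norm_green_le (hlam : 0 < lam) (ht : 0 ≤ t) (g : R3 → ℂ) :
    ‖green lam t g‖ ≤ kap * ∫ p, rk lam t p * ‖g p‖ := by
  unfold green
  rw [norm_mul, Complex.norm_real, Real.norm_of_nonneg kap_pos.le]
  refine mul_le_mul_of_nonneg_left ((norm_integral_le_integral_norm _).trans_eq ?_) kap_pos.le
  congr 1
  ext p
  rw [norm_mul, Complex.norm_real, Real.norm_of_nonneg (rk_pos hlam ht p).le]

theorem exists_norm_green_le (hlam : 0 < lam) {g : R3 → ℂ} (hg : MemLp g 2) :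
    ∃ C, 0 ≤ C ∧ ∀ t, 0 ≤ t → ‖green lam t g‖ ≤ C * (lam + t) ^ (-(1 / 4) : ℝ) := by
  refine ⟨kap * (√(2 * Real.pi ^ 2) * √(∫ p, ‖g p‖ ^ 2)), by have := kap_pos; positivity,
    fun t ht => (norm_green_le hlam ht g).trans ?_⟩
  rw [mul_assoc]
  exact mul_le_mul_of_nonneg_left (integral_rk_mul_norm_le hlam ht hg) kap_pos.le

theorem aestronglyMeasurable_green (lam : ℝ) {g : R3 → ℂ} (hg : AEStronglyMeasurable g volume) :
    AEStronglyMeasurable (fun t => green lam t g) vol0 := by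
  have : AEStronglyMeasurable (fun z : ℝ × R3 => (rk lam z.1 z.2 : ℂ) * g z.2)
      (vol0.prod volume) :=
    ((measurable_rk lam).complex_ofReal).aestronglyMeasurable.mul hg.comp_snd
  exact this.integral_prod_right'.const_mul _

/-- `⟨ψ_0, ψ_t⟩ = 1 / (4π (√(lam + t) + √lam))`. -/
theorem green_zero_rk (hlam : 0 < lam) (ht : 0 < t) :
    (kap : ℂ) * green lam 0 (fun p => (rk lam t p : ℂ)) =
      ((1 / (4 * Real.pi) / (√(lam + t) + √lam) : ℝ) : ℂ) := by
  have h := (integral_rk_mul_rk_zero hlam ht).2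
  unfold green
  have e : ∀ p, (rk lam 0 p : ℂ) * (rk lam t p : ℂ) = ((rk lam t p * rk lam 0 p : ℝ) : ℂ) :=
    fun p => by push_cast; ring
  simp only [e]
  rw [integral_complex_ofReal, h, ← Complex.ofReal_mul, ← Complex.ofReal_mul, ← kap_sq]
  congr 1
  ring

theorem mul_rk_mul_rk_zero (hlam : 0 < lam) (ht : 0 ≤ t) (p : R3) :
    t * (rk lam 0 p * rk lam t p) = rk lam 0 p - rk lam t p := by
  unfold rk
  rw [add_zero]
  have h1 : ‖p‖ ^ 2 + lam ≠ 0 := by positivity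
  have h2 : ‖p‖ ^ 2 + lam + t ≠ 0 := by positivity
  field_simp
  ring

/-- `t ⟨ψ_0, (p² + lam + t)⁻¹ g⟩ = ⟨ψ_0, g⟩ - ⟨ψ_t, g⟩`. -/
theorem mul_green_zero_rk_mul (hlam : 0 < lam) (ht : 0 ≤ t) {g : R3 → ℂ} (hg : MemLp g 2) :
    (t : ℂ) * green lam 0 (fun p => (rk lam t p : ℂ) * g p) = green lam 0 g - green lam t g := by
  unfold green
  rw [← mul_sub, ← integral_sub (integrable_rk_mul hlam le_rfl hg) (integrable_rk_mul hlam ht hg),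
    mul_left_comm, ← integral_const_mul]
  congr 2
  ext p
  have := mul_rk_mul_rk_zero hlam ht p
  rw [← sub_mul, ← Complex.ofReal_sub, ← this]
  push_cast
  ring

end green

theorem memLp_rk_ofReal {lam t : ℝ} (hlam : 0 < lam) (ht : 0 ≤ t) :
    MemLp (fun p => (rk lam t p : ℂ)) 2 := (memLp_rk hlam ht).ofReal

theorem memLp_rk_mul {lam t : ℝ} (hlam : 0 < lam) (ht : 0 ≤ t) {g : R3 → ℂ} (hg : MemLp g 2) :
    MemLp (fun p => (rk lam t p : ℂ) * g p) 2 := by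
  refine hg.of_le_mul (c := (lam + t)⁻¹)
    ((Complex.continuous_ofReal.comp (continuous_rk hlam ht)).aestronglyMeasurable.mul hg.1)
    (Filter.Eventually.of_forall fun p => ?_)
  rw [norm_mul, Complex.norm_real, Real.norm_of_nonneg (rk_pos hlam ht p).le]
  exact mul_le_mul_of_nonneg_right (rk_le hlam ht p) (norm_nonneg _)

/-- The resolvent of the point interaction Hamiltonian in momentum space. -/
def resFun (α lam t : ℝ) (g : R3 → ℂ) (p : R3) : ℂ :=
  (rk lam t p : ℂ) * g p + ((4 * Real.pi * robin α lam t * kap : ℝ) : ℂ) * green lam t g *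
    (rk lam t p : ℂ)

theorem exists_resOp {α lam t : ℝ} (hlam : 0 < lam) (ht : 0 ≤ t) :
    ∃ T : L2 →L[ℂ] L2, ∀ g : L2, T g =ᵐ[volume] resFun α lam t g := by
  let T₁ : L2 →ₗ[ℂ] L2 :=
    { toFun := fun g => (memLp_rk_mul hlam ht (Lp.memLp g)).toLp _
      map_add' := fun g h => by
        refine Lp.ext ?_
        filter_upwards [(memLp_rk_mul hlam ht (Lp.memLp (g + h))).coeFn_toLp,
          Lp.coeFn_add g h, Lp.coeFn_add ((memLp_rk_mul hlam ht (Lp.memLp g)).toLp _)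
            ((memLp_rk_mul hlam ht (Lp.memLp h)).toLp _),
          (memLp_rk_mul hlam ht (Lp.memLp g)).coeFn_toLp,
          (memLp_rk_mul hlam ht (Lp.memLp h)).coeFn_toLp] with p h1 h2 h3 h4 h5
        rw [h1, h2, h3, Pi.add_apply, Pi.add_apply, h4, h5, mul_add]
      map_smul' := fun c g => by
        refine Lp.ext ?_
        filter_upwards [(memLp_rk_mul hlam ht (Lp.memLp (c • g))).coeFn_toLp,
          Lp.coeFn_smul c g, Lp.coeFn_smul c ((memLp_rk_mul hlam ht (Lp.memLp g)).toLp _),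
          (memLp_rk_mul hlam ht (Lp.memLp g)).coeFn_toLp] with p h1 h2 h3 h4
        rw [h1, h2, RingHom.id_apply, h3, Pi.smul_apply, Pi.smul_apply, h4, smul_eq_mul,
          smul_eq_mul]
        ring }
  have hT₁ : ∀ g : L2, T₁ g =ᵐ[volume] fun p => (rk lam t p : ℂ) * g p := fun g =>
    (memLp_rk_mul hlam ht (Lp.memLp g)).coeFn_toLp
  let M : L2 →L[ℂ] L2 := T₁.mkContinuous (lam + t)⁻¹ fun g => by
    refine Lp.norm_le_mul_norm_of_ae_le_mul ?_
    filter_upwards [hT₁ g] with p hp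
    rw [hp, norm_mul, Complex.norm_real, Real.norm_of_nonneg (rk_pos hlam ht p).le]
    exact mul_le_mul_of_nonneg_right (rk_le hlam ht p) (norm_nonneg _)
  have hr := memLp_rk_ofReal hlam ht
  let ψ : L2 := hr.toLp _
  have hψ : ψ =ᵐ[volume] fun p => (rk lam t p : ℂ) := hr.coeFn_toLp
  refine ⟨M + (((4 * Real.pi * robin α lam t * kap : ℝ) : ℂ) * kap) •
    (innerSL ℂ ψ).smulRight ψ, fun g => ?_⟩
  have hin : (kap : ℂ) * inner ℂ ψ g = green lam t g := by
    rw [L2.inner_def, green]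
    congr 1
    refine integral_congr_ae ?_
    filter_upwards [hψ] with p hp
    rw [hp, RCLike.inner_apply, Complex.conj_ofReal, mul_comm]
  have e : (M + (((4 * Real.pi * robin α lam t * kap : ℝ) : ℂ) * kap) •
      (innerSL ℂ ψ).smulRight ψ) g =
      T₁ g + (((4 * Real.pi * robin α lam t * kap : ℝ) : ℂ) * green lam t g) • ψ := by
    rw [← hin, add_apply, smul_apply, ContinuousLinearMap.smulRight_apply, innerSL_apply_apply,
      smul_smul, mul_assoc]
    rfl
  rw [e]
  filter_upwards [Lp.coeFn_add (T₁ g)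
    ((((4 * Real.pi * robin α lam t * kap : ℝ) : ℂ) * green lam t g) • ψ), hT₁ g,
    Lp.coeFn_smul (((4 * Real.pi * robin α lam t * kap : ℝ) : ℂ) * green lam t g) ψ, hψ]
    with p h1 h2 h3 h4
  rw [h1, Pi.add_apply, h2, h3, Pi.smul_apply, h4, smul_eq_mul, resFun]

open Classical in
/-- The resolvent of the point interaction Hamiltonian as a bounded operator. -/
def resOp (α lam t : ℝ) : L2 →L[ℂ] L2 :=
  if h : ∃ T : L2 →L[ℂ] L2, ∀ g : L2, T g =ᵐ[volume] resFun α lam t g then h.choose else 0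

section resOp

variable {α lam t : ℝ}

theorem resOp_ae (hlam : 0 < lam) (ht : 0 ≤ t) (g : L2) :
    resOp α lam t g =ᵐ[volume] resFun α lam t g := by
  have h := exists_resOp (α := α) hlam ht
  rw [resOp, dif_pos h]
  exact h.choose_spec g

theorem integrable_rk_mul_norm_sq (hlam : 0 < lam) (ht : 0 ≤ t) {g : R3 → ℂ} (hg : MemLp g 2) :
    Integrable fun p => rk lam t p * ‖g p‖ ^ 2 := by
  refine (((memLp_two_iff_integrable_sq_norm hg.1).1 hg).const_mul (lam + t)⁻¹).mono'
    ((continuous_rk hlam ht).aestronglyMeasurable.mul (hg.1.norm.pow 2))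
    (Filter.Eventually.of_forall fun p => ?_)
  have := rk_pos hlam ht p
  rw [Real.norm_of_nonneg (by positivity)]
  exact mul_le_mul_of_nonneg_right (rk_le hlam ht p) (by positivity)

/-- The quadratic form is a sum of two nonnegative terms. Positivity of N follows, and already the
first term gives injectivity. -/
theorem inner_resOp_self (hlam : 0 < lam) (ht : 0 ≤ t) (g : L2) :
    inner ℂ (resOp α lam t g) g = (((∫ p, rk lam t p * ‖g p‖ ^ 2) +
      4 * Real.pi * robin α lam t * ‖green lam t g‖ ^ 2 : ℝ) : ℂ) := by
  have hg := Lp.memLp g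
  have h1 := integrable_rk_mul hlam ht hg
  have h2 := integrable_rk_mul_norm_sq hlam ht hg
  have e : inner ℂ (resOp α lam t g) g = ∫ p, (((rk lam t p * ‖g p‖ ^ 2 : ℝ) : ℂ) +
      ((4 * Real.pi * robin α lam t * kap : ℝ) : ℂ) * (starRingEnd ℂ) (green lam t g) *
        ((rk lam t p : ℂ) * g p)) := by
    rw [L2.inner_def]
    refine integral_congr_ae ?_
    filter_upwards [resOp_ae hlam ht g] with p hp
    rw [hp, RCLike.inner_apply, resFun]
    simp only [map_add, map_mul, Complex.conj_ofReal]
    rw [mul_add, ← mul_assoc, mul_comm (g p) (rk lam t p : ℂ), mul_assoc (rk lam t p : ℂ),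
      Complex.mul_conj, Complex.normSq_eq_norm_sq]
    push_cast
    ring
  have h2' : Integrable fun p => ((rk lam t p * ‖g p‖ ^ 2 : ℝ) : ℂ) := h2.ofReal
  rw [e, integral_add h2' (h1.const_mul _), integral_const_mul, integral_complex_ofReal]
  have h3 : (4 * Real.pi * robin α lam t * kap : ℝ) * (starRingEnd ℂ) (green lam t g) *
      ∫ p, (rk lam t p : ℂ) * g p = (4 * Real.pi * robin α lam t : ℝ) *
        (green lam t g * (starRingEnd ℂ) (green lam t g)) := by
    nth_rw 2 [green]
    push_cast
    ring
  rw [h3, Complex.mul_conj, Complex.normSq_eq_norm_sq]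
  push_cast
  ring

theorem resOp_zero_nonneg (hα : 0 ≤ α) (hlam : 0 < lam) : 0 ≤ resOp α lam 0 := by
  rw [ContinuousLinearMap.nonneg_iff_isPositive, ContinuousLinearMap.isPositive_iff_complex]
  intro g
  rw [inner_resOp_self hlam le_rfl g]
  refine ⟨by rw [RCLike.re_to_complex, Complex.ofReal_re], ?_⟩
  have := robin_pos hα hlam le_rfl
  have h2 := Real.pi_pos
  have h3 : 0 ≤ ∫ p, rk lam 0 p * ‖g p‖ ^ 2 := integral_nonneg fun p => by
    have := rk_pos hlam le_rfl p
    positivity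
  simp only [RCLike.re_to_complex, Complex.ofReal_re]
  positivity

theorem resOp_zero_injective (hα : 0 ≤ α) (hlam : 0 < lam) {g : L2}
    (h : resOp α lam 0 g = 0) : g = 0 := by
  have h1 := inner_resOp_self (α := α) hlam le_rfl g
  rw [h, inner_zero_left, eq_comm, Complex.ofReal_eq_zero] at h1
  have hg := Lp.memLp g
  have h2 := robin_pos hα hlam le_rfl
  have hpi := Real.pi_pos
  have hnn : ∀ p, 0 ≤ rk lam 0 p * ‖g p‖ ^ 2 := fun p => by
    have := rk_pos hlam le_rfl p
    positivity
  have h3 : 0 ≤ ∫ p, rk lam 0 p * ‖g p‖ ^ 2 := integral_nonneg hnn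
  have h4 : ∫ p, rk lam 0 p * ‖g p‖ ^ 2 = 0 := by
    have : 0 ≤ 4 * Real.pi * robin α lam 0 * ‖green lam 0 g‖ ^ 2 := by positivity
    linarith
  rw [integral_eq_zero_iff_of_nonneg hnn (integrable_rk_mul_norm_sq hlam le_rfl hg)] at h4
  refine Lp.ext ?_
  filter_upwards [h4, Lp.coeFn_zero ℂ 2 (volume : Measure R3)] with p hp hp0
  have := (rk_pos hlam le_rfl p).ne'
  rw [hp0]
  simpa [this] using hp

/-- The resolvent identity. -/
theorem resOp_identity (hα : 0 ≤ α) (hlam : 0 < lam) (ht : 0 < t) (g : L2) :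
    t • resOp α lam 0 (resOp α lam t g) + resOp α lam t g = resOp α lam 0 g := by
  have hg := Lp.memLp g
  set y := resOp α lam t g
  have hy : y =ᵐ[volume] resFun α lam t g := resOp_ae hlam ht.le g
  -- The multiplication parts of the resolvent identity agree pointwise, so what is left is its
  -- pairing with ψ_0. There t ⟨ψ_0, ψ_t⟩ appears, which `robin_identity` turns into a difference of
  -- coupling constants.
  have hgreen : (t : ℂ) * green lam 0 y =
      green lam 0 g - ((robin α lam t / robin α lam 0 : ℝ) : ℂ) * green lam t g := by
    rw [green_congr hy]
    have hre : resFun α lam t g = fun p => (rk lam t p : ℂ) * g p +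
        ((4 * Real.pi * robin α lam t * kap : ℝ) : ℂ) * green lam t g * (rk lam t p : ℂ) := rfl
    rw [hre, green_add (integrable_rk_mul hlam le_rfl (memLp_rk_mul hlam ht.le hg))
      (integrable_rk_mul hlam le_rfl ((memLp_rk_ofReal hlam ht.le).const_mul _)),
      green_const_mul, mul_add, mul_green_zero_rk_mul hlam ht.le hg]
    have h1 := green_zero_rk hlam ht
    have h2 := robin_identity hα hlam ht
    have h3 : (t : ℂ) * (((4 * Real.pi * robin α lam t * kap : ℝ) : ℂ) * green lam t g *
        green lam 0 fun p => (rk lam t p : ℂ)) = ((t * robin α lam t / (√(lam + t) + √lam) : ℝ) : ℂ)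
          * green lam t g := by
      calc _ = ((t * (4 * Real.pi * robin α lam t) : ℝ) : ℂ) * green lam t g *
            ((kap : ℂ) * green lam 0 fun p => (rk lam t p : ℂ)) := by push_cast; ring
        _ = ((t * (4 * Real.pi * robin α lam t) * (1 / (4 * Real.pi) / (√(lam + t) + √lam)) : ℝ) : ℂ)
            * green lam t g := by rw [h1]; push_cast; ring
        _ = _ := by
          congr 2
          have := Real.pi_pos
          field_simp
    rw [h3, h2]
    push_cast
    ring
  refine Lp.ext ?_
  filter_upwards [Lp.coeFn_add (t • resOp α lam 0 y) y, Lp.coeFn_smul t (resOp α lam 0 y), hy,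
    resOp_ae hlam le_rfl y, resOp_ae hlam le_rfl g] with p h1 h2 h3 h4 h5
  rw [h1, Pi.add_apply, h2, Pi.smul_apply, h4, h5, Complex.real_smul, resFun, resFun, h3, resFun,
    mul_add, mul_comm (t : ℂ) (_ * (rk lam 0 p : ℂ)), mul_right_comm _ (rk lam 0 p : ℂ) (t : ℂ),
    mul_assoc _ _ (t : ℂ), mul_comm _ (t : ℂ), hgreen]
  have hb : (robin α lam 0 : ℂ) ≠ 0 := by exact_mod_cast (robin_pos hα hlam le_rfl).ne'
  have hk : (t : ℂ) * ((rk lam 0 p : ℂ) * (rk lam t p : ℂ)) =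
      (rk lam 0 p : ℂ) - (rk lam t p : ℂ) := by
    exact_mod_cast mul_rk_mul_rk_zero hlam ht.le p
  have hk' : (t : ℂ) * ((rk lam 0 p : ℂ) * ((rk lam t p : ℂ) * g p +
      ((4 * Real.pi * robin α lam t * kap : ℝ) : ℂ) * green lam t g * (rk lam t p : ℂ))) =
      ((rk lam 0 p : ℂ) - (rk lam t p : ℂ)) *
        (g p + ((4 * Real.pi * robin α lam t * kap : ℝ) : ℂ) * green lam t g) := by
    rw [← hk]; ring
  rw [hk']
  push_cast
  field_simp
  ring

end resOp

/-! ### The powers of the resolvent as integral operators -/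

/-- The factor (lam + t)⁻¹ comes out of the kernel: σ < 1 gives convergence at t = 0, and σ > 0 at
infinity. -/
theorem ProdInt.of_bound {lam σ C : ℝ} (hlam : 0 < lam) (h0 : 0 < σ) (h1 : σ < 1) {u : ℝ → ℂ}
    {h : R3 → ℂ} (hu : AEStronglyMeasurable u vol0) (hC : ∀ t, 0 < t → ‖u t‖ ≤ C * t ^ (-σ))
    (hh : Integrable h) : ProdInt lam u h := by
  refine ProdInt.of_fst hlam hu hh.1 (fun t ht => ?_) ?_
  · refine (hh.norm.const_mul (lam + t)⁻¹).mono'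
      ((Complex.continuous_ofReal.comp (continuous_rk hlam ht.le)).aestronglyMeasurable.mul hh.1)
      (Filter.Eventually.of_forall fun p => ?_)
    rw [norm_mul, Complex.norm_real, Real.norm_of_nonneg (rk_pos hlam ht.le p).le]
    exact mul_le_mul_of_nonneg_right (rk_le hlam ht.le p) (norm_nonneg _)
  · have hb := (integrableOn_rpow_div_add (σ := 1 - σ) (by linarith) (by linarith) hlam).const_mul
      (C * ∫ p, ‖h p‖)
    have hm : AEStronglyMeasurable (fun t => ‖u t‖ * ∫ p, rk lam t p * ‖h p‖) vol0 := by
      have : AEStronglyMeasurable (fun z : ℝ × R3 => rk lam z.1 z.2 * ‖h z.2‖)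
          (vol0.prod volume) :=
        (measurable_rk lam).aestronglyMeasurable.mul hh.1.norm.comp_snd
      exact hu.norm.mul this.integral_prod_right'
    refine hb.mono' hm ?_
    filter_upwards [ae_restrict_mem measurableSet_Ioi] with t ht
    have ht' : (0 : ℝ) < t := ht
    have hin : 0 ≤ ∫ p, rk lam t p * ‖h p‖ := integral_nonneg fun p => by
      have := rk_pos hlam ht'.le p
      positivity
    have hle : ∫ p, rk lam t p * ‖h p‖ ≤ (lam + t)⁻¹ * ∫ p, ‖h p‖ := by
      rw [← integral_const_mul]
      refine integral_mono_of_nonneg (Filter.Eventually.of_forall fun p => ?_)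
        (hh.norm.const_mul _) (Filter.Eventually.of_forall fun p => ?_)
      · have := rk_pos hlam ht'.le p
        simp only [Pi.zero_apply]
        positivity
      · exact mul_le_mul_of_nonneg_right (rk_le hlam ht'.le p) (norm_nonneg _)
    rw [Real.norm_of_nonneg (by positivity)]
    calc _ ≤ C * t ^ (-σ) * ((lam + t)⁻¹ * ∫ p, ‖h p‖) :=
          mul_le_mul (hC t ht') hle hin ((norm_nonneg _).trans (hC t ht'))
      _ = _ := by
          rw [show 1 - σ - 1 = -σ by ring]
          ring

/-- The integral operator that represents the `σ`-th power of the resolvent. -/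
def powFun (α lam σ : ℝ) (g : R3 → ℂ) (p : R3) : ℂ :=
  (((‖p‖ ^ 2 + lam) ^ (-σ) : ℝ) : ℂ) * g p +
    ((4 * Real.sin (Real.pi * σ) * kap : ℝ) : ℂ) * ∫ t in Ioi (0 : ℝ),
      ((t ^ (-σ) * robin α lam t : ℝ) : ℂ) * green lam t g * (rk lam t p : ℂ)

section

variable {α lam σ : ℝ}

theorem integral_rpow_mul_rk (hlam : 0 < lam) (h0 : 0 < σ) (h1 : σ < 1) (p : R3) :
    ∫ t in Ioi (0 : ℝ), ((t ^ (-σ) : ℝ) : ℂ) * (rk lam t p : ℂ) =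
      ((Real.pi / Real.sin (Real.pi * σ) * (‖p‖ ^ 2 + lam) ^ (-σ) : ℝ) : ℂ) := by
  have hX : 0 < ‖p‖ ^ 2 + lam := by positivity
  have h := integral_rpow_div_add (σ := 1 - σ) (by linarith) (by linarith) hX
  rw [show 1 - σ - 1 = -σ by ring, show Real.pi * (1 - σ) = Real.pi - Real.pi * σ by ring,
    Real.sin_pi_sub] at h
  rw [← h, ← integral_complex_ofReal]
  congr 1
  ext t
  rw [rk]
  push_cast
  rw [div_eq_mul_inv]

/-- The density `t^{-σ} ⟨ψ_t, g⟩ / (4πα + √(lam + t))`. -/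
theorem aestronglyMeasurable_density (α lam e : ℝ) {g : R3 → ℂ}
    (hg : AEStronglyMeasurable g volume) :
    AEStronglyMeasurable (fun t => ((t ^ e * robin α lam t : ℝ) : ℂ) * green lam t g) vol0 := by
  have := measurable_robin α lam
  exact (Measurable.aestronglyMeasurable (by fun_prop)).mul (aestronglyMeasurable_green lam hg)

theorem exists_norm_density_le (hα : 0 ≤ α) (hlam : 0 < lam) {g : R3 → ℂ} (hg : MemLp g 2) :
    ∃ C, 0 ≤ C ∧ ∀ e t : ℝ, 0 < t →
      ‖((t ^ e * robin α lam t : ℝ) : ℂ) * green lam t g‖ ≤ C * t ^ e := by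
  obtain ⟨C, hC, h⟩ := exists_norm_green_le hlam hg
  have hr0 := robin_pos hα hlam le_rfl
  refine ⟨robin α lam 0 * (C * lam ^ (-(1 / 4) : ℝ)), by positivity, fun e t ht => ?_⟩
  have hr := robin_pos hα hlam ht.le
  rw [norm_mul, Complex.norm_real, Real.norm_of_nonneg (by positivity)]
  have h2 : ‖green lam t g‖ ≤ C * lam ^ (-(1 / 4) : ℝ) := (h t ht.le).trans
    (mul_le_mul_of_nonneg_left (Real.rpow_le_rpow_of_nonpos hlam (by linarith) (by norm_num)) hC)
  calc _ ≤ t ^ e * robin α lam 0 * (C * lam ^ (-(1 / 4) : ℝ)) :=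
        mul_le_mul (mul_le_mul_of_nonneg_left (robin_le hα hlam ht.le) (by positivity)) h2
          (norm_nonneg _) (by positivity)
    _ = _ := by ring

theorem powFun_congr {g h : R3 → ℂ} (H : g =ᵐ[volume] h) :
    powFun α lam σ g =ᵐ[volume] powFun α lam σ h := by
  filter_upwards [H] with p hp
  simp only [powFun, hp, green_congr H]

theorem fracPow_resOp_ae (hα : 0 ≤ α) (hlam : 0 < lam) (h0 : 0 < σ) (h1 : σ < 1) (g : L2) :
    fracPow (resOp α lam 0) σ g =ᵐ[volume] powFun α lam σ g := by
  have hg := Lp.memLp g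
  have hs := (sin_pi_mul_pos h0 h1).ne'
  have hpi := Real.pi_ne_zero
  have hgS : ∀ S : Set R3, MeasurableSet S → volume S < ⊤ → ∀ f : R3 → ℂ, MemLp f 2 →
      IntegrableOn f S := fun S _ hfin f hf => by
    have : IsFiniteMeasure (volume.restrict S) := isFiniteMeasure_restrict.2 hfin.ne
    exact (hf.restrict S).integrable one_le_two
  obtain ⟨C, -, hC⟩ := exists_norm_density_le hα hlam hg
  let u₁ : ℝ → ℂ := fun t => ((t ^ (-σ) : ℝ) : ℂ)
  let u₂ : ℝ → ℂ := fun t => ((t ^ (-σ) * robin α lam t : ℝ) : ℂ) * green lam t g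
  -- The weak formula is tested against indicators of sets of finite measure. There `g` is
  -- integrable, so Fubini applies to the multiplication part and to the rank-one part separately,
  -- and these set integrals determine the function almost everywhere.
  have H1 : ∀ S : Set R3, MeasurableSet S → volume S < ⊤ → ProdInt lam u₁ (S.indicator g) :=
    fun S hS hfin => ProdInt.of_bound (C := 1) hlam h0 h1
      (Measurable.aestronglyMeasurable (by fun_prop))
      (fun t ht => by
        rw [one_mul, Complex.norm_real, Real.norm_of_nonneg (by positivity)])
      ((integrable_indicator_iff hS).2 (hgS S hS hfin g hg))
  have H2 : ∀ S : Set R3, MeasurableSet S → volume S < ⊤ →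
      ProdInt lam u₂ (S.indicator fun _ => 1) :=
    fun S hS hfin => ProdInt.of_bound hlam h0 h1 (aestronglyMeasurable_density α lam _ hg.1)
      (fun t ht => hC (-σ) t ht)
      ((integrable_indicator_iff hS).2 (integrableOn_const hfin.ne))
  let A : ℂ := ((Real.sin (Real.pi * σ) / Real.pi : ℝ) : ℂ)
  let B : ℂ := ((4 * Real.pi * kap : ℝ) : ℂ)
  have hpow : ∀ S : Set R3, S.indicator (powFun α lam σ g) = fun p =>
      A * (S.indicator g p * (∫ t in Ioi (0 : ℝ), u₁ t * (rk lam t p : ℂ)) +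
        B * (S.indicator (fun _ => 1) p * ∫ t in Ioi (0 : ℝ), u₂ t * (rk lam t p : ℂ))) := by
    intro S
    ext p
    simp only [u₁, integral_rpow_mul_rk hlam h0 h1]
    by_cases hp : p ∈ S
    · simp only [indicator_of_mem hp, powFun, A, B, u₂]
      push_cast
      have h3 : ((Real.sin (Real.pi * σ) : ℝ) : ℂ) ≠ 0 := by exact_mod_cast hs
      have h4 : (Real.pi : ℂ) ≠ 0 := by exact_mod_cast hpi
      push_cast at h3
      field_simp
    · simp [indicator_of_notMem hp]
  refine ae_eq_of_forall_setIntegral_eq_of_sigmaFinite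
    (fun S hS hfin => hgS S hS hfin _ (Lp.memLp _)) (fun S hS hfin => ?_) fun S hS hfin => ?_
  · rw [← integrable_indicator_iff hS, hpow S]
    exact (((H1 S hS hfin).integrable_snd).add
      (((H2 S hS hfin).integrable_snd).const_mul B)).const_mul A
  · rw [← integral_indicator hS (f := powFun α lam σ g), hpow S, integral_const_mul,
      integral_add (H1 S hS hfin).integrable_snd ((H2 S hS hfin).integrable_snd.const_mul B),
      integral_const_mul, ← (H1 S hS hfin).swap, ← (H2 S hS hfin).swap, ← integral_const_mul B,
      ← integral_add (H1 S hS hfin).integrable_fst ((H2 S hS hfin).integrable_fst.const_mul B),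
      ← L2.inner_indicatorConstLp_one (𝕜 := ℂ) hS hfin.ne,
      inner_fracPow (resOp_zero_nonneg hα hlam)
        (fun t ht g => resOp_identity hα hlam ht g) h0 h1]
    congr 1
    refine setIntegral_congr_fun measurableSet_Ioi fun t ht => ?_
    have ht' : (0 : ℝ) < t := ht
    simp only [L2.inner_indicatorConstLp_one]
    have e1 : ∀ f : R3 → ℂ, ∫ p, (rk lam t p : ℂ) * S.indicator f p =
        ∫ p in S, (rk lam t p : ℂ) * f p := fun f => by
      rw [← integral_indicator hS]
      congr 1
      ext p
      by_cases hp : p ∈ S <;> simp [hp]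
    rw [e1, e1, setIntegral_congr_ae (g := resFun α lam t g) hS
      ((resOp_ae hlam ht'.le g).mono fun p hp _ => hp)]
    unfold resFun
    rw [integral_add (integrable_rk_mul hlam ht'.le hg).integrableOn
      ((hgS S hS hfin _ (memLp_rk_ofReal hlam ht'.le)).const_mul _), integral_const_mul]
    simp only [u₁, u₂, B, mul_one]
    push_cast
    ring

end

/-! ### The equation for the preimages -/

section

variable {α lam σ t : ℝ}

theorem robin_le_rpow (hα : 0 ≤ α) (hlam : 0 < lam) (ht : 0 ≤ t) :
    robin α lam t ≤ (lam + t) ^ (-(1 / 2) : ℝ) := by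
  have h0 : 0 < √(lam + t) := Real.sqrt_pos.2 (by positivity)
  rw [robin, Real.rpow_neg (by positivity), ← Real.sqrt_eq_rpow, ← one_div]
  have := Real.pi_pos
  refine one_div_le_one_div_of_le h0 ?_
  have : 0 ≤ 4 * Real.pi * α := by positivity
  linarith

/-- The coupling decays like (lam + t)^{-1/2} and the pairing like (lam + t)^{-1/4}, so convergence
at infinity needs σ + 3/4 > 1. Subadditivity of the power 1/4 reduces the bound to two scalar
integrals already known. -/
theorem integrableOn_density (hα : 0 ≤ α) (hlam : 0 < lam) (h0 : 1 / 4 < σ) (h1 : σ < 1)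
    {g : R3 → ℂ} (hg : MemLp g 2) :
    IntegrableOn (fun t => ((t ^ (-σ) * robin α lam t : ℝ) : ℂ) * green lam t g) (Ioi 0) := by
  obtain ⟨C, hC, h⟩ := exists_norm_green_le hlam hg
  have i1 := (integrableOn_rpow_div_add (σ := 1 - σ) (by linarith) (by linarith) hlam).const_mul
    (C * lam ^ (1 / 4 : ℝ))
  have i2 := (integrableOn_rpow_div_add (σ := 5 / 4 - σ) (by linarith) (by linarith)
    hlam).const_mul C
  refine (i1.add i2).mono' (aestronglyMeasurable_density α lam _ hg.1) ?_
  filter_upwards [ae_restrict_mem measurableSet_Ioi] with t ht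
  have ht' : (0 : ℝ) < t := ht
  have hr := robin_pos hα hlam ht'.le
  have hlt : 0 < lam + t := by positivity
  rw [norm_mul, Complex.norm_real, Real.norm_of_nonneg (by positivity)]
  have e1 : (lam + t) ^ (-(1 / 2) : ℝ) * (lam + t) ^ (-(1 / 4) : ℝ) =
      (lam + t) ^ (1 / 4 : ℝ) / (lam + t) := by
    rw [← Real.rpow_add hlt, ← Real.rpow_sub_one hlt.ne']
    norm_num
  have e2 : (lam + t) ^ (1 / 4 : ℝ) ≤ lam ^ (1 / 4 : ℝ) + t ^ (1 / 4 : ℝ) :=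
    Real.rpow_add_le_add_rpow hlam.le ht'.le (by norm_num) (by norm_num)
  calc _ ≤ t ^ (-σ) * (lam + t) ^ (-(1 / 2) : ℝ) * (C * (lam + t) ^ (-(1 / 4) : ℝ)) :=
        mul_le_mul (mul_le_mul_of_nonneg_left (robin_le_rpow hα hlam ht'.le) (by positivity))
          (h t ht'.le) (norm_nonneg _) (by positivity)
    _ = C * t ^ (-σ) * ((lam + t) ^ (1 / 4 : ℝ) / (lam + t)) := by rw [← e1]; ring
    _ ≤ C * t ^ (-σ) * ((lam ^ (1 / 4 : ℝ) + t ^ (1 / 4 : ℝ)) / (lam + t)) := by gcongr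
    _ = _ := by
        simp only [Pi.add_apply]
        rw [show 1 - σ - 1 = -σ by ring, show 5 / 4 - σ - 1 = -σ + 1 / 4 by ring,
          Real.rpow_add ht']
        ring

theorem integrableOn_density_mul_rk (hα : 0 ≤ α) (hlam : 0 < lam) (h0 : 1 / 4 < σ) (h1 : σ < 1)
    {g : R3 → ℂ} (hg : MemLp g 2) (p : R3) :
    IntegrableOn (fun t => ((t ^ (1 - σ) * robin α lam t : ℝ) : ℂ) * green lam t g *
      (rk lam t p : ℂ)) (Ioi 0) := by
  have hi := integrableOn_density hα hlam h0 h1 hg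
  refine hi.norm.mono' ((aestronglyMeasurable_density α lam _ hg.1).mul
    ((measurable_rk lam).comp measurable_prodMk_right).complex_ofReal.aestronglyMeasurable) ?_
  filter_upwards [ae_restrict_mem measurableSet_Ioi] with t ht
  have ht' : (0 : ℝ) < t := ht
  have hr := rk_pos hlam ht'.le p
  have hle : t * rk lam t p ≤ 1 := by
    rw [rk, ← div_eq_mul_inv, div_le_one (by positivity)]
    linarith [sq_nonneg ‖p‖]
  have hb := robin_pos hα hlam ht'.le
  have hpow : t ^ (1 - σ) = t ^ (-σ) * t := by
    rw [← Real.rpow_add_one ht'.ne']; congr 1; ring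
  simp only [norm_mul, Complex.norm_real, Real.norm_of_nonneg hr.le, hpow,
    Real.norm_of_nonneg ht'.le]
  calc _ = (‖t ^ (-σ)‖ * ‖robin α lam t‖ * ‖green lam t g‖) * (t * rk lam t p) := by ring
    _ ≤ _ := mul_le_of_le_one_right (by positivity) hle

/-- The operator `K` with `R_s = 1 - K` after conjugation with `(p² + lam)^σ`. -/
def corrFun (α lam σ : ℝ) (g : R3 → ℂ) (p : R3) : ℂ :=
  (((‖p‖ ^ 2 + lam) ^ (σ - 1) : ℝ) : ℂ) * (((4 * Real.sin (Real.pi * σ) * kap : ℝ) : ℂ) *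
    ∫ t in Ioi (0 : ℝ),
      ((t ^ (1 - σ) * robin α lam t : ℝ) : ℂ) * green lam t g * (rk lam t p : ℂ))

/-- The coefficient `q` in terms of `(p² + lam)^σ f̂`. -/
def chargeFun (α lam σ : ℝ) (g : R3 → ℂ) : ℂ :=
  ((4 * Real.sin (Real.pi * σ) : ℝ) : ℂ) * ∫ t in Ioi (0 : ℝ),
    ((t ^ (-σ) * robin α lam t : ℝ) : ℂ) * green lam t g

theorem rk_zero_eq (p : R3) : rk lam 0 p = (‖p‖ ^ 2 + lam) ^ (-1 : ℝ) := by
  rw [rk, add_zero, Real.rpow_neg_one]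

theorem powFun_eq (hα : 0 ≤ α) (hlam : 0 < lam) (h0 : 1 / 4 < σ) (h1 : σ < 1)
    {g : R3 → ℂ} (hg : MemLp g 2) (p : R3) :
    powFun α lam σ g p = (((‖p‖ ^ 2 + lam) ^ (-σ) : ℝ) : ℂ) * (g p - corrFun α lam σ g p) +
      chargeFun α lam σ g * kap * (rk lam 0 p : ℂ) := by
  have hX : 0 < ‖p‖ ^ 2 + lam := by positivity
  have hi := integrableOn_density hα hlam h0 h1 hg
  have e : ∫ t in Ioi (0 : ℝ), ((t ^ (-σ) * robin α lam t : ℝ) : ℂ) * green lam t g *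
      (rk lam t p : ℂ) = (rk lam 0 p : ℂ) * ((∫ t in Ioi (0 : ℝ),
        ((t ^ (-σ) * robin α lam t : ℝ) : ℂ) * green lam t g) - ∫ t in Ioi (0 : ℝ),
        ((t ^ (1 - σ) * robin α lam t : ℝ) : ℂ) * green lam t g * (rk lam t p : ℂ)) := by
    -- This splitting separates the multiple of ψ_0, whose coefficient is the charge, from a more
    -- regular remainder, which becomes the operator K.
    have hk : ∀ t : ℝ, 0 < t → (rk lam t p : ℂ) = (rk lam 0 p : ℂ) * (1 - t * rk lam t p) := by
      intro t ht
      have := mul_rk_mul_rk_zero hlam ht.le p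
      rw [mul_sub, mul_one, mul_left_comm]
      exact_mod_cast (by linarith : rk lam t p = rk lam 0 p - t * (rk lam 0 p * rk lam t p))
    have hpow : ∀ t : ℝ, 0 < t → t ^ (1 - σ) = t ^ (-σ) * t := fun t ht => by
      rw [← Real.rpow_add_one ht.ne']; congr 1; ring
    have hi2 := integrableOn_density_mul_rk hα hlam h0 h1 hg p
    rw [← integral_sub hi hi2, ← integral_const_mul]
    refine setIntegral_congr_fun measurableSet_Ioi fun t ht => ?_
    nth_rw 1 [hk t ht]
    rw [hpow t ht]
    push_cast
    ring
  have hXX : (((‖p‖ ^ 2 + lam) ^ (-σ) : ℝ) : ℂ) * (((‖p‖ ^ 2 + lam) ^ (σ - 1) : ℝ) : ℂ) =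
      (rk lam 0 p : ℂ) := by
    rw [← Complex.ofReal_mul, ← Real.rpow_add hX, rk_zero_eq]
    congr 2
    ring
  rw [powFun, e, corrFun, chargeFun, mul_sub (((‖p‖ ^ 2 + lam) ^ (-σ) : ℝ) : ℂ), ← mul_assoc
    (((‖p‖ ^ 2 + lam) ^ (-σ) : ℝ) : ℂ) (((‖p‖ ^ 2 + lam) ^ (σ - 1) : ℝ) : ℂ), hXX]
  push_cast
  ring

theorem memLp_schur_robin {b₁ b₂ e : ℝ} (hα : 0 ≤ α) (hlam : 0 < lam) (h1 : -(3 / 4) < b₁)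
    (h1' : b₁ < 1 / 4) (h2 : -(3 / 4) < b₂) (h2' : b₂ < 1 / 4) (he : e = -b₁ - b₂) {g : R3 → ℂ}
    (hg : MemLp g 2) :
    MemLp (fun p => (((‖p‖ ^ 2 + lam) ^ b₁ : ℝ) : ℂ) * ∫ t in Ioi (0 : ℝ),
      ((t ^ e * robin α lam t : ℝ) : ℂ) *
        green lam t (fun q => (((‖q‖ ^ 2 + lam) ^ b₂ : ℝ) : ℂ) * g q) * (rk lam t p : ℂ)) 2 := by
  have hm := measurable_robin α lam
  have h := (memLp_schur_comp hlam h1 h1' h2 h2' (w := fun t => t ^ (1 / 2 : ℝ) * robin α lam t)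
    (by fun_prop) (fun t ht => sqrt_mul_robin_le_one hα hlam ht) hg).const_mul (kap : ℂ)
  convert h using 1
  ext p
  rw [mul_left_comm (kap : ℂ), ← integral_const_mul (kap : ℂ)]
  congr 1
  refine setIntegral_congr_fun measurableSet_Ioi fun t ht => ?_
  have ht' : (0 : ℝ) < t := ht
  simp only [green]
  have hpow : t ^ e = t ^ (-b₁ - b₂ - 1 / 2) * t ^ (1 / 2 : ℝ) := by
    rw [← Real.rpow_add ht', he]; congr 1; ring
  rw [hpow]
  push_cast
  ring

theorem memLp_corrFun (hα : 0 ≤ α) (hlam : 0 < lam) (h0 : 1 / 4 < σ) (h1 : σ < 1)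
    {g : R3 → ℂ} (hg : MemLp g 2) : MemLp (corrFun α lam σ g) 2 := by
  have h := (memLp_schur_robin (b₁ := σ - 1) (b₂ := 0) (e := 1 - σ) hα hlam (by linarith)
    (by linarith) (by norm_num) (by norm_num) (by ring) hg).const_mul
    ((4 * Real.sin (Real.pi * σ) * kap : ℝ) : ℂ)
  simp only [Real.rpow_zero, Complex.ofReal_one, one_mul] at h
  convert h using 1
  ext p
  rw [corrFun]
  ring

/-- `(p² + lam)^{-σ} v`. -/
def scaled (lam σ : ℝ) (v : R3 → ℂ) (p : R3) : ℂ := (((‖p‖ ^ 2 + lam) ^ (-σ) : ℝ) : ℂ) * v p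

/-- The density that determines the preimage of `(v, Q)`. -/
def errDensity (α lam σ : ℝ) (v : R3 → ℂ) (Q : ℂ) (t : ℝ) : ℂ :=
  ((t ^ (σ - 1) * robin α lam t : ℝ) : ℂ) *
    (Q / ((4 * Real.pi * robin α lam 0 : ℝ) : ℂ) - t * green lam t (scaled lam σ v))

/-- The correction `E` such that `v + E` is the preimage of `(v, Q)`. -/
def errFun (α lam σ : ℝ) (v : R3 → ℂ) (Q : ℂ) (p : R3) : ℂ :=
  ((4 * Real.sin (Real.pi * σ) * kap : ℝ) : ℂ) *
    ∫ t in Ioi (0 : ℝ), errDensity α lam σ v Q t * (rk lam t p : ℂ)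

/-- `⟨ψ_0, ψ_t⟩`. -/
def greenPair (lam t : ℝ) : ℝ := 1 / (4 * Real.pi) / (√(lam + t) + √lam)

theorem greenPair_pos (hlam : 0 < lam) (ht : 0 ≤ t) : 0 < greenPair lam t := by
  have h1 := Real.sqrt_pos.2 hlam
  have := Real.pi_pos
  unfold greenPair
  positivity

theorem robin_greenPair (hα : 0 ≤ α) (hlam : 0 < lam) (ht : 0 < t) :
    4 * Real.pi * (robin α lam t * t * greenPair lam t) = 1 - robin α lam t / robin α lam 0 := by
  rw [← robin_identity hα hlam ht, greenPair]
  have := Real.pi_pos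
  field_simp

theorem kap_mul_green_rk_zero (hlam : 0 < lam) (ht : 0 < t) :
    (kap : ℂ) * green lam t (fun p => (rk lam 0 p : ℂ)) = (greenPair lam t : ℂ) := by
  have h := green_zero_rk hlam ht
  simp only [green, mul_comm (rk lam t _ : ℂ)] at h ⊢
  exact h

theorem memLp_scaled (hlam : 0 < lam) (h0 : 0 ≤ σ) {v : R3 → ℂ} (hv : MemLp v 2) :
    MemLp (scaled lam σ v) 2 := by
  refine hv.of_le_mul (c := lam ^ (-σ)) ((Complex.continuous_ofReal.comp
    (continuous_symbol hlam _)).aestronglyMeasurable.mul hv.1)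
    (Filter.Eventually.of_forall fun p => ?_)
  rw [scaled, norm_mul, Complex.norm_real, Real.norm_of_nonneg (by positivity)]
  refine mul_le_mul_of_nonneg_right ?_ (norm_nonneg _)
  exact Real.rpow_le_rpow_of_nonpos hlam (by nlinarith [sq_nonneg ‖p‖]) (by linarith)

theorem integrableOn_rpow_mul_rk (hlam : 0 < lam) (h0 : 0 < σ) (h1 : σ < 1) (p : R3) :
    IntegrableOn (fun t : ℝ => t ^ (σ - 1) * rk lam t p) (Ioi 0) :=
  integrableOn_rpow_div_add h0 h1 (by positivity : 0 < ‖p‖ ^ 2 + lam)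

/-- The t-integral is done first: it yields (p² + lam)^{σ-1}, which together with the scaling leaves
(p² + lam)⁻¹, and this is square integrable against `v`. -/
theorem prodInt_scaled (hlam : 0 < lam) (h0 : 0 < σ) (h1 : σ < 1) {v : R3 → ℂ}
    (hv : MemLp v 2) : ProdInt lam (fun t => ((t ^ (σ - 1) : ℝ) : ℂ)) (scaled lam σ v) := by
  refine ProdInt.of_snd hlam (Measurable.aestronglyMeasurable (by fun_prop))
    (memLp_scaled hlam h0.le hv).1 (fun p => ?_) ?_
  · have : IntegrableOn (fun t : ℝ => ((t ^ (σ - 1) * rk lam t p : ℝ) : ℂ)) (Ioi 0) :=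
      (integrableOn_rpow_mul_rk hlam h0 h1 p).ofReal
    simpa only [Complex.ofReal_mul] using this
  · refine ((integrable_rk_mul hlam le_rfl hv).norm.const_mul
      (Real.pi / Real.sin (Real.pi * σ))).congr (Filter.Eventually.of_forall fun p => ?_)
    have hX : 0 < ‖p‖ ^ 2 + lam := by positivity
    have e : ∫ t in Ioi (0 : ℝ), ‖((t ^ (σ - 1) : ℝ) : ℂ)‖ * rk lam t p =
        Real.pi / Real.sin (Real.pi * σ) * (‖p‖ ^ 2 + lam) ^ (σ - 1) := by
      rw [← integral_rpow_div_add h0 h1 hX]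
      refine setIntegral_congr_fun measurableSet_Ioi fun t ht => ?_
      have ht' : (0 : ℝ) < t := ht
      simp only [Complex.norm_real, Real.norm_of_nonneg (by positivity : 0 ≤ t ^ (σ - 1))]
      rw [rk, div_eq_mul_inv]
    beta_reduce
    rw [e, scaled, norm_mul, norm_mul, Complex.norm_real, Complex.norm_real,
      Real.norm_of_nonneg (rk_pos hlam le_rfl p).le, Real.norm_of_nonneg (by positivity),
      rk_zero_eq, show (-1 : ℝ) = -σ + (σ - 1) by ring, Real.rpow_add hX]
    ring

theorem integral_rpow_mul_green_scaled (hlam : 0 < lam) (h0 : 0 < σ) (h1 : σ < 1) {v : R3 → ℂ}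
    (hv : MemLp v 2) :
    IntegrableOn (fun t => ((t ^ (σ - 1) : ℝ) : ℂ) * green lam t (scaled lam σ v)) (Ioi 0) ∧
      ∫ t in Ioi (0 : ℝ), ((t ^ (σ - 1) : ℝ) : ℂ) * green lam t (scaled lam σ v) =
        ((Real.pi / Real.sin (Real.pi * σ) : ℝ) : ℂ) * green lam 0 v := by
  have H := prodInt_scaled hlam h0 h1 hv
  constructor
  · have := H.integrable_fst.const_mul (kap : ℂ)
    refine this.congr (Filter.Eventually.of_forall fun t => ?_)
    simp only [green]
    ring
  · have := H.swap
    have e : ∀ p, scaled lam σ v p * ∫ t in Ioi (0 : ℝ), ((t ^ (σ - 1) : ℝ) : ℂ) *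
        (rk lam t p : ℂ) = ((Real.pi / Real.sin (Real.pi * σ) : ℝ) : ℂ) *
          ((rk lam 0 p : ℂ) * v p) := fun p => by
      have hX : 0 < ‖p‖ ^ 2 + lam := by positivity
      have h := integral_rpow_mul_rk (σ := 1 - σ) hlam (by linarith) (by linarith) p
      rw [show -(1 - σ) = σ - 1 by ring, show Real.pi * (1 - σ) = Real.pi - Real.pi * σ by ring,
        Real.sin_pi_sub] at h
      rw [h, scaled, rk_zero_eq, show (-1 : ℝ) = -σ + (σ - 1) by ring, Real.rpow_add hX]
      push_cast
      ring
    simp only [e, integral_const_mul] at this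
    rw [green, mul_left_comm, ← this, ← integral_const_mul]
    congr 1
    ext t
    rw [green]
    ring

end

/-! ### Explicit solution for a prescribed pair (v, Q) -/

section

variable {α lam σ t : ℝ} {v : R3 → ℂ} {Q : ℂ}

/-- The density `t^{σ-1} ⟨ψ_t, (p² + lam)^{-σ} v + Q ψ_0⟩ / (4πα + √(lam + t))`. -/
def chargeDensity (α lam σ : ℝ) (v : R3 → ℂ) (Q : ℂ) (t : ℝ) : ℂ :=
  ((t ^ (σ - 1) * robin α lam t : ℝ) : ℂ) *
    (green lam t (scaled lam σ v) + Q * (greenPair lam t : ℂ))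

/-- Each of the two factors is at most a constant times (lam + t)^{-1/2}, so their product is
dominated by a multiple of 1/(lam + t). -/
theorem integrableOn_robin_greenPair (hα : 0 ≤ α) (hlam : 0 < lam) (h0 : 0 < σ) (h1 : σ < 1) :
    IntegrableOn (fun t => t ^ (σ - 1) * robin α lam t * greenPair lam t) (Ioi 0) := by
  have hm := measurable_robin α lam
  have hm' : Measurable (greenPair lam) := by unfold greenPair; fun_prop
  refine ((integrableOn_rpow_div_add h0 h1 hlam).const_mul (1 / (4 * Real.pi))).mono'
    (Measurable.aestronglyMeasurable (by fun_prop)) ?_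
  filter_upwards [ae_restrict_mem measurableSet_Ioi] with t ht
  have ht' : (0 : ℝ) < t := ht
  have hr := robin_pos hα hlam ht'.le
  have hg := greenPair_pos hlam ht'.le
  have hpi := Real.pi_pos
  have hs : 0 < √(lam + t) := Real.sqrt_pos.2 (by positivity)
  rw [Real.norm_of_nonneg (by positivity)]
  have h1 : robin α lam t ≤ 1 / √(lam + t) := by
    rw [robin]
    refine one_div_le_one_div_of_le hs ?_
    have : 0 ≤ 4 * Real.pi * α := by positivity
    linarith
  have h2 : greenPair lam t ≤ 1 / (4 * Real.pi) / √(lam + t) := by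
    rw [greenPair]
    refine div_le_div_of_nonneg_left (by positivity) hs ?_
    linarith [Real.sqrt_nonneg lam]
  calc _ ≤ t ^ (σ - 1) * (1 / √(lam + t)) * (1 / (4 * Real.pi) / √(lam + t)) := by gcongr
    _ = 1 / (4 * Real.pi) * (t ^ (σ - 1) / (√(lam + t) * √(lam + t))) := by
        field_simp
    _ = _ := by rw [Real.mul_self_sqrt (by positivity)]

theorem integrableOn_robin_green_scaled (hα : 0 ≤ α) (hlam : 0 < lam) (h0 : 0 < σ) (h1 : σ < 1)
    (hv : MemLp v 2) :
    IntegrableOn (fun t => ((t ^ (σ - 1) * robin α lam t : ℝ) : ℂ) *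
      green lam t (scaled lam σ v)) (Ioi 0) := by
  refine ((integral_rpow_mul_green_scaled hlam h0 h1 hv).1.norm.const_mul (robin α lam 0)).mono'
    (aestronglyMeasurable_density α lam _ (memLp_scaled hlam h0.le hv).1) ?_
  filter_upwards [ae_restrict_mem measurableSet_Ioi] with t ht
  have ht' : (0 : ℝ) < t := ht
  have hr := robin_pos hα hlam ht'.le
  rw [norm_mul, norm_mul, Complex.norm_real, Complex.norm_real, norm_mul, ← mul_assoc,
    mul_comm ‖t ^ (σ - 1)‖, Real.norm_of_nonneg hr.le]
  gcongr
  exact robin_le hα hlam ht'.le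

theorem integrableOn_chargeDensity (hα : 0 ≤ α) (hlam : 0 < lam) (h0 : 0 < σ) (h1 : σ < 1)
    (hv : MemLp v 2) : IntegrableOn (chargeDensity α lam σ v Q) (Ioi 0) := by
  have i1 := integrableOn_robin_green_scaled hα hlam h0 h1 hv
  have i2 : IntegrableOn (fun t => ((t ^ (σ - 1) * robin α lam t * greenPair lam t : ℝ) : ℂ))
    (Ioi 0) := (integrableOn_robin_greenPair hα hlam h0 h1).ofReal
  refine (i1.add (i2.const_mul Q)).congr (Filter.Eventually.of_forall fun t => ?_)
  simp only [Pi.add_apply, chargeDensity]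
  push_cast
  ring

theorem aestronglyMeasurable_errDensity (hlam : 0 < lam) (h0 : 0 < σ)
    (hv : MemLp v 2) : AEStronglyMeasurable (errDensity α lam σ v Q) vol0 := by
  have hm := measurable_robin α lam
  unfold errDensity
  refine (Measurable.aestronglyMeasurable (by fun_prop)).mul (aestronglyMeasurable_const.sub
    ((Measurable.aestronglyMeasurable (by fun_prop)).mul
      (aestronglyMeasurable_green lam (memLp_scaled hlam h0.le hv).1)))

theorem mul_rk_le_one (hlam : 0 < lam) (ht : 0 ≤ t) (p : R3) : t * rk lam t p ≤ 1 := by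
  rw [rk, ← div_eq_mul_inv, div_le_one (by positivity)]
  nlinarith [sq_nonneg ‖p‖]

/-- Pointwise relation of the two densities. -/
theorem errDensity_eq (hα : 0 ≤ α) (hlam : 0 < lam) (ht : 0 < t) :
    errDensity α lam σ v Q t = ((t ^ (σ - 1) : ℝ) : ℂ) * (Q / (4 * Real.pi : ℝ)) -
      t * chargeDensity α lam σ v Q t := by
  have h := robin_greenPair hα hlam ht
  have hb : (robin α lam 0 : ℂ) ≠ 0 := by exact_mod_cast (robin_pos hα hlam le_rfl).ne'
  have hpi : (Real.pi : ℂ) ≠ 0 := by exact_mod_cast Real.pi_ne_zero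
  have h' : 4 * (Real.pi : ℂ) * ((robin α lam t : ℂ) * t * (greenPair lam t : ℂ)) =
      1 - (robin α lam t : ℂ) / (robin α lam 0 : ℂ) := by exact_mod_cast h
  have h'' : (robin α lam t : ℂ) * t * (greenPair lam t : ℂ) =
      (1 - (robin α lam t : ℂ) / (robin α lam 0 : ℂ)) / (4 * Real.pi) := by
    rw [← h']; field_simp
  have e : t * chargeDensity α lam σ v Q t = ((t ^ (σ - 1) : ℝ) : ℂ) *
      ((robin α lam t : ℂ) * t * green lam t (scaled lam σ v) +
        Q * ((robin α lam t : ℂ) * t * (greenPair lam t : ℂ))) := by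
    rw [chargeDensity]; push_cast; ring
  rw [e, h'', errDensity]
  push_cast
  field_simp
  ring

theorem integrableOn_errDensity_mul_rk (hα : 0 ≤ α) (hlam : 0 < lam) (h0 : 0 < σ) (h1 : σ < 1)
    (hv : MemLp v 2) (p : R3) :
    IntegrableOn (fun t => chargeDensity α lam σ v Q t * (t * rk lam t p : ℂ)) (Ioi 0) ∧
    IntegrableOn (fun t => errDensity α lam σ v Q t * (rk lam t p : ℂ)) (Ioi 0) := by
  have hc := integrableOn_chargeDensity (Q := Q) hα hlam h0 h1 hv
  have hrk : Measurable fun t => (rk lam t p : ℂ) :=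
    ((measurable_rk lam).comp measurable_prodMk_right).complex_ofReal
  have i1 : IntegrableOn (fun t => chargeDensity α lam σ v Q t * (t * rk lam t p : ℂ)) (Ioi 0) := by
    refine hc.norm.mono' (hc.1.mul (Measurable.aestronglyMeasurable (by fun_prop))) ?_
    filter_upwards [ae_restrict_mem measurableSet_Ioi] with t ht
    have ht' : (0 : ℝ) < t := ht
    have hr := rk_pos hlam ht'.le p
    rw [norm_mul]
    refine mul_le_of_le_one_right (norm_nonneg _) ?_
    rw [← Complex.ofReal_mul, Complex.norm_real, Real.norm_of_nonneg (by positivity)]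
    exact mul_rk_le_one hlam ht'.le p
  refine ⟨i1, ?_⟩
  have i2 : IntegrableOn (fun t : ℝ => ((t ^ (σ - 1) * rk lam t p : ℝ) : ℂ)) (Ioi 0) :=
    (integrableOn_rpow_mul_rk hlam h0 h1 p).ofReal
  refine ((i2.const_mul (Q / (4 * Real.pi : ℝ))).sub i1).congr ?_
  filter_upwards [ae_restrict_mem measurableSet_Ioi] with t ht
  rw [errDensity_eq hα hlam ht]
  simp only [Pi.sub_apply]
  push_cast
  ring

/-- `(p² + lam) N^{1-σ} h = v + E + const` for `h = (p² + lam)^{-σ} v + Q ψ_0`. -/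
theorem powFun_one_sub (hα : 0 ≤ α) (hlam : 0 < lam) (h0 : 0 < σ) (h1 : σ < 1)
    (hv : MemLp v 2) {h : R3 → ℂ}
    (hh : h =ᵐ[volume] fun p => scaled lam σ v p + Q * kap * (rk lam 0 p : ℂ)) :
    powFun α lam (1 - σ) h =ᵐ[volume] fun p => (rk lam 0 p : ℂ) * (v p + errFun α lam σ v Q p +
      ((4 * Real.sin (Real.pi * σ) * kap : ℝ) : ℂ) *
        ∫ t in Ioi (0 : ℝ), chargeDensity α lam σ v Q t) := by
  have hgreen : ∀ t, 0 < t → green lam t h =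
      green lam t (scaled lam σ v) + Q * (greenPair lam t : ℂ) := fun t ht => by
    rw [green_congr hh, green_add (integrable_rk_mul hlam ht.le (memLp_scaled hlam h0.le hv))
      (integrable_rk_mul hlam ht.le ((memLp_rk_ofReal hlam le_rfl).const_mul _)),
      green_const_mul, mul_assoc, kap_mul_green_rk_zero hlam ht]
  filter_upwards [hh] with p hp
  have hX : 0 < ‖p‖ ^ 2 + lam := by positivity
  have hc := integrableOn_chargeDensity (Q := Q) hα hlam h0 h1 hv
  obtain ⟨i1, i2⟩ := integrableOn_errDensity_mul_rk (α := α) (Q := Q) hα hlam h0 h1 hv p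
  have hs : Real.sin (Real.pi * (1 - σ)) = Real.sin (Real.pi * σ) := by
    rw [mul_sub, mul_one, Real.sin_pi_sub]
  have eint : ∫ t in Ioi (0 : ℝ), ((t ^ (-(1 - σ)) * robin α lam t : ℝ) : ℂ) * green lam t h *
      (rk lam t p : ℂ) = (rk lam 0 p : ℂ) * ((∫ t in Ioi (0 : ℝ), chargeDensity α lam σ v Q t) -
        ∫ t in Ioi (0 : ℝ), chargeDensity α lam σ v Q t * (t * rk lam t p : ℂ)) := by
    rw [← integral_sub hc i1, ← integral_const_mul]
    refine setIntegral_congr_fun measurableSet_Ioi fun t ht => ?_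
    have ht' : (0 : ℝ) < t := ht
    have := mul_rk_mul_rk_zero hlam ht'.le p
    have hk : (rk lam t p : ℂ) = (rk lam 0 p : ℂ) * (1 - t * rk lam t p) := by
      rw [mul_sub, mul_one, mul_left_comm]
      exact_mod_cast (by linarith : rk lam t p = rk lam 0 p - t * (rk lam 0 p * rk lam t p))
    simp only [hgreen t ht', chargeDensity]
    nth_rw 1 [hk]
    rw [show -(1 - σ) = σ - 1 by ring]
    ring
  have eerr : ∫ t in Ioi (0 : ℝ), errDensity α lam σ v Q t * (rk lam t p : ℂ) =
      (Q / (4 * Real.pi : ℝ)) * ((Real.pi / Real.sin (Real.pi * σ) *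
        (‖p‖ ^ 2 + lam) ^ (σ - 1) : ℝ) : ℂ) -
        ∫ t in Ioi (0 : ℝ), chargeDensity α lam σ v Q t * (t * rk lam t p : ℂ) := by
    have i3 : IntegrableOn (fun t : ℝ => ((t ^ (σ - 1) / (‖p‖ ^ 2 + lam + t) : ℝ) : ℂ)) (Ioi 0) :=
      (integrableOn_rpow_div_add h0 h1 hX).ofReal
    rw [← integral_rpow_div_add h0 h1 hX, ← integral_complex_ofReal, ← integral_const_mul,
      ← integral_sub (i3.const_mul _) i1]
    refine setIntegral_congr_fun measurableSet_Ioi fun t ht => ?_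
    simp only [errDensity_eq hα hlam ht, div_eq_mul_inv, rk]
    push_cast
    ring
  rw [powFun, hs, eint, hp, errFun, eerr, scaled, rk_zero_eq]
  have e1 : (‖p‖ ^ 2 + lam) ^ (-(1 - σ)) * (‖p‖ ^ 2 + lam) ^ (-σ) = (‖p‖ ^ 2 + lam) ^ (-1 : ℝ) := by
    rw [← Real.rpow_add hX]; congr 1; ring
  rw [show -(1 - σ) = σ - 1 by ring] at e1 ⊢
  have e2 : (((‖p‖ ^ 2 + lam) ^ (σ - 1) : ℝ) : ℂ) * (((‖p‖ ^ 2 + lam) ^ (-σ) : ℝ) : ℂ) =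
      (((‖p‖ ^ 2 + lam) ^ (-1 : ℝ) : ℝ) : ℂ) := by exact_mod_cast e1
  have hsn : ((Real.sin (Real.pi * σ) : ℝ) : ℂ) ≠ 0 := by exact_mod_cast (sin_pi_mul_pos h0 h1).ne'
  have hpi : (Real.pi : ℂ) ≠ 0 := by exact_mod_cast Real.pi_ne_zero
  -- The constant part of `errDensity`, integrated against the kernel, reproduces exactly the
  -- contribution of the summand Q ψ_0 of `h`. This is why the density has the factor 1/(4π · `robin
  -- α lam 0`).
  have e3 : ((4 * Real.sin (Real.pi * σ) * kap : ℝ) : ℂ) * ((Q / (4 * Real.pi : ℝ)) *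
      ((Real.pi / Real.sin (Real.pi * σ) * (‖p‖ ^ 2 + lam) ^ (σ - 1) : ℝ) : ℂ)) =
      Q * kap * (((‖p‖ ^ 2 + lam) ^ (σ - 1) : ℝ) : ℂ) := by
    rw [Complex.ofReal_mul, Complex.ofReal_mul, Complex.ofReal_mul (_ / _), Complex.ofReal_div,
      Complex.ofReal_mul]
    generalize ((Real.sin (Real.pi * σ) : ℝ) : ℂ) = S at *
    push_cast
    field_simp
  rw [mul_add, ← mul_assoc, e2, mul_sub (((4 * Real.sin (Real.pi * σ) * kap : ℝ) : ℂ)), e3]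
  ring

theorem errDensity_mul_greenPair (hα : 0 ≤ α) (hlam : 0 < lam) (ht : 0 < t) :
    errDensity α lam σ v Q t * (greenPair lam t : ℂ) =
      Q / ((4 * Real.pi * robin α lam 0 : ℝ) : ℂ) *
        ((t ^ (σ - 1) * robin α lam t * greenPair lam t : ℝ) : ℂ) -
      ((1 / (4 * Real.pi) : ℝ) : ℂ) * (((t ^ (σ - 1) : ℝ) : ℂ) * green lam t (scaled lam σ v)) +
      ((1 / (4 * Real.pi * robin α lam 0) : ℝ) : ℂ) *
        (((t ^ (σ - 1) * robin α lam t : ℝ) : ℂ) * green lam t (scaled lam σ v)) := by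
  have h := robin_greenPair hα hlam ht
  have hb : (robin α lam 0 : ℂ) ≠ 0 := by exact_mod_cast (robin_pos hα hlam le_rfl).ne'
  have hpi : (Real.pi : ℂ) ≠ 0 := by exact_mod_cast Real.pi_ne_zero
  have h' : 4 * (Real.pi : ℂ) * ((robin α lam t : ℂ) * t * (greenPair lam t : ℂ)) =
      1 - (robin α lam t : ℂ) / (robin α lam 0 : ℂ) := by exact_mod_cast h
  have h'' : (robin α lam t : ℂ) * t * (greenPair lam t : ℂ) =
      (1 - (robin α lam t : ℂ) / (robin α lam 0 : ℂ)) / (4 * Real.pi) := by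
    rw [← h']; field_simp
  have e : errDensity α lam σ v Q t * (greenPair lam t : ℂ) =
      Q / ((4 * Real.pi * robin α lam 0 : ℝ) : ℂ) *
        ((t ^ (σ - 1) * robin α lam t * greenPair lam t : ℝ) : ℂ) -
      ((t ^ (σ - 1) : ℝ) : ℂ) * green lam t (scaled lam σ v) *
        ((robin α lam t : ℂ) * t * (greenPair lam t : ℂ)) := by
    rw [errDensity]; push_cast; ring
  rw [e, h'']
  push_cast
  field_simp
  ring

/-- This pairs the correction E with ψ_0. The term without the coupling integrates to ⟨ψ_0, v⟩ by
`integral_rpow_mul_green_scaled`; the remaining two terms together form the integral of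
`chargeDensity`. -/
theorem integral_errDensity_mul_greenPair (hα : 0 ≤ α) (hlam : 0 < lam) (h0 : 0 < σ) (h1 : σ < 1)
    (hv : MemLp v 2) :
    IntegrableOn (fun t => errDensity α lam σ v Q t * (greenPair lam t : ℂ)) (Ioi 0) ∧
    ((4 * Real.sin (Real.pi * σ) : ℝ) : ℂ) *
      ∫ t in Ioi (0 : ℝ), errDensity α lam σ v Q t * (greenPair lam t : ℂ) =
      ((4 * Real.sin (Real.pi * σ) : ℝ) : ℂ) / ((4 * Real.pi * robin α lam 0 : ℝ) : ℂ) *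
        (∫ t in Ioi (0 : ℝ), chargeDensity α lam σ v Q t) - green lam 0 v := by
  have i1 := integrableOn_robin_green_scaled hα hlam h0 h1 hv
  have i2 : IntegrableOn (fun t => ((t ^ (σ - 1) * robin α lam t * greenPair lam t : ℝ) : ℂ))
    (Ioi 0) := (integrableOn_robin_greenPair hα hlam h0 h1).ofReal
  obtain ⟨i3, v3⟩ := integral_rpow_mul_green_scaled hlam h0 h1 hv
  have j1 := i1.const_mul ((1 / (4 * Real.pi * robin α lam 0) : ℝ) : ℂ)
  have j2 := i2.const_mul (Q / ((4 * Real.pi * robin α lam 0 : ℝ) : ℂ))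
  have j3 := i3.const_mul ((1 / (4 * Real.pi) : ℝ) : ℂ)
  have j23 : IntegrableOn (fun t => Q / ((4 * Real.pi * robin α lam 0 : ℝ) : ℂ) *
        ((t ^ (σ - 1) * robin α lam t * greenPair lam t : ℝ) : ℂ) -
      ((1 / (4 * Real.pi) : ℝ) : ℂ) * (((t ^ (σ - 1) : ℝ) : ℂ) * green lam t (scaled lam σ v)))
      (Ioi 0) := j2.sub j3
  have ec : ∫ t in Ioi (0 : ℝ), chargeDensity α lam σ v Q t =
      (∫ t in Ioi (0 : ℝ), ((t ^ (σ - 1) * robin α lam t : ℝ) : ℂ) *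
        green lam t (scaled lam σ v)) + Q * ∫ t in Ioi (0 : ℝ),
          ((t ^ (σ - 1) * robin α lam t * greenPair lam t : ℝ) : ℂ) := by
    rw [← integral_const_mul, ← integral_add i1 (i2.const_mul Q)]
    congr 1
    ext t
    rw [chargeDensity]
    push_cast
    ring
  constructor
  · refine (j23.add j1).congr ?_
    filter_upwards [ae_restrict_mem measurableSet_Ioi] with t ht
    rw [errDensity_mul_greenPair hα hlam ht]
    rfl
  · rw [setIntegral_congr_fun measurableSet_Ioi
      (fun t ht => errDensity_mul_greenPair (σ := σ) (v := v) (Q := Q) hα hlam ht),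
      integral_add j23 j1, integral_sub j2 j3, integral_const_mul, integral_const_mul,
      integral_const_mul, v3, ec]
    have hb : (robin α lam 0 : ℂ) ≠ 0 := by exact_mod_cast (robin_pos hα hlam le_rfl).ne'
    have hpi : (Real.pi : ℂ) ≠ 0 := by exact_mod_cast Real.pi_ne_zero
    have hsn : ((Real.sin (Real.pi * σ) : ℝ) : ℂ) ≠ 0 := by
      exact_mod_cast (sin_pi_mul_pos h0 h1).ne'
    rw [Complex.ofReal_mul 4, Complex.ofReal_div (Real.pi)]
    generalize ((Real.sin (Real.pi * σ) : ℝ) : ℂ) = S at *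
    push_cast
    field_simp
    ring

theorem prodInt_errDensity (hα : 0 ≤ α) (hlam : 0 < lam) (h0 : 0 < σ) (h1 : σ < 1)
    (hv : MemLp v 2) :
    ProdInt lam (errDensity α lam σ v Q) (fun p => (rk lam 0 p : ℂ)) := by
  refine ProdInt.of_fst hlam (aestronglyMeasurable_errDensity hlam h0 hv)
    (memLp_rk_ofReal hlam le_rfl).1
    (fun t ht => integrable_rk_mul hlam ht.le (memLp_rk_ofReal hlam le_rfl)) ?_
  refine ((integral_errDensity_mul_greenPair (Q := Q) hα hlam h0 h1 hv).1.norm.const_mul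
    (kap * kap)⁻¹).congr ?_
  filter_upwards [ae_restrict_mem measurableSet_Ioi] with t ht
  have ht' : (0 : ℝ) < t := ht
  have hk := kap_pos
  simp only [Complex.norm_real, Real.norm_of_nonneg (rk_pos hlam le_rfl _).le, norm_mul,
    Real.norm_of_nonneg (greenPair_pos hlam ht'.le).le]
  rw [(integral_rk_mul_rk_zero hlam ht').2, greenPair, ← kap_sq]
  field_simp

/-- The charge condition for the preimage. -/
theorem green_zero_add_errFun (hα : 0 ≤ α) (hlam : 0 < lam) (h0 : 0 < σ) (h1 : σ < 1)
    (hv : MemLp v 2) :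
    Integrable (fun p => (rk lam 0 p : ℂ) * errFun α lam σ v Q p) ∧
    ((4 * Real.pi * robin α lam 0 : ℝ) : ℂ) *
      green lam 0 (fun p => v p + errFun α lam σ v Q p) =
      ((4 * Real.sin (Real.pi * σ) : ℝ) : ℂ) *
        ∫ t in Ioi (0 : ℝ), chargeDensity α lam σ v Q t := by
  have H := prodInt_errDensity (Q := Q) hα hlam h0 h1 hv
  -- At this stage E is not known to be square integrable; its integrability against (p² + lam)⁻¹
  -- comes from Fubini, and suffices for pairing with ψ_0.
  have hE : Integrable (fun p => (rk lam 0 p : ℂ) * errFun α lam σ v Q p) := by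
    refine (H.integrable_snd.const_mul ((4 * Real.sin (Real.pi * σ) * kap : ℝ) : ℂ)).congr
      (Filter.Eventually.of_forall fun p => ?_)
    simp only [errFun]
    ring
  refine ⟨hE, ?_⟩
  have hgE : green lam 0 (errFun α lam σ v Q) = ((4 * Real.sin (Real.pi * σ) : ℝ) : ℂ) *
      ∫ t in Ioi (0 : ℝ), errDensity α lam σ v Q t * (greenPair lam t : ℂ) := by
    have e1 : ∀ p, (rk lam 0 p : ℂ) * errFun α lam σ v Q p =
        ((4 * Real.sin (Real.pi * σ) * kap : ℝ) : ℂ) * ((rk lam 0 p : ℂ) *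
          ∫ t in Ioi (0 : ℝ), errDensity α lam σ v Q t * (rk lam t p : ℂ)) := fun p => by
      rw [errFun]; ring
    have e2 : ∫ t in Ioi (0 : ℝ), errDensity α lam σ v Q t * (greenPair lam t : ℂ) =
        (kap : ℂ) * kap * ∫ t in Ioi (0 : ℝ), errDensity α lam σ v Q t *
          ∫ p, (rk lam t p : ℂ) * (rk lam 0 p : ℂ) := by
      rw [← integral_const_mul]
      refine setIntegral_congr_fun measurableSet_Ioi fun t ht => ?_
      simp only [← kap_mul_green_rk_zero hlam ht, green]
      ring
    rw [green]
    simp only [e1, integral_const_mul]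
    rw [e2, H.swap]
    push_cast
    ring
  rw [green_add (integrable_rk_mul hlam le_rfl hv) hE, hgE,
    (integral_errDensity_mul_greenPair hα hlam h0 h1 hv).2]
  have hb : (robin α lam 0 : ℂ) ≠ 0 := by exact_mod_cast (robin_pos hα hlam le_rfl).ne'
  have hpi : (Real.pi : ℂ) ≠ 0 := by exact_mod_cast Real.pi_ne_zero
  rw [Complex.ofReal_mul 4 (Real.sin _)]
  generalize ((Real.sin (Real.pi * σ) : ℝ) : ℂ) = S at *
  push_cast
  field_simp
  ring

/-- `1 / (p² + lam)` is not integrable. -/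
theorem eq_zero_of_integrable_rk_mul_const (hlam : 0 < lam) {c : ℂ}
    (h : Integrable fun p => (rk lam 0 p : ℂ) * c) : c = 0 := by
  by_contra hc
  have h2 := (h.mul_const c⁻¹).norm
  refine not_integrable_symbol (e := 1) hlam (by norm_num) (by norm_num)
    (h2.congr (Filter.Eventually.of_forall fun p => ?_))
  simp only
  rw [mul_assoc, mul_inv_cancel₀ hc, mul_one, Complex.norm_real,
    Real.norm_of_nonneg (rk_pos hlam le_rfl p).le, rk_zero_eq]

/-- Characterization of the preimages in terms of the operator `N`. -/
theorem resFun_eq_powFun_iff (hα : 0 ≤ α) (hlam : 0 < lam) (h0 : 0 < σ) (h1 : σ < 1)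
    (hv : MemLp v 2) {g h : R3 → ℂ} (hg : MemLp g 2)
    (hh : h =ᵐ[volume] fun p => scaled lam σ v p + Q * kap * (rk lam 0 p : ℂ)) :
    resFun α lam 0 g =ᵐ[volume] powFun α lam (1 - σ) h ↔
      g =ᵐ[volume] fun p => v p + errFun α lam σ v Q p := by
  have hp := powFun_one_sub hα hlam h0 h1 hv hh
  obtain ⟨hE, hq⟩ := green_zero_add_errFun (Q := Q) hα hlam h0 h1 hv
  have hr : ∀ p, (rk lam 0 p : ℂ) ≠ 0 := fun p => by exact_mod_cast (rk_pos hlam le_rfl p).ne'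
  have hres : ∀ p, resFun α lam 0 g p = (rk lam 0 p : ℂ) * (g p +
      ((4 * Real.pi * robin α lam 0 * kap : ℝ) : ℂ) * green lam 0 g) := fun p => by
    rw [resFun]; ring
  constructor
  · intro H
    set c : ℂ := ((4 * Real.sin (Real.pi * σ) * kap : ℝ) : ℂ) *
        (∫ t in Ioi (0 : ℝ), chargeDensity α lam σ v Q t) -
      ((4 * Real.pi * robin α lam 0 * kap : ℝ) : ℂ) * green lam 0 g with hcdef
    have hgc : g =ᵐ[volume] fun p => v p + errFun α lam σ v Q p + c := by
      filter_upwards [H, hp] with p h2 h3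
      rw [h3, hres] at h2
      have := mul_left_cancel₀ (hr p) h2
      rw [hcdef]
      linear_combination this
    -- After multiplication by (p² + lam)⁻¹ all terms except the constant are integrable over ℝ³,
    -- whereas (p² + lam)⁻¹ itself is not.
    have hc : c = 0 := by
      refine eq_zero_of_integrable_rk_mul_const hlam (((integrable_rk_mul hlam le_rfl hg).sub
        ((integrable_rk_mul hlam le_rfl hv).add hE)).congr ?_)
      filter_upwards [hgc] with p h2
      simp only [Pi.sub_apply, Pi.add_apply]
      rw [h2]
      ring
    simpa only [hc, add_zero] using hgc
  · intro H
    have hgr := green_congr (lam := lam) (t := 0) H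
    filter_upwards [H, hp] with p h2 h3
    rw [h3, hres, h2, hgr]
    congr 2
    rw [Complex.ofReal_mul _ kap, Complex.ofReal_mul _ kap, mul_right_comm, hq]
    ring

end

/-! ### Passage between the pair (R_s, Q_s) and the powers of N -/

section

variable {α lam σ t : ℝ} {v : R3 → ℂ} {Q : ℂ}

/-- N^{1-σ} N^σ = N, and N is injective. -/
theorem fracPow_resOp_injective (hα : 0 ≤ α) (hlam : 0 < lam) (h0 : 0 < σ) (h1 : σ < 1) {g h : L2}
    (H : fracPow (resOp α lam 0) σ g = fracPow (resOp α lam 0) σ h) : g = h := by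
  have e := fracPow_fracPow (resOp_zero_nonneg hα hlam) h0 h1
  have h2 : resOp α lam 0 (g - h) = 0 := by
    rw [map_sub, ← e, ← e, H, sub_self]
  exact sub_eq_zero.1 (resOp_zero_injective hα hlam h2)

/-- Preimages of `(v, Q)` under `(R_s, Q_s)`, on the Fourier side. -/
theorem preimage_iff (hα : 0 ≤ α) (hlam : 0 < lam) (h0 : 1 / 4 < σ) (h1 : σ < 1)
    (hv : MemLp v 2) {g : R3 → ℂ} (hg : MemLp g 2) :
    ((fun p => g p - corrFun α lam σ g p) =ᵐ[volume] v ∧ chargeFun α lam σ g = Q) ↔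
      g =ᵐ[volume] fun p => v p + errFun α lam σ v Q p := by
  have h0' : 0 < σ := by linarith
  let G : L2 := hg.toLp g
  have hG : G =ᵐ[volume] g := hg.coeFn_toLp
  set N := resOp α lam 0
  have hH0 : fracPow N σ G =ᵐ[volume] fun p => scaled lam σ
      (fun p => g p - corrFun α lam σ g p) p + chargeFun α lam σ g * kap * (rk lam 0 p : ℂ) := by
    filter_upwards [fracPow_resOp_ae hα hlam h0' h1 G, powFun_congr (α := α) (lam := lam) (σ := σ)
      hG] with p h2 h3
    rw [h2, h3, powFun_eq hα hlam h0 h1 hg, scaled]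
  have hN1 : fracPow N (1 - σ) (fracPow N σ G) = N G :=
    fracPow_fracPow (resOp_zero_nonneg hα hlam) h0' h1 G
  have hN2 : N G =ᵐ[volume] resFun α lam 0 g := by
    filter_upwards [resOp_ae (α := α) hlam le_rfl G, hG] with p h2 h3
    rw [h2, resFun, resFun, h3, green_congr hG]
  have hr : ∀ p, (rk lam 0 p : ℂ) ≠ 0 := fun p => by exact_mod_cast (rk_pos hlam le_rfl p).ne'
  constructor
  · rintro ⟨hR, hQ⟩
    have hH : fracPow N σ G =ᵐ[volume] fun p => scaled lam σ v p + Q * kap * (rk lam 0 p : ℂ) := by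
      filter_upwards [hH0, hR] with p h2 h3
      rw [h2, hQ, scaled, h3, scaled]
    refine (resFun_eq_powFun_iff hα hlam h0' h1 hv hg hH).1 ?_
    refine hN2.symm.trans ?_
    rw [← hN1]
    exact fracPow_resOp_ae hα hlam (by linarith) (by linarith) _
  · intro H
    have hm : MemLp (fun p => scaled lam σ v p + Q * kap * (rk lam 0 p : ℂ)) 2 :=
      (memLp_scaled hlam h0'.le hv).add ((memLp_rk_ofReal hlam le_rfl).const_mul _)
    -- Here N g = N^{1-σ} h, and cancelling N^{1-σ} gives N^σ g = h. It remains to read off both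
    -- components of `h`.
    have h2 := (resFun_eq_powFun_iff hα hlam h0' h1 hv hg hm.coeFn_toLp).2 H
    have h3 : fracPow N (1 - σ) (fracPow N σ G) = fracPow N (1 - σ) (hm.toLp _) := by
      rw [hN1]
      refine Lp.ext (hN2.trans (h2.trans ?_))
      exact (fracPow_resOp_ae hα hlam (by linarith) (by linarith) _).symm
    have h4 := fracPow_resOp_injective hα hlam (by linarith) (by linarith) h3
    have h5 : (fun p => scaled lam σ (fun p => g p - corrFun α lam σ g p) p +
        chargeFun α lam σ g * kap * (rk lam 0 p : ℂ)) =ᵐ[volume]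
        fun p => scaled lam σ v p + Q * kap * (rk lam 0 p : ℂ) := by
      rw [h4] at hH0
      exact hH0.symm.trans hm.coeFn_toLp
    have hK := memLp_corrFun hα hlam h0 h1 hg
    have h6 : ∀ p, scaled lam σ (fun p => g p - corrFun α lam σ g p) p +
        chargeFun α lam σ g * kap * (rk lam 0 p : ℂ) = scaled lam σ v p +
          Q * kap * (rk lam 0 p : ℂ) → v p - (g p - corrFun α lam σ g p) =
          (chargeFun α lam σ g - Q) * kap * (((‖p‖ ^ 2 + lam) ^ (σ - 1) : ℝ) : ℂ) := fun p hp => by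
      have hX : 0 < ‖p‖ ^ 2 + lam := by positivity
      have e : (rk lam 0 p : ℂ) = (((‖p‖ ^ 2 + lam) ^ (-σ) : ℝ) : ℂ) *
          (((‖p‖ ^ 2 + lam) ^ (σ - 1) : ℝ) : ℂ) := by
        rw [← Complex.ofReal_mul, ← Real.rpow_add hX, rk_zero_eq]
        congr 2
        ring
      have hne : (((‖p‖ ^ 2 + lam) ^ (-σ) : ℝ) : ℂ) ≠ 0 := by
        exact_mod_cast (Real.rpow_pos_of_pos hX _).ne'
      rw [scaled, scaled, e] at hp
      refine mul_left_cancel₀ hne ?_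
      linear_combination -hp
    -- Two decompositions of the same function with different charges would put (p² + lam)^{σ-1}
    -- into L², which fails because 2(1 - σ) ≤ 3/2 for σ ≥ 1/4.
    have hQ : chargeFun α lam σ g = Q := by
      by_contra hne
      have hk : (kap : ℂ) ≠ 0 := by exact_mod_cast kap_pos.ne'
      have hc : (chargeFun α lam σ g - Q) * kap ≠ 0 := mul_ne_zero (sub_ne_zero.2 hne) hk
      have hm2 : MemLp (fun p : R3 => (‖p‖ ^ 2 + lam) ^ (σ - 1)) 2 := by
        refine ((hv.sub (hg.sub hK)).const_mul ((chargeFun α lam σ g - Q) * kap)⁻¹).norm.ae_eq ?_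
        filter_upwards [h5] with p hp
        have := h6 p hp
        simp only [Pi.sub_apply] at this ⊢
        rw [this, inv_mul_cancel_left₀ hc, Complex.norm_real, Real.norm_of_nonneg (by positivity)]
      rw [memLp_two_iff_integrable_sq hm2.1] at hm2
      refine not_integrable_symbol (e := 2 * (1 - σ)) hlam (by linarith) (by linarith)
        (hm2.congr (Filter.Eventually.of_forall fun p => ?_))
      simp only
      rw [← Real.rpow_two ((_ : ℝ) ^ (σ - 1)), ← Real.rpow_mul (by positivity)]
      congr 1
      ring
    refine ⟨?_, hQ⟩
    filter_upwards [h5] with p hp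
    have := h6 p hp
    rw [hQ, sub_self, zero_mul, zero_mul] at this
    exact (sub_eq_zero.1 this).symm

/-! ### Square-integrability of the correction -/

/-- `∫ t^{τ-1} / ((4πα + √(lam + t)) (p² + lam + t)) dt`. -/
def robinInt (α lam τ : ℝ) (p : R3) : ℝ :=
  ∫ t in Ioi (0 : ℝ), t ^ (τ - 1) * robin α lam t * rk lam t p

theorem measurable_rk_left (lam : ℝ) (p : R3) : Measurable fun t => rk lam t p := by
  unfold rk
  fun_prop

theorem integrableOn_robinInt {τ : ℝ} (hα : 0 ≤ α) (hlam : 0 < lam) (h0 : 0 < τ) (h1 : τ < 1)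
    (p : R3) : IntegrableOn (fun t => t ^ (τ - 1) * robin α lam t * rk lam t p) (Ioi 0) := by
  have hm := measurable_robin α lam
  have hrk := measurable_rk_left lam p
  have hmeas : Measurable fun t => t ^ (τ - 1) * robin α lam t * rk lam t p :=
    ((measurable_id.pow_const _).mul hm).mul hrk
  refine ((integrableOn_rpow_mul_rk hlam h0 h1 p).const_mul (robin α lam 0)).mono'
    hmeas.aestronglyMeasurable ?_
  filter_upwards [ae_restrict_mem measurableSet_Ioi] with t ht
  have ht' : (0 : ℝ) < t := ht
  have hr := robin_pos hα hlam ht'.le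
  have hk := rk_pos hlam ht'.le p
  have hp := Real.rpow_pos_of_pos ht' (τ - 1)
  rw [Real.norm_of_nonneg (mul_pos (mul_pos hp hr) hk).le]
  calc t ^ (τ - 1) * robin α lam t * rk lam t p
      ≤ t ^ (τ - 1) * robin α lam 0 * rk lam t p :=
        mul_le_mul_of_nonneg_right (mul_le_mul_of_nonneg_left (robin_le hα hlam ht'.le) hp.le)
          hk.le
    _ = robin α lam 0 * (t ^ (τ - 1) * rk lam t p) := by ring

theorem robinInt_pos {τ : ℝ} (hα : 0 ≤ α) (hlam : 0 < lam) (h0 : 0 < τ) (h1 : τ < 1) (p : R3) :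
    0 < robinInt α lam τ p := by
  have hpos : ∀ t ∈ Ioi (0 : ℝ), 0 < t ^ (τ - 1) * robin α lam t * rk lam t p := fun t ht => by
    have ht' : (0 : ℝ) < t := ht
    have hr := robin_pos hα hlam ht'.le
    have hk := rk_pos hlam ht'.le p
    positivity
  rw [robinInt, setIntegral_pos_iff_support_of_nonneg_ae
    ((ae_restrict_mem measurableSet_Ioi).mono fun t ht => (hpos t ht).le)
    (integrableOn_robinInt hα hlam h0 h1 p)]
  refine lt_of_lt_of_le (b := volume (Ioi (0 : ℝ))) (by simp) (measure_mono fun t ht => ?_)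
  exact ⟨(hpos t ht).ne', ht⟩

theorem memLp_robinInt {τ : ℝ} (hα : 0 ≤ α) (hlam : 0 < lam) (h0 : 0 < τ) (h1 : τ < 3 / 4) :
    MemLp (robinInt α lam τ) 2 := by
  have hm := measurable_robin α lam
  have hpi := Real.pi_pos
  have hmeas : AEStronglyMeasurable (robinInt α lam τ) volume := by
    have : AEStronglyMeasurable (fun z : R3 × ℝ => z.2 ^ (τ - 1) * robin α lam z.2 *
        rk lam z.2 z.1) (volume.prod vol0) := by
      have := (measurable_rk lam).comp (measurable_swap (α := R3) (β := ℝ))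
      exact ((Measurable.aestronglyMeasurable (by fun_prop)).mul this.aestronglyMeasurable)
    exact this.integral_prod_right'
  have hτ : 0 < τ / 3 := by positivity
  have hs := sin_pi_mul_pos hτ (by linarith)
  refine ((memLp_symbol (e := 1 - τ / 3) hlam (by linarith)).const_mul
    (lam ^ (2 * τ / 3 - 1 / 2) * (Real.pi / Real.sin (Real.pi * (τ / 3))))).mono hmeas
    (Filter.Eventually.of_forall fun p => ?_)
  have hX : 0 < ‖p‖ ^ 2 + lam := by positivity
  have hpos := robinInt_pos hα hlam h0 (by linarith) p
  rw [Real.norm_of_nonneg hpos.le, Real.norm_of_nonneg (by positivity), mul_assoc,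
    show -(1 - τ / 3) = τ / 3 - 1 by ring, ← integral_rpow_div_add hτ (by linarith) hX,
    ← integral_const_mul, robinInt]
  refine setIntegral_mono_on (integrableOn_robinInt hα hlam h0 (by linarith) p)
    ((integrableOn_rpow_div_add hτ (by linarith) hX).const_mul _) measurableSet_Ioi fun t ht => ?_
  have ht' : (0 : ℝ) < t := ht
  have hlt : 0 < lam + t := by positivity
  -- The decay (lam + t)^{-1/2} is traded for t^{-2τ/3}, possible as 2τ/3 < 1/2. The t-integral then
  -- has exponent τ/3 > 0 and yields (p² + lam)^{τ/3 - 1}, which lies in L² as τ/3 < 1/4.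
  have hb : robin α lam t ≤ lam ^ (2 * τ / 3 - 1 / 2) * t ^ (-(2 * τ / 3)) := by
    refine (robin_le_rpow hα hlam ht'.le).trans ?_
    rw [show (-(1 / 2) : ℝ) = (2 * τ / 3 - 1 / 2) + -(2 * τ / 3) by ring, Real.rpow_add hlt]
    gcongr ?_ * ?_
    · exact Real.rpow_le_rpow_of_nonpos hlam (by linarith) (by linarith)
    · exact Real.rpow_le_rpow_of_nonpos ht' (by linarith) (by linarith)
  have hk := rk_pos hlam ht'.le p
  calc _ ≤ t ^ (τ - 1) * (lam ^ (2 * τ / 3 - 1 / 2) * t ^ (-(2 * τ / 3))) * rk lam t p := by gcongr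
    _ = lam ^ (2 * τ / 3 - 1 / 2) * (t ^ (τ - 1) * t ^ (-(2 * τ / 3)) * rk lam t p) := by ring
    _ = _ := by
        rw [← Real.rpow_add ht', rk, ← div_eq_mul_inv]
        congr 3
        ring

theorem scaled_zero : scaled lam σ (fun _ => 0) = fun _ => 0 := by
  ext p; simp [scaled]

theorem errFun_zero_left (p : R3) : errFun α lam σ (fun _ => 0) Q p =
    ((4 * Real.sin (Real.pi * σ) * kap : ℝ) : ℂ) * (Q / ((4 * Real.pi * robin α lam 0 : ℝ) : ℂ)) *
      (robinInt α lam σ p : ℂ) := by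
  rw [errFun, robinInt, ← integral_complex_ofReal,
    mul_assoc ((4 * Real.sin (Real.pi * σ) * kap : ℝ) : ℂ), ← integral_const_mul (Q / _)]
  refine congrArg (fun z : ℂ => ((4 * Real.sin (Real.pi * σ) * kap : ℝ) : ℂ) * z)
    (integral_congr_ae (Filter.Eventually.of_forall fun t => ?_))
  simp only [errDensity, scaled_zero, green, mul_zero, integral_zero, sub_zero]
  push_cast
  ring

theorem errFun_add (hα : 0 ≤ α) (hlam : 0 < lam) (h0 : 0 < σ) (h1 : σ < 1) (hv : MemLp v 2)
    (p : R3) : errFun α lam σ v Q p =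
      errFun α lam σ v 0 p + errFun α lam σ (fun _ => 0) Q p := by
  have i1 := (integrableOn_errDensity_mul_rk (α := α) (Q := 0) hα hlam h0 h1 hv p).2
  have i2 := (integrableOn_errDensity_mul_rk (α := α) (Q := Q) hα hlam h0 h1
    (MemLp.zero' : MemLp (fun _ : R3 => (0 : ℂ)) 2 volume) p).2
  rw [errFun, errFun, errFun, ← mul_add, ← integral_add i1 i2]
  refine congrArg (_ * ·) (integral_congr_ae (Filter.Eventually.of_forall fun t => ?_))
  simp only [errDensity, scaled_zero, green, mul_zero, integral_zero, sub_zero, zero_div]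
  ring

/-- E is additive in (v, Q). The part from `v` is a composition of Schur kernels with b₁ = 0 and b₂
= -σ, admissible because σ < 3/4; the part from Q is a multiple of `robinInt`. -/
theorem memLp_errFun_of_lt (hα : 0 ≤ α) (hlam : 0 < lam) (h0 : 1 / 4 < σ) (h1 : σ < 3 / 4)
    (hv : MemLp v 2) : MemLp (errFun α lam σ v Q) 2 := by
  have e : errFun α lam σ v Q = fun p => errFun α lam σ v 0 p +
      errFun α lam σ (fun _ => 0) Q p := by
    ext p
    exact errFun_add hα hlam (by linarith) (by linarith) hv p
  rw [e]
  refine MemLp.add ?_ ?_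
  · have h := (memLp_schur_robin (b₁ := 0) (b₂ := -σ) (e := σ) hα hlam (by norm_num) (by norm_num)
      (by linarith) (by linarith) (by ring) hv).const_mul
      (-((4 * Real.sin (Real.pi * σ) * kap : ℝ) : ℂ))
    convert h using 1
    ext p
    rw [errFun, Real.rpow_zero, Complex.ofReal_one, one_mul, neg_mul, ← mul_neg, ← integral_neg]
    congr 1
    refine setIntegral_congr_fun measurableSet_Ioi fun t ht => ?_
    have ht' : (0 : ℝ) < t := ht
    simp only [errDensity, zero_div, zero_sub, Real.rpow_sub_one ht'.ne']
    have : (t : ℂ) ≠ 0 := by exact_mod_cast ht'.ne'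
    unfold scaled
    push_cast
    field_simp
  · refine MemLp.ae_eq (Filter.Eventually.of_forall fun p => (errFun_zero_left p).symm) ?_
    exact ((memLp_robinInt hα hlam (by linarith) h1).ofReal (K := ℂ)).const_mul _

/-- For this charge the constant in the density is the limit that t ⟨ψ_t, X^{-σ} v⟩ would approach,
with X = p² + lam. The difference is ⟨ψ_t, X^{1-σ} v⟩, which the Schur test handles with b₂ = 1 - σ
< 1/4. The charge is finite because X^{-σ} is in L² for σ > 3/4. -/
theorem memLp_errFun_of_gt (hα : 0 ≤ α) (hlam : 0 < lam) (h0 : 3 / 4 < σ) (h1 : σ < 1)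
    (hv : MemLp v 2) :
    MemLp (errFun α lam σ v (((4 * Real.pi * robin α lam 0 : ℝ) : ℂ) *
      (kap * ∫ p, scaled lam σ v p))) 2 := by
  have h := (memLp_schur_robin (b₁ := 0) (b₂ := 1 - σ) (e := σ - 1) hα hlam (by norm_num)
    (by norm_num) (by linarith) (by linarith) (by ring) hv).const_mul
    ((4 * Real.sin (Real.pi * σ) * kap : ℝ) : ℂ)
  convert h using 1
  ext p
  rw [errFun, Real.rpow_zero, Complex.ofReal_one, one_mul]
  congr 1
  have hb : ((4 * Real.pi * robin α lam 0 : ℝ) : ℂ) ≠ 0 := by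
    have := robin_pos hα hlam le_rfl
    have := Real.pi_pos
    exact_mod_cast (by positivity : (4 * Real.pi * robin α lam 0 : ℝ) ≠ 0)
  have hsym : MemLp (fun p : R3 => (((‖p‖ ^ 2 + lam) ^ (-σ) : ℝ) : ℂ)) 2 :=
    (memLp_symbol hlam h0).ofReal
  have hi : Integrable (scaled lam σ v) := hsym.integrable_mul hv
  refine setIntegral_congr_fun measurableSet_Ioi fun t ht => ?_
  have ht' : (0 : ℝ) < t := ht
  have hg : (kap * ∫ p, scaled lam σ v p) - t * green lam t (scaled lam σ v) =
      green lam t (fun q => (((‖q‖ ^ 2 + lam) ^ (1 - σ) : ℝ) : ℂ) * v q) := by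
    rw [green, green, mul_left_comm, ← mul_sub, ← integral_const_mul, ← integral_sub hi
      ((integrable_rk_mul hlam ht'.le (memLp_scaled hlam (by linarith) hv)).const_mul _)]
    congr 2
    ext q
    have hX : 0 < ‖q‖ ^ 2 + lam := by positivity
    have e1 : (‖q‖ ^ 2 + lam) ^ (1 - σ) = (‖q‖ ^ 2 + lam) * (‖q‖ ^ 2 + lam) ^ (-σ) := by
      rw [sub_eq_add_neg, Real.rpow_add hX, Real.rpow_one]
    have e2 : 1 - t * rk lam t q = rk lam t q * (‖q‖ ^ 2 + lam) := by
      rw [rk]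
      field_simp
      ring
    have e3 : (1 : ℂ) - t * rk lam t q = rk lam t q * ((‖q‖ ^ 2 + lam : ℝ) : ℂ) := by
      exact_mod_cast e2
    rw [e1, scaled]
    push_cast at e3 ⊢
    linear_combination ((((‖q‖ ^ 2 + lam) ^ (-σ) : ℝ) : ℂ) * v q) * e3
  simp only [errDensity]
  rw [mul_div_cancel_left₀ _ hb, hg]

end

/-! ### Failure of square-integrability -/

section

variable {α lam σ : ℝ}

/-- The power -3/4 of p² + lam just fails to be square integrable at infinity. On the region p² +
lam ≤ T it is dominated by T^{1/4} (p² + lam)⁻¹, so a lower bound at large p is enough. -/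
theorem not_memLp_of_le_norm (hlam : 0 < lam) {f : R3 → ℝ} {c T : ℝ} (hc : 0 < c) (hT : 0 < T)
    (h : ∀ p, T ≤ ‖p‖ ^ 2 + lam → c * (‖p‖ ^ 2 + lam) ^ (-(3 / 4) : ℝ) ≤ ‖f p‖) :
    ¬ MemLp f 2 := by
  intro hf
  have hm : MemLp (fun p : R3 => (‖p‖ ^ 2 + lam) ^ (-(3 / 4) : ℝ)) 2 := by
    refine ((hf.norm.const_mul c⁻¹).add ((memLp_rk hlam le_rfl).const_mul (T ^ (1 / 4 : ℝ)))).mono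
      (continuous_symbol hlam _).aestronglyMeasurable (Filter.Eventually.of_forall fun p => ?_)
    have hX : 0 < ‖p‖ ^ 2 + lam := by positivity
    have hk := rk_pos hlam le_rfl p
    simp only [Pi.add_apply]
    rw [Real.norm_of_nonneg (by positivity), Real.norm_of_nonneg (by positivity)]
    rcases le_total T (‖p‖ ^ 2 + lam) with hp | hp
    · have : (‖p‖ ^ 2 + lam) ^ (-(3 / 4) : ℝ) ≤ c⁻¹ * ‖f p‖ := by
        rw [le_inv_mul_iff₀ hc]
        exact h p hp
      have h2 : 0 ≤ T ^ (1 / 4 : ℝ) * rk lam 0 p := by positivity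
      linarith
    · have e : (‖p‖ ^ 2 + lam) ^ (-(3 / 4) : ℝ) = (‖p‖ ^ 2 + lam) ^ (1 / 4 : ℝ) * rk lam 0 p := by
        rw [rk_zero_eq, ← Real.rpow_add hX]
        norm_num
      have h2 : (‖p‖ ^ 2 + lam) ^ (1 / 4 : ℝ) * rk lam 0 p ≤ T ^ (1 / 4 : ℝ) * rk lam 0 p := by
        gcongr
      have h3 : 0 ≤ c⁻¹ * ‖f p‖ := by positivity
      linarith
  rw [memLp_two_iff_integrable_sq hm.1] at hm
  refine not_integrable_symbol (e := 3 / 2) hlam (by norm_num) le_rfl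
    (hm.congr (Filter.Eventually.of_forall fun p => ?_))
  simp only
  rw [← Real.rpow_two ((_ : ℝ) ^ (-(3 / 4) : ℝ)), ← Real.rpow_mul (by positivity)]
  norm_num

/-- Large t gives a contribution of order at least (p² + lam)^{-3/4}, while t ≤ T contributes only
O((p² + lam)⁻¹), which is square integrable and cannot cancel it. -/
theorem not_memLp_of_density (hlam : 0 < lam) {D : ℝ → ℝ}
    (hD : ∀ p, IntegrableOn (fun t => D t * rk lam t p) (Ioi 0)) {c T : ℝ} (hc : 0 < c)
    (hT : 0 < T) (hlow : ∀ t, T ≤ t → c * t ^ (-(3 / 4) : ℝ) ≤ D t) :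
    ¬ MemLp (fun p => ∫ t in Ioi (0 : ℝ), D t * rk lam t p) 2 := by
  intro hf
  -- No sign or bound on D is assumed below T. There the kernel at p is compared with the kernel at
  -- 0, which costs the factor (lam + T)/(p² + lam).
  set M : ℝ := (lam + T) * ∫ t in Ioi (0 : ℝ), ‖D t * rk lam t 0‖ with hM
  have hM0 : 0 ≤ M := by
    have : 0 ≤ ∫ t in Ioi (0 : ℝ), ‖D t * rk lam t 0‖ := integral_nonneg fun _ => norm_nonneg _
    positivity
  refine not_memLp_of_le_norm hlam (f := fun p => ‖∫ t in Ioi (0 : ℝ), D t * rk lam t p‖ +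
    M * rk lam 0 p) (c := c * 2 ^ (-(3 / 4) : ℝ) / 3) (T := T) (by positivity) hT (fun p hp => ?_)
    (hf.norm.add ((memLp_rk hlam le_rfl).const_mul M))
  set X := ‖p‖ ^ 2 + lam with hXdef
  have hX : 0 < X := by positivity
  have hk0 := rk_pos hlam le_rfl p
  have hsplit : ∫ t in Ioi (0 : ℝ), D t * rk lam t p =
      (∫ t in Ioc 0 T, D t * rk lam t p) + ∫ t in Ioi T, D t * rk lam t p := by
    rw [← setIntegral_union (Ioc_disjoint_Ioi le_rfl) measurableSet_Ioi
      ((hD p).mono_set Ioc_subset_Ioi_self) ((hD p).mono_set (Ioi_subset_Ioi hT.le)),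
      Ioc_union_Ioi_eq_Ioi hT.le]
  have hsmall : ‖∫ t in Ioc 0 T, D t * rk lam t p‖ ≤ M * rk lam 0 p := by
    have i0 := ((hD 0).norm.const_mul ((lam + T) * rk lam 0 p))
    calc _ ≤ ∫ t in Ioc 0 T, ‖D t * rk lam t p‖ := norm_integral_le_integral_norm _
      _ ≤ ∫ t in Ioc 0 T, (lam + T) * rk lam 0 p * ‖D t * rk lam t 0‖ := by
          refine setIntegral_mono_on ((hD p).mono_set Ioc_subset_Ioi_self).norm
            (IntegrableOn.mono_set i0 Ioc_subset_Ioi_self) measurableSet_Ioc fun t ht => ?_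
          have ht0 := ht.1
          have h1 := rk_pos hlam ht0.le p
          have h2 := rk_pos hlam ht0.le 0
          have h3 : rk lam t p ≤ rk lam 0 p := rk_le_zero hlam ht0.le p
          have h4 : 1 ≤ (lam + T) * rk lam t 0 := by
            rw [rk, norm_zero, ← div_eq_mul_inv, one_le_div (by positivity)]
            linarith [ht.2]
          rw [norm_mul, norm_mul, Real.norm_of_nonneg h1.le, Real.norm_of_nonneg h2.le]
          calc ‖D t‖ * rk lam t p ≤ ‖D t‖ * (rk lam 0 p * ((lam + T) * rk lam t 0)) := by
                refine mul_le_mul_of_nonneg_left ?_ (norm_nonneg _)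
                nlinarith
            _ = _ := by ring
      _ ≤ ∫ t in Ioi (0 : ℝ), (lam + T) * rk lam 0 p * ‖D t * rk lam t 0‖ := by
          refine setIntegral_mono_set i0 (Filter.Eventually.of_forall fun t => ?_)
            Ioc_subset_Ioi_self.eventuallyLE
          simp only [Pi.zero_apply]
          positivity
      _ = M * rk lam 0 p := by rw [integral_const_mul, hM]; ring
  have hlarge : c * 2 ^ (-(3 / 4) : ℝ) / 3 * X ^ (-(3 / 4) : ℝ) ≤
      ∫ t in Ioi T, D t * rk lam t p := by
    -- On X < t ≤ 2X the density is at least c (2X)^{-3/4} and the kernel at least 1/(3X); the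
    -- interval has length X.
    have hsub : Ioc X (2 * X) ⊆ Ioi T := fun t ht => lt_of_le_of_lt hp ht.1
    have hpos : ∀ t ∈ Ioi T, 0 ≤ D t * rk lam t p := fun t ht => by
      have ht' : T < t := ht
      have ht0 : 0 < t := hT.trans ht'
      refine mul_nonneg (le_trans ?_ (hlow t ht'.le)) (rk_pos hlam ht0.le p).le
      positivity
    calc _ = ∫ _ in Ioc X (2 * X), c * (2 * X) ^ (-(3 / 4) : ℝ) * (3 * X)⁻¹ := by
          rw [setIntegral_const, Measure.real, Real.volume_Ioc,
            ENNReal.toReal_ofReal (by linarith), smul_eq_mul, Real.mul_rpow (by norm_num) hX.le]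
          field_simp
          ring
      _ ≤ ∫ t in Ioc X (2 * X), D t * rk lam t p := by
          refine setIntegral_mono_on (integrableOn_const (by simp))
            ((hD p).mono_set (hsub.trans (Ioi_subset_Ioi hT.le))) measurableSet_Ioc fun t ht => ?_
          have ht0 : 0 < t := hX.trans ht.1
          refine mul_le_mul (le_trans ?_ (hlow t (hp.trans ht.1.le))) ?_ (by positivity) ?_
          · exact mul_le_mul_of_nonneg_left
              (Real.rpow_le_rpow_of_nonpos ht0 ht.2 (by norm_num)) hc.le
          · rw [rk]
            refine inv_anti₀ (by positivity) ?_
            rw [← hXdef]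
            linarith [ht.2]
          · exact le_trans (by positivity) (hlow t (hp.trans ht.1.le))
      _ ≤ _ := setIntegral_mono_set ((hD p).mono_set (Ioi_subset_Ioi hT.le))
          ((ae_restrict_mem measurableSet_Ioi).mono hpos) hsub.eventuallyLE
  have h1 : 0 ≤ M * rk lam 0 p := by positivity
  rw [Real.norm_of_nonneg (by positivity), hsplit]
  have h2 := norm_sub_norm_le (∫ t in Ioi T, D t * rk lam t p)
    (-∫ t in Ioc 0 T, D t * rk lam t p)
  rw [norm_neg, sub_neg_eq_add, add_comm (∫ t in Ioi T, D t * rk lam t p)] at h2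
  have h3 := le_abs_self (∫ t in Ioi T, D t * rk lam t p)
  rw [← Real.norm_eq_abs] at h3
  linarith

theorem exists_le_rpow_mul_robin (hα : 0 ≤ α) (hlam : 0 < lam) (h0 : 3 / 4 ≤ σ) :
    ∃ c, 0 < c ∧ ∀ t, 1 ≤ t → c * t ^ (-(3 / 4) : ℝ) ≤ t ^ (σ - 1) * robin α lam t := by
  have hpi := Real.pi_pos
  refine ⟨(4 * Real.pi * α + √lam + 1)⁻¹, by positivity, fun t ht => ?_⟩
  have ht0 : 0 < t := by linarith
  have hr : (4 * Real.pi * α + √lam + 1)⁻¹ * t ^ (-(1 / 2) : ℝ) ≤ robin α lam t := by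
    have h1 : √(lam + t) ≤ √lam + √t := by
      rw [Real.sqrt_le_left (by positivity)]
      nlinarith [Real.sq_sqrt hlam.le, Real.sq_sqrt ht0.le, Real.sqrt_nonneg lam,
        Real.sqrt_nonneg t, mul_nonneg (Real.sqrt_nonneg lam) (Real.sqrt_nonneg t)]
    have h2 : 1 ≤ √t := Real.one_le_sqrt.2 ht
    have h3 : 0 ≤ 4 * Real.pi * α + √lam := by positivity
    rw [robin, Real.rpow_neg ht0.le, ← Real.sqrt_eq_rpow, ← mul_inv, one_div]
    refine inv_anti₀ (robin_denom_pos hα hlam ht0.le) ?_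
    nlinarith
  have hp : t ^ (-(1 / 4) : ℝ) ≤ t ^ (σ - 1) := Real.rpow_le_rpow_of_exponent_le ht (by linarith)
  calc _ = t ^ (-(1 / 4) : ℝ) * ((4 * Real.pi * α + √lam + 1)⁻¹ * t ^ (-(1 / 2) : ℝ)) := by
        rw [mul_left_comm, ← Real.rpow_add ht0]
        norm_num
    _ ≤ _ := mul_le_mul hp hr (by positivity) (by positivity)

theorem not_memLp_robinInt (hα : 0 ≤ α) (hlam : 0 < lam) (h0 : 3 / 4 ≤ σ) (h1 : σ < 1) :
    ¬ MemLp (robinInt α lam σ) 2 := by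
  obtain ⟨c, hc, h⟩ := exists_le_rpow_mul_robin hα hlam h0
  exact not_memLp_of_density hlam (fun p => integrableOn_robinInt hα hlam (by linarith) h1 p) hc
    one_pos h

theorem eq_zero_of_memLp_errFun_zero (hα : 0 ≤ α) (hlam : 0 < lam) (h0 : 3 / 4 ≤ σ) (h1 : σ < 1)
    {Q : ℂ} (h : MemLp (errFun α lam σ (fun _ => 0) Q) 2) : Q = 0 := by
  by_contra hQ
  have hb := robin_pos hα hlam le_rfl
  have hs := sin_pi_mul_pos (by linarith) h1
  have hk := kap_pos
  have hpi := Real.pi_pos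
  set c : ℂ := ((4 * Real.sin (Real.pi * σ) * kap : ℝ) : ℂ) *
    (Q / ((4 * Real.pi * robin α lam 0 : ℝ) : ℂ)) with hcdef
  have hc : c ≠ 0 := by
    refine mul_ne_zero ?_ (div_ne_zero hQ ?_)
    · exact_mod_cast (by positivity : 4 * Real.sin (Real.pi * σ) * kap ≠ 0)
    · exact_mod_cast (by positivity : 4 * Real.pi * robin α lam 0 ≠ 0)
  refine not_memLp_robinInt hα hlam h0 h1 ((h.const_mul c⁻¹).re.ae_eq
    (Filter.Eventually.of_forall fun p => ?_))
  simp only [errFun_zero_left]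
  rw [← hcdef, inv_mul_cancel_left₀ hc]
  exact Complex.ofReal_re _

/-! ### A target that is not attained at the critical exponent -/

/-- `(p² + lam)^{-3/4} / (1 + log ((p² + lam) / lam))`. -/
def critFun (lam : ℝ) (p : R3) : ℝ :=
  (‖p‖ ^ 2 + lam) ^ (-(3 / 4) : ℝ) / (1 + Real.log ((‖p‖ ^ 2 + lam) / lam))

theorem one_le_one_add_log (hlam : 0 < lam) (r : ℝ) :
    1 ≤ 1 + Real.log ((r ^ 2 + lam) / lam) := by
  have : 0 ≤ Real.log ((r ^ 2 + lam) / lam) := by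
    refine Real.log_nonneg ?_
    rw [one_le_div hlam]
    nlinarith [sq_nonneg r]
  linarith

theorem continuous_critFun (hlam : 0 < lam) : Continuous (critFun lam) := by
  unfold critFun
  refine (continuous_symbol hlam _).div (continuous_const.add (Continuous.log (by fun_prop)
    fun p => ?_)) fun p => ?_
  · have : 0 < ‖p‖ ^ 2 + lam := by positivity
    positivity
  · have := one_le_one_add_log hlam ‖p‖
    positivity

theorem critFun_pos (hlam : 0 < lam) (p : R3) : 0 < critFun lam p := by
  have := one_le_one_add_log hlam ‖p‖
  unfold critFun
  positivity

theorem hasDerivAt_one_add_log (hlam : 0 < lam) (r : ℝ) :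
    HasDerivAt (fun r : ℝ => 1 + Real.log ((r ^ 2 + lam) / lam)) (2 * r / (r ^ 2 + lam)) r := by
  have hX : 0 < r ^ 2 + lam := by positivity
  have h1 : HasDerivAt (fun r : ℝ => (r ^ 2 + lam) / lam) (2 * r / lam) r := by
    have := (((hasDerivAt_id r).pow 2).add_const lam).div_const lam
    simpa using this
  have h2 := (h1.log (by positivity)).const_add 1
  refine h2.congr_deriv ?_
  field_simp

theorem tendsto_one_add_log (hlam : 0 < lam) :
    Filter.Tendsto (fun r : ℝ => 1 + Real.log ((r ^ 2 + lam) / lam)) Filter.atTop Filter.atTop := by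
  refine Filter.tendsto_atTop_add_const_left _ _ (Real.tendsto_log_atTop.comp ?_)
  exact (Filter.tendsto_atTop_add_const_right _ _ (Filter.tendsto_pow_atTop two_ne_zero)).atTop_div_const
    hlam

/-- With L = 1 + log((r² + lam)/lam), the radial integrand is dominated by L'/L², the derivative of
-1/L. -/
theorem memLp_critFun (hlam : 0 < lam) : MemLp (critFun lam) 2 := by
  rw [memLp_two_iff_integrable_sq (continuous_critFun hlam).aestronglyMeasurable]
  have hint : IntegrableOn (fun r : ℝ => 2 * r / (r ^ 2 + lam) /
      (1 + Real.log ((r ^ 2 + lam) / lam)) ^ 2) (Ioi 0) := by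
    refine integrableOn_Ioi_deriv_of_nonneg' (g := fun r => -(1 + Real.log ((r ^ 2 + lam) / lam))⁻¹)
      (l := 0) (fun r _ => ?_) (fun r hr => ?_) ?_
    · have := one_le_one_add_log hlam r
      have h := ((hasDerivAt_one_add_log hlam r).inv (by positivity)).neg
      refine h.congr_deriv ?_
      ring
    · have hr' : (0 : ℝ) < r := hr
      positivity
    · simpa using (tendsto_one_add_log hlam).inv_tendsto_atTop.neg
  have key : IntegrableOn (fun r : ℝ => r ^ 2 * ((r ^ 2 + lam) ^ (-(3 / 4) : ℝ) /
      (1 + Real.log ((r ^ 2 + lam) / lam))) ^ 2) (Ioi 0) := by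
    refine hint.mono' (Measurable.aestronglyMeasurable (by fun_prop)) ?_
    filter_upwards [ae_restrict_mem measurableSet_Ioi] with r hr
    have hr' : (0 : ℝ) < r := hr
    have hX : 0 < r ^ 2 + lam := by positivity
    have hl := one_le_one_add_log hlam r
    set L := 1 + Real.log ((r ^ 2 + lam) / lam)
    rw [Real.norm_of_nonneg (by positivity), div_pow, ← mul_div_assoc]
    gcongr
    rw [← Real.rpow_two ((_ : ℝ) ^ (-(3 / 4) : ℝ)), ← Real.rpow_mul hX.le,
      show (-(3 / 4) * 2 : ℝ) = -(1 / 2) + -1 by norm_num, Real.rpow_add hX, Real.rpow_neg_one,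
      Real.rpow_neg hX.le, ← Real.sqrt_eq_rpow]
    have h1 : r ≤ √(r ^ 2 + lam) := Real.le_sqrt_of_sq_le (by linarith)
    have h2 : r * (√(r ^ 2 + lam))⁻¹ ≤ 1 := by
      rw [← div_eq_mul_inv, div_le_one (by positivity)]
      exact h1
    calc _ = r * (r * (√(r ^ 2 + lam))⁻¹) / (r ^ 2 + lam) := by rw [div_eq_mul_inv]; ring
      _ ≤ r * 2 / (r ^ 2 + lam) := by gcongr; linarith
      _ = _ := by ring
  exact (integrable_radial_iff (f := fun r => ((r ^ 2 + lam) ^ (-(3 / 4) : ℝ) /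
      (1 + Real.log ((r ^ 2 + lam) / lam))) ^ 2)).2 key

/-- For r > √lam the radial integrand dominates a constant times L'/L, the derivative of log L,
which is unbounded. -/
theorem not_integrable_mul_critFun (hlam : 0 < lam) :
    ¬ Integrable (fun p => (‖p‖ ^ 2 + lam) ^ (-(3 / 4) : ℝ) * critFun lam p) := by
  intro h
  have h2 := (integrable_radial_iff (f := fun r => (r ^ 2 + lam) ^ (-(3 / 4) : ℝ) *
    ((r ^ 2 + lam) ^ (-(3 / 4) : ℝ) / (1 + Real.log ((r ^ 2 + lam) / lam))))).1 h
  have hd : ∀ r, HasDerivAt (fun r => Real.log (1 + Real.log ((r ^ 2 + lam) / lam)))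
      (2 * r / (r ^ 2 + lam) / (1 + Real.log ((r ^ 2 + lam) / lam))) r := fun r => by
    have := one_le_one_add_log hlam r
    exact (hasDerivAt_one_add_log hlam r).log (by positivity)
  have h3 : IntegrableOn (fun r : ℝ => 2 * r / (r ^ 2 + lam) /
      (1 + Real.log ((r ^ 2 + lam) / lam))) (Ioi √lam) := by
    refine ((h2.mono_set (Ioi_subset_Ioi (Real.sqrt_nonneg lam))).const_mul 4).mono'
      (Measurable.aestronglyMeasurable (by fun_prop)) ?_
    filter_upwards [ae_restrict_mem measurableSet_Ioi] with r hr
    have hr' : √lam < r := hr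
    have hr0 : 0 < r := lt_of_le_of_lt (Real.sqrt_nonneg _) hr'
    have hX : 0 < r ^ 2 + lam := by positivity
    have hl := one_le_one_add_log hlam r
    set L := 1 + Real.log ((r ^ 2 + lam) / lam)
    rw [Real.norm_of_nonneg (by positivity), ← mul_div_assoc, ← mul_div_assoc, ← mul_div_assoc]
    gcongr
    rw [← Real.rpow_add hX,
      show (-(3 / 4) + -(3 / 4) : ℝ) = -(1 / 2) + -1 by norm_num, Real.rpow_add hX,
      Real.rpow_neg_one, Real.rpow_neg hX.le, ← Real.sqrt_eq_rpow]
    have hs : 0 < √(r ^ 2 + lam) := Real.sqrt_pos.2 hX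
    have h1 : √(r ^ 2 + lam) ≤ 2 * r := by
      rw [Real.sqrt_le_left (by positivity)]
      have : lam < r ^ 2 := by
        rw [← Real.sqrt_lt' hr0]; exact hr'
      nlinarith
    have h2 : 1 ≤ 2 * (r * (√(r ^ 2 + lam))⁻¹) := by
      rw [← mul_assoc, ← div_eq_mul_inv, one_le_div hs]
      exact h1
    calc 2 * r / (r ^ 2 + lam) = 2 * r / (r ^ 2 + lam) * 1 := by ring
      _ ≤ 2 * r / (r ^ 2 + lam) * (2 * (r * (√(r ^ 2 + lam))⁻¹)) := by gcongr
      _ = _ := by rw [div_eq_mul_inv]; ring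
  refine not_integrableOn_of_tendsto_norm_atTop_of_deriv_isBigO_filter
    (l := Filter.atTop) (f := fun r => Real.log (1 + Real.log ((r ^ 2 + lam) / lam)))
    (Filter.Ioi_mem_atTop √lam) (Filter.Eventually.of_forall fun r => (hd r).differentiableAt)
    ?_ ?_ h3
  · exact tendsto_norm_atTop_atTop.comp (Real.tendsto_log_atTop.comp (tendsto_one_add_log hlam))
  · have : deriv (fun r => Real.log (1 + Real.log ((r ^ 2 + lam) / lam))) = _ :=
      funext fun r => (hd r).deriv
    rw [this]
    exact Asymptotics.isBigO_refl _ _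

theorem exists_le_integral_mul_critFun (hlam : 0 < lam) (K : ℝ) : ∃ T, 0 < T ∧ ∀ t, T ≤ t →
    K ≤ t * ∫ p, rk lam t p * ((‖p‖ ^ 2 + lam) ^ (-(3 / 4) : ℝ) * critFun lam p) := by
  set w : R3 → ℝ := fun p => (‖p‖ ^ 2 + lam) ^ (-(3 / 4) : ℝ) * critFun lam p with hw
  have hwc : Continuous w := (continuous_symbol hlam _).mul (continuous_critFun hlam)
  have hw0 : ∀ p, 0 ≤ w p := fun p => by
    have := critFun_pos hlam p
    positivity
  have hball : ∀ n : ℕ, IntegrableOn w (Metric.closedBall 0 n) := fun n =>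
    hwc.continuousOn.integrableOn_compact (isCompact_closedBall 0 _)
  obtain ⟨n, hn⟩ : ∃ n : ℕ, 2 * K ≤ ∫ p in Metric.closedBall (0 : R3) n, w p := by
    by_contra! hcon
    refine not_integrable_mul_critFun hlam ?_
    refine (aecover_closedBall (x := (0 : R3)) tendsto_natCast_atTop_atTop).integrable_of_integral_bounded_of_nonneg_ae
      (2 * K) hball (Filter.Eventually.of_forall hw0) (Filter.Eventually.of_forall fun n => (hcon n).le)
  -- For t beyond this threshold, t/(p² + lam + t) ≥ 1/2 on the ball of radius n, which costs half
  -- of an integral chosen to be at least 2K.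
  refine ⟨(n : ℝ) ^ 2 + lam, by positivity, fun t ht => ?_⟩
  have ht0 : 0 < t := lt_of_lt_of_le (by positivity) ht
  have hwm : MemLp w 2 := by
    refine ((memLp_critFun hlam).const_mul (lam ^ (-(3 / 4) : ℝ))).mono
      hwc.aestronglyMeasurable (Filter.Eventually.of_forall fun p => ?_)
    rw [norm_mul, norm_mul]
    gcongr ?_ * _
    rw [Real.norm_of_nonneg (by positivity), Real.norm_of_nonneg (by positivity)]
    exact Real.rpow_le_rpow_of_nonpos hlam (by nlinarith [sq_nonneg ‖p‖]) (by norm_num)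
  have hi : Integrable (fun p => rk lam t p * w p) := (memLp_rk hlam ht0.le).integrable_mul hwm
  rw [← integral_const_mul]
  calc K ≤ 2⁻¹ * ∫ p in Metric.closedBall (0 : R3) n, w p := by linarith
    _ = ∫ p in Metric.closedBall (0 : R3) n, 2⁻¹ * w p := (integral_const_mul _ _).symm
    _ ≤ ∫ p in Metric.closedBall (0 : R3) n, t * (rk lam t p * w p) := by
        refine setIntegral_mono_on ((hball n).const_mul _) (hi.const_mul t).integrableOn
          Metric.isClosed_closedBall.measurableSet fun p hp => ?_
        rw [← mul_assoc t]
        refine mul_le_mul_of_nonneg_right ?_ (hw0 p)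
        have hp' : ‖p‖ ≤ n := by simpa using hp
        have : ‖p‖ ^ 2 ≤ (n : ℝ) ^ 2 := by gcongr
        rw [rk, ← div_eq_mul_inv, inv_eq_one_div, div_le_div_iff₀ (by norm_num) (by positivity)]
        linarith
    _ ≤ _ := by
        refine setIntegral_le_integral (hi.const_mul t) (Filter.Eventually.of_forall fun p => ?_)
        have := rk_pos hlam ht0.le p
        have := hw0 p
        simp only [Pi.zero_apply]
        positivity

/-- The term t ⟨ψ_t, X^{-3/4} v⟩, with X = p² + lam, tends to infinity and so exceeds any constant
produced by Q. Minus the real part of the density is then eventually at least c t^{-3/4}, and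
`not_memLp_of_density` applies. -/
theorem not_memLp_errFun_critFun (hα : 0 ≤ α) (hlam : 0 < lam) (Q : ℂ) :
    ¬ MemLp (errFun α lam (3 / 4) (fun p => (critFun lam p : ℂ)) Q) 2 := by
  intro h
  have hv : MemLp (fun p => (critFun lam p : ℂ)) 2 := (memLp_critFun hlam).ofReal
  have hs := sin_pi_mul_pos (σ := 3 / 4) (by norm_num) (by norm_num)
  have hk := kap_pos
  set q : ℝ := (Q / ((4 * Real.pi * robin α lam 0 : ℝ) : ℂ)).re with hq
  set G : ℝ → ℝ := fun t => kap * ∫ p, rk lam t p *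
    ((‖p‖ ^ 2 + lam) ^ (-(3 / 4) : ℝ) * critFun lam p) with hG
  have hgreen : ∀ t, green lam t (scaled lam (3 / 4) fun p => (critFun lam p : ℂ)) = (G t : ℂ) := by
    intro t
    simp only [hG, green, scaled]
    rw [Complex.ofReal_mul, ← integral_complex_ofReal]
    push_cast
    rfl
  set D : ℝ → ℝ := fun t => t ^ (3 / 4 - 1 : ℝ) * robin α lam t * (t * G t - q) with hDdef
  have hDre : ∀ t p, D t * rk lam t p = -(errDensity α lam (3 / 4)
      (fun p => (critFun lam p : ℂ)) Q t * (rk lam t p : ℂ)).re := fun t p => by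
    rw [Complex.re_mul_ofReal, errDensity, hgreen, Complex.re_ofReal_mul, Complex.sub_re,
      ← Complex.ofReal_mul, Complex.ofReal_re, ← hq, hDdef]
    ring
  have hint : ∀ p, IntegrableOn (fun t => errDensity α lam (3 / 4)
      (fun p => (critFun lam p : ℂ)) Q t * (rk lam t p : ℂ)) (Ioi 0) := fun p =>
    (integrableOn_errDensity_mul_rk hα hlam (by norm_num) (by norm_num) hv p).2
  have hD : ∀ p, IntegrableOn (fun t => D t * rk lam t p) (Ioi 0) := fun p => by
    simp only [hDre]
    exact (hint p).re.neg
  obtain ⟨c, hc, hlow⟩ := exists_le_rpow_mul_robin (σ := 3 / 4) hα hlam le_rfl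
  obtain ⟨T, hT, hT'⟩ := exists_le_integral_mul_critFun hlam (kap⁻¹ * (q + 1))
  refine not_memLp_of_density hlam hD hc (T := max T 1) (by positivity) (fun t ht => ?_) ?_
  · have h1 := hlow t (le_trans (le_max_right _ _) ht)
    have h2 := hT' t (le_trans (le_max_left _ _) ht)
    rw [inv_mul_le_iff₀ hk] at h2
    have h3 : q + 1 ≤ t * G t := by
      rw [hG]
      linarith
    have h4 : 0 ≤ t ^ (3 / 4 - 1 : ℝ) * robin α lam t := by
      have ht0 : 0 < t := lt_of_lt_of_le (by positivity) ht
      have := robin_pos hα hlam ht0.le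
      positivity
    rw [hDdef]
    nlinarith
  · refine (h.re.const_mul (-(4 * Real.sin (Real.pi * (3 / 4)) * kap)⁻¹)).ae_eq
      (Filter.Eventually.of_forall fun p => ?_)
    simp only [hDre, integral_neg]
    have e : (∫ t in Ioi (0 : ℝ), (errDensity α lam (3 / 4)
      (fun p => (critFun lam p : ℂ)) Q t * (rk lam t p : ℂ)).re) = (∫ t in Ioi (0 : ℝ),
      errDensity α lam (3 / 4) (fun p => (critFun lam p : ℂ)) Q t * (rk lam t p : ℂ)).re :=
      integral_re (hint p)
    rw [e, RCLike.re_to_complex, errFun, Complex.re_ofReal_mul, neg_mul,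
      inv_mul_cancel_left₀ (by positivity)]

end

/-! ### The Fourier transform `hat` -/

section hat

theorem two_pi_inv_ne_zero : ((2 * Real.pi)⁻¹ : ℝ) ≠ 0 := by
  have := Real.pi_pos
  positivity

theorem ae_comp_smul {u v : R3 → ℂ} (h : u =ᵐ[volume] v) {r : ℝ} (hr : r ≠ 0) :
    (fun p => u (r • p)) =ᵐ[volume] fun p => v (r • p) :=
  (quasiMeasurePreserving_smul hr).ae_eq_comp h

theorem memLp_hat (f : L2) : MemLp (hat f) 2 :=
  (memLp_comp_smul (Lp.memLp _) two_pi_inv_ne_zero).const_mul _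

theorem hat_add (f g : L2) : hat (f + g) =ᵐ[volume] fun p => hat f p + hat g p := by
  have h : (𝓕 (f + g) : L2) =ᵐ[volume] fun p => (𝓕 f : L2) p + (𝓕 g : L2) p := by
    rw [FourierTransform.fourier_add]
    exact Lp.coeFn_add _ _
  filter_upwards [ae_comp_smul h two_pi_inv_ne_zero] with p hp
  rw [hat, hat, hat, hp, mul_add]

theorem hat_smul (c : ℂ) (f : L2) : hat (c • f) =ᵐ[volume] fun p => c * hat f p := by
  have h : (𝓕 (c • f) : L2) =ᵐ[volume] fun p => c * (𝓕 f : L2) p := by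
    rw [FourierTransform.fourier_smul]
    exact Lp.coeFn_smul _ _
  filter_upwards [ae_comp_smul h two_pi_inv_ne_zero] with p hp
  rw [hat, hat, hp, mul_left_comm]

theorem hat_injective {f g : L2} (h : hat f =ᵐ[volume] hat g) : f = g := by
  have h1 : (𝓕 f : L2) = (𝓕 g : L2) := by
    refine Lp.ext ?_
    have hpi : (0 : ℝ) < 2 * Real.pi := by positivity
    have hk : (((2 * Real.pi) ^ (-(3 / 2) : ℝ) : ℝ) : ℂ) ≠ 0 := by
      exact_mod_cast (Real.rpow_pos_of_pos hpi _).ne'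
    filter_upwards [ae_comp_smul h hpi.ne'] with p hp
    simp only [hat, smul_smul, inv_mul_cancel₀ hpi.ne', one_smul] at hp
    exact mul_left_cancel₀ hk hp
  have hf : (𝓕⁻ (𝓕 f : L2) : L2) = f := FourierTransform.fourierInv_fourier_eq f
  have hg : (𝓕⁻ (𝓕 g : L2) : L2) = g := FourierTransform.fourierInv_fourier_eq g
  rw [← hf, h1, hg]

theorem integral_comp_two_pi_inv_smul (F : R3 → ℂ) :
    (((2 * Real.pi) ^ (-3 : ℝ) : ℝ) : ℂ) * ∫ p, F ((2 * Real.pi)⁻¹ • p) = ∫ p, F p := by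
  have hpi : (0 : ℝ) < 2 * Real.pi := by positivity
  have e2 : (2 * Real.pi) ^ (-3 : ℝ) * |((2 * Real.pi)⁻¹ ^ 3)⁻¹| = 1 := by
    rw [abs_of_pos (by positivity), inv_pow, inv_inv, Real.rpow_neg hpi.le,
      inv_mul_eq_one₀ (by positivity)]
    exact Real.rpow_ofNat _ 3
  rw [Measure.integral_comp_smul, finrank_euclideanSpace_fin, Complex.real_smul, ← mul_assoc,
    ← Complex.ofReal_mul, e2, Complex.ofReal_one, one_mul]

theorem inner_eq_integral_hat (f g : L2) :
    inner ℂ f g = ∫ p, (starRingEnd ℂ) (hat f p) * hat g p := by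
  have hpi : (0 : ℝ) < 2 * Real.pi := by positivity
  have h := integral_comp_two_pi_inv_smul
    (fun p => (starRingEnd ℂ) ((𝓕 f : L2) p) * (𝓕 g : L2) p)
  have e : ∀ p, (starRingEnd ℂ) (hat f p) * hat g p = (((2 * Real.pi) ^ (-3 : ℝ) : ℝ) : ℂ) *
      ((starRingEnd ℂ) ((𝓕 f : L2) ((2 * Real.pi)⁻¹ • p)) * (𝓕 g : L2) ((2 * Real.pi)⁻¹ • p)) := by
    intro p
    rw [show (-3 : ℝ) = -(3 / 2) + -(3 / 2) by norm_num, Real.rpow_add hpi, hat, hat, map_mul,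
      Complex.conj_ofReal, Complex.ofReal_mul]
    ring
  rw [← Lp.inner_fourier_eq, L2.inner_def, integral_congr_ae (Filter.Eventually.of_forall e),
    integral_const_mul, h]
  refine integral_congr_ae (Filter.Eventually.of_forall fun p => ?_)
  beta_reduce
  rw [RCLike.inner_apply]
  exact mul_comm _ _

end hat

/-! ### Sobolev spaces on the Fourier side -/

section Sobolev

variable {lam s : ℝ}

theorem memLp_mul_of_le {a b : R3 → ℝ} {u : R3 → ℂ} {C : ℝ} (ha : Continuous a)
    (hu : AEStronglyMeasurable u volume) (hab : ∀ p, ‖a p‖ ≤ C * ‖b p‖)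
    (h : MemLp (fun p => (b p : ℂ) * u p) 2) : MemLp (fun p => (a p : ℂ) * u p) 2 := by
  refine h.of_le_mul (c := C) ((Complex.continuous_ofReal.comp ha).aestronglyMeasurable.mul hu)
    (Filter.Eventually.of_forall fun p => ?_)
  rw [norm_mul, norm_mul, Complex.norm_real, Complex.norm_real, ← mul_assoc]
  exact mul_le_mul_of_nonneg_right (hab p) (norm_nonneg _)

theorem toTemperedDistribution_injective {f g : L2} (h : (f : 𝓢'(R3, ℂ)) = (g : 𝓢'(R3, ℂ))) :
    f = g := by
  have h1 : f - g ∈ (Lp.toTemperedDistributionCLM ℂ (volume : Measure R3) 2).ker := by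
    rw [LinearMap.mem_ker, ContinuousLinearMap.coe_coe, map_sub, sub_eq_zero]
    exact h
  rw [Lp.ker_toTemperedDistributionCLM_eq_bot, Submodule.mem_bot] at h1
  exact sub_eq_zero.1 h1

/-- The symbols (1 + ‖ξ‖²)^{±s/2} are mutually inverse multipliers of temperate growth, and the
negative one is bounded, so it acts on L². The embedding of L² into tempered distributions is
injective, which carries identities back to functions. -/
theorem mem_Hs_iff_fourier (hs : 0 ≤ s) (f : L2) : f ∈ Hs s ↔
    MemLp (fun ξ => (((1 + ‖ξ‖ ^ 2) ^ (s / 2) : ℝ) : ℂ) * (𝓕 f : L2) ξ) 2 := by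
  have hg1 : (fun ξ : R3 => (((1 + ‖ξ‖ ^ 2) ^ (s / 2) : ℝ) : ℂ)).HasTemperateGrowth := by fun_prop
  have hg2 : (fun ξ : R3 => (((1 + ‖ξ‖ ^ 2) ^ (-(s / 2)) : ℝ) : ℂ)).HasTemperateGrowth := by
    fun_prop
  have hb : MemLp (fun ξ : R3 => (((1 + ‖ξ‖ ^ 2) ^ (-(s / 2)) : ℝ) : ℂ)) ⊤ := by
    refine memLp_top_of_bound hg2.1.continuous.aestronglyMeasurable 1
      (Filter.Eventually.of_forall fun ξ => ?_)
    rw [Complex.norm_real, Real.norm_of_nonneg (by positivity)]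
    exact Real.rpow_le_one_of_one_le_of_nonpos (by nlinarith [sq_nonneg ‖ξ‖]) (by linarith)
  have hprod : ∀ ξ : R3, (((1 + ‖ξ‖ ^ 2) ^ (s / 2) : ℝ) : ℂ) *
      (((1 + ‖ξ‖ ^ 2) ^ (-(s / 2)) : ℝ) : ℂ) = 1 := fun ξ => by
    rw [← Complex.ofReal_mul, ← Real.rpow_add (by positivity)]
    simp
  have hae : ∀ u : L2, (hb.toLp _ • u : L2) =ᵐ[volume]
      fun ξ => (((1 + ‖ξ‖ ^ 2) ^ (-(s / 2)) : ℝ) : ℂ) * u ξ := fun u => by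
    filter_upwards [Lp.coeFn_lpSMul (r := 2) (hb.toLp _) u, hb.coeFn_toLp] with ξ h1 h2
    rw [h1, Pi.smul_apply', h2, smul_eq_mul]
  have h0 : f ∈ Hs s ↔ ∃ u : L2, TemperedDistribution.smulLeftCLM ℂ
      (fun ξ : R3 => (((1 + ‖ξ‖ ^ 2) ^ (s / 2) : ℝ) : ℂ)) ((𝓕 f : L2) : 𝓢'(R3, ℂ)) =
        (u : 𝓢'(R3, ℂ)) := by
    rw [← Lp.fourier_toTemperedDistribution_eq]
    exact TemperedDistribution.memSobolev_iff_exists_smulLeftCLM_fourier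
  rw [h0]
  constructor
  · rintro ⟨u, hu⟩
    have h1 : ((𝓕 f : L2) : 𝓢'(R3, ℂ)) = ((hb.toLp _ • u : L2) : 𝓢'(R3, ℂ)) := by
      rw [Lp.toTemperedDistribution_smul_eq hg2, ← hu,
        TemperedDistribution.smulLeftCLM_smulLeftCLM_apply hg1 hg2]
      convert! (TemperedDistribution.smulLeftCLM_const 1 ((𝓕 f : L2) : 𝓢'(R3, ℂ))).symm using 1
      · simp
      · congr 1
        congr 1
        ext ξ
        exact hprod ξ
    have h2 := toTemperedDistribution_injective h1
    refine (Lp.memLp u).ae_eq ?_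
    filter_upwards [hae u] with ξ hξ
    rw [h2, hξ, ← mul_assoc, hprod, one_mul]
  · intro h
    obtain ⟨w, hw⟩ : ∃ w : L2, w =ᵐ[volume]
      fun ξ => (((1 + ‖ξ‖ ^ 2) ^ (s / 2) : ℝ) : ℂ) * (𝓕 f : L2) ξ := ⟨_, h.coeFn_toLp⟩
    refine ⟨w, ?_⟩
    have h1 : (𝓕 f : L2) = (hb.toLp _ • w : L2) := by
      refine Lp.ext ?_
      filter_upwards [hae w, hw] with ξ h2 h3
      rw [h2, h3, ← mul_assoc, mul_comm (((1 + ‖ξ‖ ^ 2) ^ (-(s / 2)) : ℝ) : ℂ), hprod, one_mul]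
    rw [h1, Lp.toTemperedDistribution_smul_eq hg2,
      TemperedDistribution.smulLeftCLM_smulLeftCLM_apply hg2 hg1]
    convert! TemperedDistribution.smulLeftCLM_const 1 (w : 𝓢'(R3, ℂ)) using 1
    · congr 1
      congr 1
      ext ξ
      rw [Pi.mul_apply, mul_comm, hprod]
    · simp

theorem memLp_comp_smul_iff {u : R3 → ℂ} {r : ℝ} (hr : r ≠ 0) :
    MemLp (fun p => u (r • p)) 2 ↔ MemLp u 2 := by
  refine ⟨fun h => ?_, fun h => memLp_comp_smul h hr⟩
  have := memLp_comp_smul h (inv_ne_zero hr)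
  simpa only [smul_smul, mul_inv_cancel₀ hr, one_smul] using this

/-- Membership in `H^s` in terms of the symbol `(p² + lam)^{s/2}`. -/
theorem mem_Hs_iff (hlam : 0 < lam) (hs : 0 ≤ s) (f : L2) : f ∈ Hs s ↔
    MemLp (fun p => (((‖p‖ ^ 2 + lam) ^ (s / 2) : ℝ) : ℂ) * hat f p) 2 := by
  have hpi : (0 : ℝ) < 2 * Real.pi := by positivity
  set k : ℝ := (2 * Real.pi)⁻¹ with hk
  have hk0 : 0 < k := by positivity
  have hc : ∀ p : R3, 1 + ‖k • p‖ ^ 2 = 1 + k ^ 2 * ‖p‖ ^ 2 := fun p => by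
    rw [norm_smul, Real.norm_of_nonneg hk0.le, mul_pow]
  have hcont : Continuous fun p : R3 => (1 + ‖k • p‖ ^ 2) ^ (s / 2) :=
    Continuous.rpow_const (by fun_prop) fun p => Or.inl (by positivity)
  rw [mem_Hs_iff_fourier hs, ← memLp_comp_smul_iff hk0.ne']
  have e : MemLp (fun p => (((1 + ‖k • p‖ ^ 2) ^ (s / 2) : ℝ) : ℂ) * (𝓕 f : L2) (k • p)) 2 ↔
      MemLp (fun p => (((1 + ‖k • p‖ ^ 2) ^ (s / 2) : ℝ) : ℂ) * hat f p) 2 := by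
    have hne : (((2 * Real.pi) ^ (-(3 / 2) : ℝ) : ℝ) : ℂ) ≠ 0 := by
      exact_mod_cast (Real.rpow_pos_of_pos hpi _).ne'
    constructor
    · intro h
      refine (h.const_mul (((2 * Real.pi) ^ (-(3 / 2) : ℝ) : ℝ) : ℂ)).ae_eq
        (Filter.Eventually.of_forall fun p => ?_)
      simp only [hat, ← hk]
      ring
    · intro h
      refine (h.const_mul (((2 * Real.pi) ^ (-(3 / 2) : ℝ) : ℝ) : ℂ)⁻¹).ae_eq
        (Filter.Eventually.of_forall fun p => ?_)
      simp only [hat, ← hk]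
      field_simp
  rw [e]
  -- The symbols 1 + k²‖p‖² and ‖p‖² + lam bound each other up to constants; raising this to the
  -- power s/2 ≥ 0 makes the two weighted conditions equivalent.
  have hrpow : ∀ {a b C : ℝ}, 0 < a → 0 < b → 0 < C → a ≤ C * b →
      ‖a ^ (s / 2)‖ ≤ C ^ (s / 2) * ‖b ^ (s / 2)‖ := fun {a b C} ha hb hC hab => by
    rw [Real.norm_of_nonneg (by positivity), Real.norm_of_nonneg (by positivity),
      ← Real.mul_rpow hC.le hb.le]
    exact Real.rpow_le_rpow ha.le hab (by linarith)
  constructor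
  · refine memLp_mul_of_le (C := ((k ^ 2)⁻¹ + lam) ^ (s / 2)) (continuous_symbol hlam _)
      (memLp_hat f).1 fun p => hrpow (by positivity) (by positivity) (by positivity) ?_
    rw [hc]
    have h1 : (k ^ 2)⁻¹ * (k ^ 2 * ‖p‖ ^ 2) = ‖p‖ ^ 2 := inv_mul_cancel_left₀ (by positivity) _
    have h2 : 0 ≤ lam * (k ^ 2 * ‖p‖ ^ 2) := by positivity
    have h3 : 0 < (k ^ 2)⁻¹ := by positivity
    nlinarith
  · refine memLp_mul_of_le (C := (lam⁻¹ + k ^ 2) ^ (s / 2)) hcont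
      (memLp_hat f).1 fun p => hrpow (by positivity) (by positivity) (by positivity) ?_
    rw [hc]
    have h1 : lam⁻¹ * lam = 1 := inv_mul_cancel₀ hlam.ne'
    have h2 : 0 ≤ lam⁻¹ * ‖p‖ ^ 2 := by positivity
    have h3 : 0 ≤ k ^ 2 * lam := by positivity
    nlinarith

theorem memLp_invPow_symbol_mul (hlam : 0 < lam) (hs : 0 ≤ s) {u : R3 → ℂ} (hu : MemLp u 2) :
    MemLp (fun p => (((‖p‖ ^ 2 + lam) ^ (-(s / 2)) : ℝ) : ℂ) * u p) 2 :=
  memLp_scaled (σ := s / 2) hlam (by linarith) hu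

theorem hat_invPow (hlam : 0 < lam) (hs : 0 ≤ s) (g : L2) :
    (fun p => (((‖p‖ ^ 2 + lam) ^ (s / 2) : ℝ) : ℂ) * hat (invPow lam s g) p) =ᵐ[volume] hat g := by
  filter_upwards [hat_ofHat (memLp_invPow_symbol_mul hlam hs (memLp_hat g))] with p hp
  have hX : 0 < ‖p‖ ^ 2 + lam := by positivity
  rw [invPow, hp, ← mul_assoc, ← Complex.ofReal_mul, ← Real.rpow_add hX]
  simp

theorem invPow_mem_Hs (hlam : 0 < lam) (hs : 0 ≤ s) (g : L2) : invPow lam s g ∈ Hs s :=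
  (mem_Hs_iff hlam hs _).2 ((memLp_hat g).ae_eq (hat_invPow hlam hs g).symm)

theorem exists_invPow_eq (hlam : 0 < lam) (hs : 0 ≤ s) {f : L2} (hf : f ∈ Hs s) :
    ∃ g, invPow lam s g = f := by
  have hm := (mem_Hs_iff hlam hs f).1 hf
  refine ⟨ofHat fun p => (((‖p‖ ^ 2 + lam) ^ (s / 2) : ℝ) : ℂ) * hat f p, hat_injective ?_⟩
  filter_upwards [hat_invPow hlam hs (ofHat fun p => (((‖p‖ ^ 2 + lam) ^ (s / 2) : ℝ) : ℂ) *
    hat f p), hat_ofHat hm] with p h1 h2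
  have hX : 0 < ‖p‖ ^ 2 + lam := by positivity
  have hne : (((‖p‖ ^ 2 + lam) ^ (s / 2) : ℝ) : ℂ) ≠ 0 := by
    exact_mod_cast (Real.rpow_pos_of_pos hX _).ne'
  rw [h2] at h1
  exact mul_left_cancel₀ hne h1

end Sobolev

/-! ### The maps `R_s` and `Q_s` on the Fourier side -/

section

variable {α lam s σ : ℝ}

/-- `(p² + lam)^{s/2} f̂(p)`. -/
def lift (lam s : ℝ) (f : L2) (p : R3) : ℂ :=
  (((‖p‖ ^ 2 + lam) ^ (s / 2) : ℝ) : ℂ) * hat f p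

theorem memLp_lift (hlam : 0 < lam) (hs : 0 ≤ s) {f : L2} (hf : f ∈ Hs s) :
    MemLp (lift lam s f) 2 := (mem_Hs_iff hlam hs f).1 hf

theorem rpow_ofReal_ne_zero (hlam : 0 < lam) (e : ℝ) (p : R3) :
    (((‖p‖ ^ 2 + lam) ^ e : ℝ) : ℂ) ≠ 0 := by
  have hX : 0 < ‖p‖ ^ 2 + lam := by positivity
  exact_mod_cast (Real.rpow_pos_of_pos hX _).ne'

theorem lift_injective (hlam : 0 < lam) {f g : L2} (h : lift lam s f =ᵐ[volume] lift lam s g) :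
    f = g := by
  refine hat_injective ?_
  filter_upwards [h] with p hp
  exact mul_left_cancel₀ (rpow_ofReal_ne_zero hlam _ p) hp

theorem exists_lift_eq (hlam : 0 < lam) (hs : 0 ≤ s) {u : R3 → ℂ} (hu : MemLp u 2) :
    ∃ f ∈ Hs s, lift lam s f =ᵐ[volume] u :=
  ⟨invPow lam s (ofHat u), invPow_mem_Hs hlam hs _,
    (hat_invPow hlam hs (ofHat u)).trans (hat_ofHat hu)⟩

theorem lift_smul_add (c : ℂ) (f g : L2) :
    lift lam s (c • f + g) =ᵐ[volume] fun p => c * lift lam s f p + lift lam s g p := by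
  filter_upwards [hat_add (c • f) g, hat_smul c f] with p h1 h2
  rw [lift, lift, lift, h1, h2]
  ring

theorem lift_zero : lift lam s 0 =ᵐ[volume] fun _ => 0 := by
  filter_upwards [hat_smul 0 (0 : L2)] with p h
  rw [smul_zero, zero_mul] at h
  rw [lift, h, mul_zero]

theorem kap_eq : kap = 1 / (2 * Real.pi) ^ (3 / 2 : ℝ) := by
  rw [kap, Real.rpow_neg (by positivity), one_div]

theorem cIntegrand_eq (f : L2) (t : ℝ) (p : R3) :
    cIntegrand lam s f t p = (rk lam t p : ℂ) * lift lam s f p := by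
  rw [cIntegrand, lift, rk, div_eq_mul_inv]
  push_cast
  ring

theorem cCoef_eq (f : L2) (t : ℝ) : cCoef lam s f t = green lam t (lift lam s f) := by
  simp only [cCoef, green, cIntegrand_eq, kap]

theorem qIntegrand_eq (f : L2) (t : ℝ) : qIntegrand α lam s f t =
    ((t ^ (-(s / 2)) * robin α lam t : ℝ) : ℂ) * green lam t (lift lam s f) := by
  rw [qIntegrand, cCoef_eq, robin, mul_one_div]

theorem sin_half_eq (s : ℝ) : Real.sin (s * Real.pi / 2) = Real.sin (Real.pi * (s / 2)) := by
  congr 1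
  ring

theorem fracQ_eq (f : L2) : fracQ α lam s f = chargeFun α lam (s / 2) (lift lam s f) := by
  simp only [fracQ, qConst, chargeFun, qIntegrand_eq, sin_half_eq]

theorem wIntegrand_eq (f : L2) (p : R3) (t : ℝ) : wIntegrand α lam s f p t =
    ((t ^ (1 - s / 2) * robin α lam t : ℝ) : ℂ) * green lam t (lift lam s f) *
      (rk lam t p : ℂ) := by
  rw [wIntegrand, cCoef_eq, robin, rk]
  push_cast
  ring

theorem wHat_eq (hlam : 0 < lam) (f : L2) (p : R3) : wHat α lam s f p =
    -scaled lam (s / 2) (corrFun α lam (s / 2) (lift lam s f)) p := by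
  have hX : 0 < ‖p‖ ^ 2 + lam := by positivity
  have e : 1 / (‖p‖ ^ 2 + lam) = (‖p‖ ^ 2 + lam) ^ (-(s / 2)) * (‖p‖ ^ 2 + lam) ^ (s / 2 - 1) := by
    rw [← Real.rpow_add hX, one_div, ← Real.rpow_neg_one]
    congr 1
    ring
  simp only [wHat, wIntegrand_eq, scaled, corrFun, sin_half_eq, e, kap_eq]
  push_cast
  ring

theorem memLp_wHat (hα : 0 ≤ α) (hlam : 0 < lam) (hs : s ∈ Ioo (1 / 2 : ℝ) 2) {f : L2}
    (hf : f ∈ Hs s) : MemLp (wHat α lam s f) 2 := by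
  obtain ⟨h0, h1⟩ := hs
  refine (memLp_scaled (σ := s / 2) hlam (by linarith) (memLp_corrFun (σ := s / 2) hα hlam
    (by linarith) (by linarith) (memLp_lift hlam (by linarith) hf))).neg.ae_eq
    (Filter.Eventually.of_forall fun p => (wHat_eq hlam f p).symm)

theorem lift_fracR (hα : 0 ≤ α) (hlam : 0 < lam) (hs : s ∈ Ioo (1 / 2 : ℝ) 2) {f : L2}
    (hf : f ∈ Hs s) : lift lam s (fracR α lam s f) =ᵐ[volume]
      fun p => lift lam s f p - corrFun α lam (s / 2) (lift lam s f) p := by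
  filter_upwards [hat_add f (wFun α lam s f), hat_ofHat (memLp_wHat hα hlam hs hf)] with p h1 h2
  have hX : 0 < ‖p‖ ^ 2 + lam := by positivity
  rw [fracR, lift, h1, wFun, h2, wHat_eq hlam, scaled, mul_add, mul_neg, ← mul_assoc,
    ← Complex.ofReal_mul, ← Real.rpow_add hX, add_neg_cancel, Real.rpow_zero, Complex.ofReal_one,
    one_mul, ← sub_eq_add_neg, lift]

theorem fracR_mem (hα : 0 ≤ α) (hlam : 0 < lam) (hs : s ∈ Ioo (1 / 2 : ℝ) 2) {f : L2}
    (hf : f ∈ Hs s) : fracR α lam s f ∈ Hs s := by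
  have h0 : 0 ≤ s := by linarith [hs.1]
  have hl := memLp_lift hlam h0 hf
  exact (mem_Hs_iff hlam h0 _).2 ((hl.sub (memLp_corrFun (σ := s / 2) hα hlam
    (by linarith [hs.1]) (by linarith [hs.2]) hl)).ae_eq (lift_fracR hα hlam hs hf).symm)

/-- The preimages of `(h, Q)` under `(R_s, Q_s)`. -/
theorem fracR_eq_and_fracQ_eq_iff (hα : 0 ≤ α) (hlam : 0 < lam) (hs : s ∈ Ioo (1 / 2 : ℝ) 2)
    {f h : L2} (hf : f ∈ Hs s) {v : R3 → ℂ} (hv : MemLp v 2) (hh : lift lam s h =ᵐ[volume] v)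
    {Q : ℂ} : (fracR α lam s f = h ∧ fracQ α lam s f = Q) ↔
      lift lam s f =ᵐ[volume] fun p => v p + errFun α lam (s / 2) v Q p := by
  rw [← preimage_iff hα hlam (by linarith [hs.1]) (by linarith [hs.2]) hv
    (memLp_lift hlam (by linarith [hs.1]) hf), fracQ_eq]
  refine and_congr_left' ⟨fun H => ?_, fun H => ?_⟩
  · rw [← H] at hh
    exact (lift_fracR hα hlam hs hf).symm.trans hh
  · exact lift_injective hlam ((lift_fracR hα hlam hs hf).trans (H.trans hh.symm))

/-! ### Linearity and absolute convergence -/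

theorem green_mul_add {t : ℝ} (hlam : 0 < lam) (ht : 0 ≤ t) {g h : R3 → ℂ} (hg : MemLp g 2)
    (hh : MemLp h 2) (c : ℂ) :
    green lam t (fun p => c * g p + h p) = c * green lam t g + green lam t h := by
  rw [green_add (integrable_rk_mul hlam ht (hg.const_mul c)) (integrable_rk_mul hlam ht hh),
    green_const_mul]

theorem chargeFun_mul_add (hα : 0 ≤ α) (hlam : 0 < lam) (h0 : 1 / 4 < σ) (h1 : σ < 1)
    {g h k : R3 → ℂ} (hg : MemLp g 2) (hh : MemLp h 2) {c : ℂ}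
    (hk : k =ᵐ[volume] fun p => c * g p + h p) :
    chargeFun α lam σ k = c * chargeFun α lam σ g + chargeFun α lam σ h := by
  have i1 := integrableOn_density hα hlam h0 h1 hg
  have i2 := integrableOn_density hα hlam h0 h1 hh
  rw [chargeFun, chargeFun, chargeFun, mul_left_comm, ← mul_add, ← integral_const_mul c,
    ← integral_add (i1.const_mul c) i2]
  congr 1
  refine setIntegral_congr_fun measurableSet_Ioi fun t ht => ?_
  have ht' : (0 : ℝ) < t := ht
  rw [green_congr hk, green_mul_add hlam ht'.le hg hh]
  ring

theorem corrFun_mul_add (hα : 0 ≤ α) (hlam : 0 < lam) (h0 : 1 / 4 < σ) (h1 : σ < 1)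
    {g h k : R3 → ℂ} (hg : MemLp g 2) (hh : MemLp h 2) {c : ℂ}
    (hk : k =ᵐ[volume] fun p => c * g p + h p) (p : R3) :
    corrFun α lam σ k p = c * corrFun α lam σ g p + corrFun α lam σ h p := by
  have i1 := integrableOn_density_mul_rk hα hlam h0 h1 hg p
  have i2 := integrableOn_density_mul_rk hα hlam h0 h1 hh p
  rw [corrFun, corrFun, corrFun, mul_left_comm c, mul_left_comm c, ← mul_add, ← mul_add,
    ← integral_const_mul c, ← integral_add (i1.const_mul c) i2]
  congr 2
  refine setIntegral_congr_fun measurableSet_Ioi fun t ht => ?_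
  have ht' : (0 : ℝ) < t := ht
  rw [green_congr hk, green_mul_add hlam ht'.le hg hh]
  ring

theorem fracQ_smul_add (hα : 0 ≤ α) (hlam : 0 < lam) (hs : s ∈ Ioo (1 / 2 : ℝ) 2) {f g : L2}
    (hf : f ∈ Hs s) (hg : g ∈ Hs s) (c : ℂ) :
    fracQ α lam s (c • f + g) = c * fracQ α lam s f + fracQ α lam s g := by
  have h0 : 0 ≤ s := by linarith [hs.1]
  rw [fracQ_eq, fracQ_eq, fracQ_eq]
  exact chargeFun_mul_add hα hlam (by linarith [hs.1]) (by linarith [hs.2])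
    (memLp_lift hlam h0 hf) (memLp_lift hlam h0 hg) (lift_smul_add c f g)

theorem fracR_smul_add (hα : 0 ≤ α) (hlam : 0 < lam) (hs : s ∈ Ioo (1 / 2 : ℝ) 2) {f g : L2}
    (hf : f ∈ Hs s) (hg : g ∈ Hs s) (c : ℂ) :
    fracR α lam s (c • f + g) = c • fracR α lam s f + fracR α lam s g := by
  have h0 : 0 ≤ s := by linarith [hs.1]
  refine lift_injective (s := s) hlam ?_
  filter_upwards [lift_fracR hα hlam hs ((Hs s).add_mem ((Hs s).smul_mem c hf) hg),
    lift_fracR hα hlam hs hf, lift_fracR hα hlam hs hg, lift_smul_add (lam := lam) (s := s) c f g,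
    lift_smul_add (lam := lam) (s := s) c (fracR α lam s f) (fracR α lam s g)]
    with p h1 h2 h3 h4 h5
  rw [h1, h5, h2, h3, h4, corrFun_mul_add hα hlam (by linarith [hs.1]) (by linarith [hs.2])
    (memLp_lift hlam h0 hf) (memLp_lift hlam h0 hg) (lift_smul_add c f g)]
  ring

theorem isLinearMap_of_map_smul_add {V W : Type*} [AddCommGroup V] [Module ℂ V] [AddCommGroup W]
    [Module ℂ W] {F : V → W} (h : ∀ (c : ℂ) (x y : V), F (c • x + y) = c • F x + F y) :
    IsLinearMap ℂ F := by
  have h0 : F 0 = 0 := by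
    have := h 1 0 0
    rw [smul_zero, add_zero, one_smul] at this
    exact left_eq_add.1 this
  refine ⟨fun x y => ?_, fun c x => ?_⟩
  · simpa only [one_smul] using h 1 x y
  · simpa only [add_zero, h0] using h c x 0

theorem isLinearMap_fracR (hα : 0 ≤ α) (hlam : 0 < lam) (hs : s ∈ Ioo (1 / 2 : ℝ) 2) :
    IsLinearMap ℂ (fun f : Hs s => fracR α lam s f) :=
  isLinearMap_of_map_smul_add fun c f g => fracR_smul_add hα hlam hs f.2 g.2 c

theorem isLinearMap_fracQ (hα : 0 ≤ α) (hlam : 0 < lam) (hs : s ∈ Ioo (1 / 2 : ℝ) 2) :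
    IsLinearMap ℂ (fun f : Hs s => fracQ α lam s f) :=
  isLinearMap_of_map_smul_add fun c f g => fracQ_smul_add hα hlam hs f.2 g.2 c

theorem fracR_zero (hα : 0 ≤ α) (hlam : 0 < lam) (hs : s ∈ Ioo (1 / 2 : ℝ) 2) :
    fracR α lam s 0 = 0 := (isLinearMap_fracR hα hlam hs).map_zero

theorem fracQ_zero (hα : 0 ≤ α) (hlam : 0 < lam) (hs : s ∈ Ioo (1 / 2 : ℝ) 2) :
    fracQ α lam s 0 = 0 := (isLinearMap_fracQ hα hlam hs).map_zero

theorem integrable_integrands (hα : 0 ≤ α) (hlam : 0 < lam) (hs : s ∈ Ioo (1 / 2 : ℝ) 2) {f : L2}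
    (hf : f ∈ Hs s) :
    (∀ t : ℝ, 0 ≤ t → Integrable (cIntegrand lam s f t) volume) ∧
      IntegrableOn (qIntegrand α lam s f) (Ioi 0) volume ∧
      (∀ p : R3, IntegrableOn (wIntegrand α lam s f p) (Ioi 0) volume) ∧
      MemLp (wHat α lam s f) 2 volume := by
  have hl := memLp_lift hlam (by linarith [hs.1]) hf
  have h0 : 1 / 4 < s / 2 := by linarith [hs.1]
  have h1 : s / 2 < 1 := by linarith [hs.2]
  refine ⟨fun t ht => ?_, ?_, fun p => ?_, memLp_wHat hα hlam hs hf⟩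
  · exact (integrable_rk_mul hlam ht hl).congr
      (Filter.Eventually.of_forall fun p => (cIntegrand_eq f t p).symm)
  · exact (integrableOn_density hα hlam h0 h1 hl).congr
      (Filter.Eventually.of_forall fun t => (qIntegrand_eq f t).symm)
  · exact (integrableOn_density_mul_rk hα hlam h0 h1 hl p).congr
      (Filter.Eventually.of_forall fun t => (wIntegrand_eq f p t).symm)

/-! ### The functional `Q_s` -/

theorem gIntegrand_eq (p : R3) (t : ℝ) : gIntegrand α lam s p t =
    t ^ ((1 - s / 2) - 1) * robin α lam t * rk lam t p := by
  rw [gIntegrand, robin, rk, show (1 - s / 2) - 1 = -(s / 2) by ring, div_eq_mul_inv, mul_inv,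
    one_div, ← mul_assoc]

theorem gHat_eq (p : R3) : gHat α lam s p =
    ((4 * Real.sin (Real.pi * (s / 2)) * kap * robinInt α lam (1 - s / 2) p : ℝ) : ℂ) := by
  simp only [gHat, gIntegrand_eq, sin_half_eq, kap_eq, robinInt]
  congr 2
  ring

theorem integrableOn_gIntegrand (hα : 0 ≤ α) (hlam : 0 < lam) (hs : s ∈ Ioo (1 / 2 : ℝ) 2)
    (p : R3) : IntegrableOn (gIntegrand α lam s p) (Ioi 0) :=
  (integrableOn_robinInt (τ := 1 - s / 2) hα hlam (by linarith [hs.2]) (by linarith [hs.1])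
    p).congr (Filter.Eventually.of_forall fun t => (gIntegrand_eq p t).symm)

theorem memLp_gHat (hα : 0 ≤ α) (hlam : 0 < lam) (hs : s ∈ Ioo (1 / 2 : ℝ) 2) :
    MemLp (gHat α lam s) 2 := by
  have h : MemLp (fun p => ((4 * Real.sin (Real.pi * (s / 2)) * kap *
      robinInt α lam (1 - s / 2) p : ℝ) : ℂ)) 2 :=
    ((memLp_robinInt (τ := 1 - s / 2) hα hlam (by linarith [hs.2])
      (by linarith [hs.1])).const_mul _).ofReal
  exact h.ae_eq (Filter.Eventually.of_forall fun p => (gHat_eq p).symm)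

/-- Fubini moves the t-integral onto the kernel, so the functional becomes integration against one
fixed square integrable function. -/
theorem chargeFun_eq_integral (hα : 0 ≤ α) (hlam : 0 < lam) (h0 : 1 / 4 < σ) (h1 : σ < 1)
    {g : R3 → ℂ} (hg : MemLp g 2) : chargeFun α lam σ g =
      ∫ p, ((4 * Real.sin (Real.pi * σ) * kap * robinInt α lam (1 - σ) p : ℝ) : ℂ) * g p := by
  have hm := measurable_robin α lam
  have hgn : MemLp (fun p => ((‖g p‖ : ℝ) : ℂ)) 2 := hg.norm.ofReal
  have hk := kap_pos
  have H : ProdInt lam (fun t => ((t ^ (-σ) * robin α lam t : ℝ) : ℂ)) g := by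
    refine ProdInt.of_fst hlam (Measurable.aestronglyMeasurable (by fun_prop)) hg.1
      (fun t ht => integrable_rk_mul hlam ht.le hg) ?_
    -- The scalar integrability statement applied to |g| is exactly the absolute convergence of the
    -- double integral for g.
    refine ((integrableOn_density hα hlam h0 h1 hgn).norm.const_mul kap⁻¹).congr ?_
    filter_upwards [ae_restrict_mem measurableSet_Ioi] with t ht
    have ht' : (0 : ℝ) < t := ht
    have e : green lam t (fun p => ((‖g p‖ : ℝ) : ℂ)) =
        ((kap * ∫ p, rk lam t p * ‖g p‖ : ℝ) : ℂ) := by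
      rw [green, Complex.ofReal_mul, ← integral_complex_ofReal]
      push_cast
      rfl
    have hnn : 0 ≤ ∫ p, rk lam t p * ‖g p‖ :=
      integral_nonneg fun p => mul_nonneg (rk_pos hlam ht'.le p).le (norm_nonneg _)
    rw [e, norm_mul, Complex.norm_real, Complex.norm_real (kap * _),
      Real.norm_of_nonneg (mul_nonneg hk.le hnn)]
    field_simp
  have e1 : chargeFun α lam σ g = ((4 * Real.sin (Real.pi * σ) * kap : ℝ) : ℂ) *
      ∫ t in Ioi (0 : ℝ), ((t ^ (-σ) * robin α lam t : ℝ) : ℂ) * ∫ p, (rk lam t p : ℂ) * g p := by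
    rw [chargeFun, Complex.ofReal_mul (4 * Real.sin (Real.pi * σ)), mul_assoc (_ : ℂ) (kap : ℂ),
      ← integral_const_mul (kap : ℂ)]
    congr 1
    refine setIntegral_congr_fun measurableSet_Ioi fun t _ => ?_
    simp only [green]
    ring
  rw [e1, H.swap, ← integral_const_mul]
  congr 1
  refine funext fun p => ?_
  have e2 : ∫ t in Ioi (0 : ℝ), ((t ^ (-σ) * robin α lam t : ℝ) : ℂ) * (rk lam t p : ℂ) =
      (robinInt α lam (1 - σ) p : ℂ) := by
    rw [robinInt, ← integral_complex_ofReal]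
    refine setIntegral_congr_fun measurableSet_Ioi fun t _ => ?_
    rw [show 1 - σ - 1 = -σ by ring, Complex.ofReal_mul (_ * _)]
  rw [e2, Complex.ofReal_mul (_ * kap)]
  ring

theorem fracQ_invPow (hα : 0 ≤ α) (hlam : 0 < lam) (hs : s ∈ Ioo (1 / 2 : ℝ) 2) (g : L2) :
    fracQ α lam s (invPow lam s g) = inner ℂ (gFun α lam s) g := by
  have h0 : 0 ≤ s := by linarith [hs.1]
  rw [fracQ_eq, chargeFun_eq_integral hα hlam (by linarith [hs.1]) (by linarith [hs.2])
    (memLp_lift hlam h0 (invPow_mem_Hs hlam h0 g)), inner_eq_integral_hat]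
  refine integral_congr_ae ?_
  filter_upwards [hat_invPow hlam h0 g, hat_ofHat (memLp_gHat hα hlam hs)] with p h1 h2
  rw [lift, h1, gFun, h2, gHat_eq, Complex.conj_ofReal]

theorem gFun_ne_zero (hα : 0 ≤ α) (hlam : 0 < lam) (hs : s ∈ Ioo (1 / 2 : ℝ) 2) :
    gFun α lam s ≠ 0 := by
  intro h
  have h1 := hat_ofHat (memLp_gHat hα hlam hs)
  rw [← gFun, h] at h1
  have h2 : ∀ᵐ _ : R3, False := by
    filter_upwards [h1, hat_smul 0 (0 : L2)] with p h3 h4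
    rw [smul_zero, zero_mul] at h4
    rw [h4, gHat_eq, eq_comm, Complex.ofReal_eq_zero] at h3
    have := robinInt_pos (τ := 1 - s / 2) hα hlam (by linarith [hs.2]) (by linarith [hs.1]) p
    have := sin_pi_mul_pos (σ := s / 2) (by linarith [hs.1]) (by linarith [hs.2])
    have := kap_pos
    exact absurd h3 (by positivity)
  obtain ⟨_, hp⟩ := h2.exists
  exact hp

theorem ker_fracQ (hα : 0 ≤ α) (hlam : 0 < lam) (hs : s ∈ Ioo (1 / 2 : ℝ) 2) :
    {f : L2 | f ∈ Hs s ∧ fracQ α lam s f = 0} =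
      invPow lam s '' {g : L2 | inner ℂ (gFun α lam s) g = 0} := by
  have h0 : 0 ≤ s := by linarith [hs.1]
  ext f
  constructor
  · rintro ⟨hf, hq⟩
    obtain ⟨g, rfl⟩ := exists_invPow_eq hlam h0 hf
    exact ⟨g, by rwa [mem_ofPred_eq, ← fracQ_invPow hα hlam hs], rfl⟩
  · rintro ⟨g, hg, rfl⟩
    exact ⟨invPow_mem_Hs hlam h0 g, by rwa [fracQ_invPow hα hlam hs]⟩

theorem surjOn_fracQ (hα : 0 ≤ α) (hlam : 0 < lam) (hs : s ∈ Ioo (1 / 2 : ℝ) 2) :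
    SurjOn (fracQ α lam s) (Hs s) univ := by
  intro z _
  have hne : inner ℂ (gFun α lam s) (gFun α lam s) ≠ 0 :=
    inner_self_ne_zero.2 (gFun_ne_zero hα hlam hs)
  refine ⟨invPow lam s ((z / inner ℂ (gFun α lam s) (gFun α lam s)) • gFun α lam s),
    invPow_mem_Hs hlam (by linarith [hs.1]) _, ?_⟩
  rw [fracQ_invPow hα hlam hs, inner_smul_right, div_mul_cancel₀ _ hne]

/-- A functional `⟨g, ·⟩` on `L²` has a nontrivial kernel. -/
theorem exists_ne_zero_inner_eq_zero (g : L2) : ∃ u : L2, u ≠ 0 ∧ inner ℂ g u = 0 := by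
  have m0 := memLp_rk_ofReal (t := 0) one_pos le_rfl
  have m1 := memLp_rk_ofReal (t := 1) one_pos zero_le_one
  have hind : ∀ c d : ℂ, c • m0.toLp _ + d • m1.toLp _ = (0 : L2) → c = 0 ∧ d = 0 := by
    intro c d h
    have hc : (fun p : R3 => c * (rk 1 0 p : ℂ) + d * (rk 1 1 p : ℂ)) =ᵐ[volume] fun _ => 0 := by
      filter_upwards [Lp.coeFn_add (c • m0.toLp _) (d • m1.toLp _), Lp.coeFn_smul c (m0.toLp _),
        Lp.coeFn_smul d (m1.toLp _), m0.coeFn_toLp, m1.coeFn_toLp,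
        Lp.coeFn_zero ℂ 2 (volume : Measure R3)] with p h1 h2 h3 h4 h5 h6
      rw [h, h6, Pi.add_apply, h2, h3, Pi.smul_apply, Pi.smul_apply, h4, h5] at h1
      exact h1.symm
    have c0 := continuous_rk (t := 0) one_pos le_rfl
    have c1 := continuous_rk (t := 1) one_pos zero_le_one
    have he := (Continuous.ae_eq_iff_eq volume (by fun_prop) continuous_const).1 hc
    -- Both kernels are continuous, so the relation holds everywhere. Evaluation at p = 0 and at a
    -- unit vector gives an invertible system with rows (1, 1/2) and (1/2, 1/3).
    have e0 := congrFun he 0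
    have e1 := congrFun he (EuclideanSpace.single 0 1)
    simp only [rk, norm_zero, PiLp.norm_single, norm_one] at e0 e1
    norm_num at e0 e1
    constructor
    · linear_combination 4 * e0 - 6 * e1
    · linear_combination -6 * e0 + 12 * e1
  by_cases hg : inner ℂ g (m0.toLp _) = 0
  · refine ⟨m0.toLp _, fun h => ?_, hg⟩
    have := hind 1 0 (by rw [h, smul_zero, zero_smul, add_zero])
    exact one_ne_zero this.1
  · refine ⟨inner ℂ g (m1.toLp _) • m0.toLp _ + (-inner ℂ g (m0.toLp _)) • m1.toLp _,
      fun h => hg (neg_eq_zero.1 (hind _ _ h).2), ?_⟩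
    rw [inner_add_right, inner_smul_right, inner_smul_right]
    ring

theorem invPow_injective (hlam : 0 < lam) (hs : 0 ≤ s) {g h : L2}
    (H : invPow lam s g = invPow lam s h) : g = h := by
  refine hat_injective ((hat_invPow hlam hs g).symm.trans ?_)
  rw [H]
  exact hat_invPow hlam hs h

theorem not_injOn_fracQ (hα : 0 ≤ α) (hlam : 0 < lam) (hs : s ∈ Ioo (1 / 2 : ℝ) 2) :
    ¬ InjOn (fracQ α lam s) (Hs s) := by
  have h0 : 0 ≤ s := by linarith [hs.1]
  intro H
  obtain ⟨u, hu, hg⟩ := exists_ne_zero_inner_eq_zero (gFun α lam s)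
  refine hu (invPow_injective (s := s) hlam h0 (H (invPow_mem_Hs hlam h0 _)
    (invPow_mem_Hs hlam h0 _) ?_))
  rw [fracQ_invPow hα hlam hs, fracQ_invPow hα hlam hs, hg, inner_zero_right]

end

/-! ### Mapping properties of `R_s` -/

section

variable {α lam s : ℝ}

/-- Below the critical exponent every pair is attained by `(R_s, Q_s)`. -/
theorem exists_fracR_eq_and_fracQ_eq (hα : 0 ≤ α) (hlam : 0 < lam)
    (hs : s ∈ Ioo (1 / 2 : ℝ) (3 / 2)) {h : L2} (hh : h ∈ Hs s) (Q : ℂ) :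
    ∃ f ∈ Hs s, fracR α lam s f = h ∧ fracQ α lam s f = Q := by
  have hs' : s ∈ Ioo (1 / 2 : ℝ) 2 := ⟨hs.1, by linarith [hs.2]⟩
  have h0 : 0 ≤ s := by linarith [hs.1]
  have hl := memLp_lift hlam h0 hh
  obtain ⟨f, hf, e⟩ := exists_lift_eq hlam h0 (hl.add (memLp_errFun_of_lt (σ := s / 2) (Q := Q) hα
    hlam (by linarith [hs.1]) (by linarith [hs.2]) hl))
  exact ⟨f, hf, (fracR_eq_and_fracQ_eq_iff hα hlam hs' hf hl .rfl).2 e⟩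

theorem exists_mem_Hs_ne_zero (hlam : 0 < lam) (hs : 0 ≤ s) : ∃ h ∈ Hs s, h ≠ 0 := by
  obtain ⟨u, hu, -⟩ := exists_ne_zero_inner_eq_zero 0
  refine ⟨invPow lam s u, invPow_mem_Hs hlam hs u, fun h => hu (hat_injective ?_)⟩
  have h1 := hat_invPow hlam hs u
  rw [h] at h1
  filter_upwards [h1, lift_zero (lam := lam) (s := s), hat_smul 0 (0 : L2)] with p h2 h3 h4
  rw [smul_zero, zero_mul] at h4
  rw [h4, ← h2]
  exact h3

theorem jIntegrand_eq (hα : 0 ≤ α) (hlam : 0 < lam) (p : R3) (t : ℝ) : jIntegrand α lam s p t =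
    (robin α lam 0)⁻¹ * (t ^ (s / 2 - 1) * robin α lam t * rk lam t p) := by
  have := robin_denom_pos hα hlam le_rfl
  rw [jIntegrand, phi, robin, robin, rk, add_zero, one_div, inv_inv]
  ring

/-- J is the correction for the data (v, Q) = (0, 1), so `fStar` is the preimage of (0, 1). -/
theorem jHat_eq (hα : 0 ≤ α) (hlam : 0 < lam) (p : R3) :
    jHat α lam s p = errFun α lam (s / 2) (fun _ => 0) 1 p := by
  have hb : (robin α lam 0 : ℂ) ≠ 0 := by exact_mod_cast (robin_pos hα hlam le_rfl).ne'
  have hpi : (Real.pi : ℂ) ≠ 0 := by exact_mod_cast Real.pi_ne_zero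
  have e : Real.sin (s * Real.pi / 2) / (Real.pi * (2 * Real.pi) ^ (3 / 2 : ℝ)) =
      Real.sin (Real.pi * (s / 2)) / Real.pi * kap := by
    rw [kap_eq, sin_half_eq]
    field_simp
  rw [errFun_zero_left, jHat, e]
  simp only [jIntegrand_eq hα hlam, integral_const_mul]
  rw [← robinInt, Complex.ofReal_mul, Complex.ofReal_mul, Complex.ofReal_div, Complex.ofReal_mul,
    Complex.ofReal_mul, Complex.ofReal_mul]
  generalize ((Real.sin (Real.pi * (s / 2)) : ℝ) : ℂ) = S
  push_cast
  field_simp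

theorem integrableOn_jIntegrand (hα : 0 ≤ α) (hlam : 0 < lam) (hs : s ∈ Ioo (1 / 2 : ℝ) (3 / 2))
    (p : R3) : IntegrableOn (jIntegrand α lam s p) (Ioi 0) :=
  ((integrableOn_robinInt (τ := s / 2) hα hlam (by linarith [hs.1]) (by linarith [hs.2])
    p).const_mul _).congr (Filter.Eventually.of_forall fun t => (jIntegrand_eq hα hlam p t).symm)

theorem memLp_jHat (hα : 0 ≤ α) (hlam : 0 < lam) (hs : s ∈ Ioo (1 / 2 : ℝ) (3 / 2)) :
    MemLp (jHat α lam s) 2 :=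
  (memLp_errFun_of_lt (σ := s / 2) hα hlam (by linarith [hs.1]) (by linarith [hs.2])
    MemLp.zero').ae_eq (Filter.Eventually.of_forall fun p => (jHat_eq hα hlam p).symm)

theorem fStar_mem (hlam : 0 < lam) (hs : 0 ≤ s) : fStar α lam s ∈ Hs s :=
  invPow_mem_Hs hlam hs _

theorem fracR_fStar_and_fracQ_fStar (hα : 0 ≤ α) (hlam : 0 < lam)
    (hs : s ∈ Ioo (1 / 2 : ℝ) (3 / 2)) :
    fracR α lam s (fStar α lam s) = 0 ∧ fracQ α lam s (fStar α lam s) = 1 := by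
  have h0 : 0 ≤ s := by linarith [hs.1]
  refine (fracR_eq_and_fracQ_eq_iff hα hlam ⟨hs.1, by linarith [hs.2]⟩ (fStar_mem hlam h0)
    MemLp.zero' lift_zero).2 ?_
  filter_upwards [hat_invPow hlam h0 (jFun α lam s), hat_ofHat (memLp_jHat hα hlam hs)] with p h1 h2
  rw [fStar, lift, h1, jFun, h2, jHat_eq hα hlam, zero_add]

theorem fStar_ne_zero (hα : 0 ≤ α) (hlam : 0 < lam) (hs : s ∈ Ioo (1 / 2 : ℝ) (3 / 2)) :
    fStar α lam s ≠ 0 := fun h => by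
  have h1 := (fracR_fStar_and_fracQ_fStar hα hlam hs).2
  rw [h, fracQ_zero hα hlam ⟨hs.1, by linarith [hs.2]⟩] at h1
  exact zero_ne_one h1

/-- A difference of two functions with the same image has data (0, Q). Its lift is then a multiple
of `robinInt`, not square integrable for s/2 ≥ 3/4, so Q = 0 and the difference vanishes. -/
theorem injOn_fracR (hα : 0 ≤ α) (hlam : 0 < lam) (hs : s ∈ Ico (3 / 2 : ℝ) 2) :
    InjOn (fracR α lam s) (Hs s) := by
  have hs' : s ∈ Ioo (1 / 2 : ℝ) 2 := ⟨by linarith [hs.1], hs.2⟩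
  intro f hf g hg hfg
  have hd : (-1 : ℂ) • g + f ∈ Hs s := (Hs s).add_mem ((Hs s).smul_mem _ hg) hf
  have h1 : fracR α lam s ((-1 : ℂ) • g + f) = 0 := by
    rw [fracR_smul_add hα hlam hs' hg hf, hfg]
    simp
  have h2 := (fracR_eq_and_fracQ_eq_iff hα hlam hs' hd MemLp.zero' lift_zero).1 ⟨h1, rfl⟩
  simp only [zero_add] at h2
  have hQ := eq_zero_of_memLp_errFun_zero (σ := s / 2) hα hlam (by linarith [hs.1])
    (by linarith [hs.2]) ((memLp_lift hlam (by linarith [hs.1]) hd).ae_eq h2)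
  rw [hQ] at h2
  have h3 : (-1 : ℂ) • g + f = 0 := by
    refine lift_injective (s := s) hlam ?_
    filter_upwards [h2, lift_zero (lam := lam) (s := s)] with p h4 h5
    rw [h4, h5, errFun_zero_left, zero_div, mul_zero, zero_mul]
  rw [neg_one_smul, neg_add_eq_zero] at h3
  exact h3.symm

/-- A preimage of the target built from `critFun`, whatever its charge, would make the corresponding
correction square integrable. -/
theorem not_surjOn_fracR (hα : 0 ≤ α) (hlam : 0 < lam) :
    ¬ SurjOn (fracR α lam (3 / 2)) (Hs (3 / 2)) (Hs (3 / 2)) := by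
  intro H
  have hs' : (3 / 2 : ℝ) ∈ Ioo (1 / 2 : ℝ) 2 := by norm_num
  have hv : MemLp (fun p => (critFun lam p : ℂ)) 2 := (memLp_critFun hlam).ofReal
  obtain ⟨h, hh, e⟩ := exists_lift_eq (s := 3 / 2) hlam (by norm_num) hv
  obtain ⟨f, hf, hfh⟩ := H hh
  have h1 := (fracR_eq_and_fracQ_eq_iff hα hlam hs' hf hv e).1 ⟨hfh, rfl⟩
  rw [show (3 / 2 / 2 : ℝ) = 3 / 4 by norm_num] at h1
  refine not_memLp_errFun_critFun hα hlam (fracQ α lam (3 / 2) f)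
    (((memLp_lift hlam (by norm_num) hf).sub hv).ae_eq ?_)
  filter_upwards [h1] with p hp
  rw [Pi.sub_apply, hp, add_sub_cancel_left]

theorem surjOn_fracR_of_gt (hα : 0 ≤ α) (hlam : 0 < lam) (hs : s ∈ Ioo (3 / 2 : ℝ) 2) :
    SurjOn (fracR α lam s) (Hs s) (Hs s) := by
  intro h hh
  have h0 : 0 ≤ s := by linarith [hs.1]
  have hl := memLp_lift hlam h0 hh
  obtain ⟨f, hf, e⟩ := exists_lift_eq hlam h0 (hl.add (memLp_errFun_of_gt (σ := s / 2) hα hlam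
    (by linarith [hs.1]) (by linarith [hs.2]) hl))
  exact ⟨f, hf, ((fracR_eq_and_fracQ_eq_iff hα hlam ⟨by linarith [hs.1], hs.2⟩ hf hl .rfl).2 e).1⟩

end

end FractionalMaps

end

/-! ### The theorem -/

theorem mainTheorem6 (α lam : ℝ) (hα : 0 ≤ α) (hlam : 0 < lam) :
    -- the maps `R_s : H^s → H^s` and `Q_s : H^s → ℂ` are well defined and linear
    (∀ s ∈ Ioo (1 / 2 : ℝ) 2,
      (∀ f ∈ Hs s,
        (∀ t : ℝ, 0 ≤ t → Integrable (cIntegrand lam s f t) volume) ∧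
        IntegrableOn (qIntegrand α lam s f) (Ioi 0) volume ∧
        (∀ p : R3, IntegrableOn (wIntegrand α lam s f p) (Ioi 0) volume) ∧
        MemLp (wHat α lam s f) 2 volume) ∧
      MapsTo (fracR α lam s) (Hs s) (Hs s) ∧
      IsLinearMap ℂ (fun f : Hs s => fracR α lam s f) ∧
      IsLinearMap ℂ (fun f : Hs s => fracQ α lam s f)) ∧
    -- (i)
    (∀ s ∈ Ioo (1 / 2 : ℝ) (3 / 2),
      SurjOn (fracR α lam s) (Hs s) (Hs s) ∧
      ¬ InjOn (fracR α lam s) (Hs s) ∧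
      SurjOn (fracQ α lam s) (Hs s) univ ∧
      ¬ InjOn (fracQ α lam s) (Hs s) ∧
      (∃ f ∈ Hs s, fracR α lam s f = 0 ∧ fracQ α lam s f ≠ 0) ∧
      (∃ f ∈ Hs s, fracQ α lam s f = 0 ∧ fracR α lam s f ≠ 0)) ∧
    -- (ii)
    (∀ s ∈ Ioo (1 / 2 : ℝ) (3 / 2),
      (∀ p : R3, IntegrableOn (jIntegrand α lam s p) (Ioi 0) volume) ∧
      MemLp (jHat α lam s) 2 volume ∧
      fStar α lam s ∈ Hs s ∧
      fStar α lam s ≠ 0 ∧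
      fracR α lam s (fStar α lam s) = 0 ∧
      fracQ α lam s (fStar α lam s) = 1) ∧
    -- (iii)
    (∀ s ∈ Ioo (1 / 2 : ℝ) 2,
      (∀ p : R3, IntegrableOn (gIntegrand α lam s p) (Ioi 0) volume) ∧
      MemLp (gHat α lam s) 2 volume ∧
      {f : L2 | f ∈ Hs s ∧ fracQ α lam s f = 0} =
        invPow lam s '' {g : L2 | inner ℂ (gFun α lam s) g = 0}) ∧
    -- (iv)
    (InjOn (fracR α lam (3 / 2)) (Hs (3 / 2)) ∧
      ¬ SurjOn (fracR α lam (3 / 2)) (Hs (3 / 2)) (Hs (3 / 2)) ∧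
      SurjOn (fracQ α lam (3 / 2)) (Hs (3 / 2)) univ ∧
      ¬ InjOn (fracQ α lam (3 / 2)) (Hs (3 / 2))) ∧
    -- (v)
    (∀ s ∈ Ioo (3 / 2 : ℝ) 2,
      BijOn (fracR α lam s) (Hs s) (Hs s) ∧
      SurjOn (fracQ α lam s) (Hs s) univ ∧
      ¬ InjOn (fracQ α lam s) (Hs s)) := by
  have hsub : ∀ {s : ℝ}, s ∈ Ioo (1 / 2 : ℝ) (3 / 2) → s ∈ Ioo (1 / 2 : ℝ) 2 :=
    fun hs => ⟨hs.1, hs.2.trans (by norm_num)⟩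
  have hcrit : (3 / 2 : ℝ) ∈ Ioo (1 / 2 : ℝ) 2 := by norm_num
  have hsup : ∀ {s : ℝ}, s ∈ Ioo (3 / 2 : ℝ) 2 → s ∈ Ioo (1 / 2 : ℝ) 2 :=
    fun hs => ⟨lt_trans (by norm_num) hs.1, hs.2⟩
  have hnonneg : ∀ {s : ℝ}, s ∈ Ioo (1 / 2 : ℝ) 2 → 0 ≤ s := fun hs => by linarith [hs.1]
  refine ⟨fun s hs => ⟨fun f hf => integrable_integrands hα hlam hs hf,
    fun f hf => fracR_mem hα hlam hs hf, isLinearMap_fracR hα hlam hs,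
    isLinearMap_fracQ hα hlam hs⟩, fun s hs => ?_, fun s hs => ?_, fun s hs => ?_, ?_,
    fun s hs => ?_⟩
  · obtain ⟨h, hh, hne⟩ := exists_mem_Hs_ne_zero (s := s) hlam (hnonneg (hsub hs))
    obtain ⟨hR, hQ⟩ := fracR_fStar_and_fracQ_fStar hα hlam hs
    have hm : fStar α lam s ∈ Hs s := fStar_mem hlam (hnonneg (hsub hs))
    refine ⟨fun g hg => ?_, fun H => ?_, surjOn_fracQ hα hlam (hsub hs),
      not_injOn_fracQ hα hlam (hsub hs), ⟨_, hm, hR, hQ ▸ one_ne_zero⟩, ?_⟩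
    · obtain ⟨f, hf, e, -⟩ := exists_fracR_eq_and_fracQ_eq hα hlam hs hg 0
      exact ⟨f, hf, e⟩
    · exact fStar_ne_zero hα hlam hs
        (H hm (Hs s).zero_mem (hR.trans (fracR_zero hα hlam (hsub hs)).symm))
    -- The preimage of (h, 0) with h ≠ 0 lies in the kernel of Q_s but not in that of R_s.
    · obtain ⟨f, hf, e, e'⟩ := exists_fracR_eq_and_fracQ_eq hα hlam hs hh 0
      exact ⟨f, hf, e', e ▸ hne⟩
  · exact ⟨integrableOn_jIntegrand hα hlam hs, memLp_jHat hα hlam hs,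
      fStar_mem hlam (hnonneg (hsub hs)), fStar_ne_zero hα hlam hs,
      fracR_fStar_and_fracQ_fStar hα hlam hs⟩
  · exact ⟨integrableOn_gIntegrand hα hlam hs, memLp_gHat hα hlam hs, ker_fracQ hα hlam hs⟩
  · exact ⟨injOn_fracR hα hlam (by norm_num), not_surjOn_fracR hα hlam,
      surjOn_fracQ hα hlam hcrit, not_injOn_fracQ hα hlam hcrit⟩
  · exact ⟨⟨fun f hf => fracR_mem hα hlam (hsup hs) hf, injOn_fracR hα hlam ⟨hs.1.le, hs.2⟩,
      surjOn_fracR_of_gt hα hlam hs⟩, surjOn_fracQ hα hlam (hsup hs),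
      not_injOn_fracQ hα hlam (hsup hs)⟩
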